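/- Let $X$ be a proper geodesic $\mathrm{CAT}(-1)$ metric space with boundary at infinity $\partial_\infty X$, and let $\Gamma$ be a discrete group of isometries of $X$ that is non-elementary (its limit set $\Lambda\Gamma$ has at least three points) and has finite critical exponent $\delta$. Let $\Gamma_0$ be a subgroup of $\Gamma$ of infinite index, with critical exponent $\delta_0$, which is almost malnormal ($\gamma\Gamma_0\gamma^{-1}\cap\Gamma_0$ is finite for every $\gamma\in\Gamma-\Gamma_0$) and convex-cocompact ($\Lambda\Gamma_0$ has at least two points and $\Gamma_0$ acts with compact quotient on the convex hull $C_0$ of $\Lambda\Gamma_0$ in $X$). Let $x_0\in C_0$. For $\xi\in\partial_\infty X-\Lambda\Gamma_0$, let $\pi_{C_0}(\xi)\in C_0$ be the closest point to $\xi$ on $C_0$ (the closed horoball centred at $\xi$ whose horosphere contains $\pi_{C_0}(\xi)$ meets $C_0$ exactly at this point), and let $t\mapsto\xi_t$ be the geodesic ray from $\pi_{C_0}(\xi)$ to $\xi$. For $\xi,\eta\in\partial_\infty X-\Lambda\Gamma_0$ put $$d_{C_0}(\xi,\eta)=\lim_{t\to+\infty}e^{\frac12 d(\xi_t,\eta_t)-t}.$$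 Let $\partial_\infty X_0=\Gamma_0\backslash(\partial_\infty X-\Lambda\Gamma_0)$, and let $d_0(\overline x,\overline y)=\inf_{x\in\overline x,\,y\in\overline y}d_{C_0}(x,y)$ on it. Let $(\mu_x)_{x\in X}$ be a non-zero conformal density of dimension $\delta$ for $\Gamma$: the $\mu_x$ are finite Borel measures on $\partial_\infty X$, $\gamma_*\mu_x=\mu_{\gamma x}$ for $\gamma\in\Gamma$, and $\frac{d\mu_x}{d\mu_y}(\xi)=e^{-\delta\beta_\xi(x,y)}$, where $\beta_\xi(x,y)=\lim_{t\to+\infty}d(x,\xi_t)-d(y,\xi_t)$ for any geodesic ray $t\mapsto \xi_t$ ending at $\xi$. Let $\mu_{\Gamma_0x_0}$ be the measure on $\partial_\infty X_0$ induced by the $\Gamma_0$-invariant measure $\widetilde\mu=\sum_{\alpha\in\Gamma_0}\mu_{\alpha x_0}$ on $\partial_\infty X-\Lambda\Gamma_0$, that is, $\int f\,d\widetilde\mu=\int\sum_{\alpha\in\Gamma_0}f(\alpha\xi)\,d\mu_{\Gamma_0x_0}(\Gamma_0\xi)$ for all Borel $f\ge 0$. For a double coset $r=\Gamma_0\gamma\Gamma_0$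 with $\gamma\in\Gamma-\Gamma_0$, let $D(r)=d(C_0,\gamma C_0)$, let $\Lambda_r$ be the image of $\gamma\Lambda\Gamma_0$ in $\partial_\infty X_0$, and let $\mathcal N_r(\epsilon)$ be the closed $\epsilon$-neighbourhood of $\Lambda_r$ in $\partial_\infty X_0$ for $d_0$. Then there exist constants $c,c'>0$ such that, for every $r\in\Gamma_0\backslash(\Gamma-\Gamma_0)/\Gamma_0$ and every $\epsilon\in\,]0,c'e^{-D(r)}]$, $$\frac1c\,e^{-\delta_0D(r)}\,\epsilon^{\delta-\delta_0}\;\le\;\mu_{\Gamma_0x_0}(\mathcal N_r(\epsilon))\;\le\;c\,e^{-\delta_0D(r)}\,\epsilon^{\delta-\delta_0}.$$ -/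

import Mathlib

open MeasureTheory Filter Topology Set
open scoped NNReal ENNReal UpperHalfPlane

noncomputable section

namespace Spiral

/-! ### CAT(-1) spaces -/

/-- Geodesic metric spaces satisfying the CAT(-1) comparison inequality. A point `p` lies on a
geodesic segment from `x` to `y` exactly when `dist x p + dist p y = dist x y`; primed points form
a comparison triangle in the hyperbolic plane, with comparison points on its sides. -/
structure IsCATNegOne (X : Type*) [MetricSpace X] : Prop where
  geodesic : ∀ x y : X, ∃ c : ℝ → X, c 0 = x ∧ c (dist x y) = y ∧
    ∀ s ∈ Icc 0 (dist x y), ∀ t ∈ Icc 0 (dist x y), dist (c s) (c t) = |s - t|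
  comparison : ∀ (x y z p q : X) (x' y' z' p' q' : ℍ),
    dist x' y' = dist x y → dist y' z' = dist y z → dist x' z' = dist x z →
    dist x p + dist p y = dist x y → dist x q + dist q z = dist x z →
    dist x' p' = dist x p → dist p' y' = dist p y →
    dist x' q' = dist x q → dist q' z' = dist q z →
    dist p q ≤ dist p' q'

/-- A subset is convex if it contains the geodesic segments between its points. -/
def IsGeodConvex {X : Type*} [MetricSpace X] (C : Set X) : Prop :=
  ∀ x ∈ C, ∀ y ∈ C, ∀ p, dist x p + dist p y = dist x y → p ∈ C

/-! ### The boundary at infinity -/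

/-- Geodesic rays, with the topology of pointwise convergence (which is the topology of uniform
convergence on compact sets, since rays are isometric maps). -/
abbrev GeodesicRay (X : Type*) [MetricSpace X] : Type _ := {ρ : ℝ≥0 → X // Isometry ρ}

/-- Two rays are asymptotic if they stay at bounded distance. -/
instance asymptotic (X : Type*) [MetricSpace X] : Setoid (GeodesicRay X) where
  r ρ σ := ∃ M : ℝ, ∀ t, dist (ρ.1 t) (σ.1 t) ≤ M
  iseqv :=
    { refl := fun ρ => ⟨0, fun t => by simp⟩
      symm := fun ⟨M, h⟩ => ⟨M, fun t => by rw [dist_comm]; exact h t⟩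
      trans := fun ⟨M, h⟩ ⟨N, k⟩ =>
        ⟨M + N, fun t => (dist_triangle _ _ _).trans (add_le_add (h t) (k t))⟩ }

/-- The boundary at infinity: asymptotic classes of geodesic rays, with the quotient topology. -/
def Boundary (X : Type*) [MetricSpace X] : Type _ := Quotient (asymptotic X)

variable {X : Type*} [MetricSpace X]

instance : TopologicalSpace (Boundary X) :=
  inferInstanceAs (TopologicalSpace (Quotient (asymptotic X)))

instance : MeasurableSpace (Boundary X) := borel _

instance : BorelSpace (Boundary X) := ⟨rfl⟩

/-- The point at infinity of a ray. -/
def GeodesicRay.endpoint (ρ : GeodesicRay X) : Boundary X := Quotient.mk (asymptotic X) ρ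

/-- The image of a ray under an isometry. -/
def GeodesicRay.map (g : X ≃ᵢ X) (ρ : GeodesicRay X) : GeodesicRay X :=
  ⟨fun t => g (ρ.1 t), g.isometry.comp ρ.2⟩

/-- The action of isometries on the boundary. -/
instance : MulAction (X ≃ᵢ X) (Boundary X) where
  smul g := Quotient.map (GeodesicRay.map g)
    (fun _ _ ⟨M, h⟩ => ⟨M, fun t => (g.dist_eq _ _).trans_le (h t)⟩)
  one_smul ξ := by
    induction ξ using Quotient.inductionOn with
    | h ρ => rfl
  mul_smul g h ξ := by
    induction ξ using Quotient.inductionOn with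
    | h ρ => rfl

theorem smul_endpoint (g : X ≃ᵢ X) (ρ : GeodesicRay X) :
    g • ρ.endpoint = (ρ.map g).endpoint := rfl

/-- A sequence of points of `X` converges to `ξ` in the cone topology on the union of `X` and its
boundary: for a ray `ρ` ending at `ξ`, the point at distance `t` from `ρ 0` on the geodesic segment
from `ρ 0` to `u n` converges to `ρ t`, for every `t`. -/
def TendstoBoundary (u : ℕ → X) (ξ : Boundary X) : Prop :=
  ∀ ρ : GeodesicRay X, ρ.endpoint = ξ → ∀ t : ℝ≥0, ∀ ε > 0, ∀ᶠ n in atTop,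
    ∃ p, dist (ρ.1 0) p = t ∧ dist (ρ.1 0) p + dist p (u n) = dist (ρ.1 0) (u n) ∧
      dist p (ρ.1 t) < ε

/-- The Busemann function `β_ξ(x, y) = lim (d(x, ξ_t) - d(y, ξ_t))`. -/
def busemann (ξ : Boundary X) (x y : X) : ℝ :=
  limUnder atTop fun t : ℝ≥0 =>
    dist x ((Quotient.out ξ : GeodesicRay X).1 t) - dist y ((Quotient.out ξ : GeodesicRay X).1 t)

/-- `p` is the closest point to the point at infinity `ξ` on `C`: the closed horoball centred at
`ξ` whose horosphere contains `p` meets `C` exactly at `p`. -/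
def IsClosestPoint (C : Set X) (ξ : Boundary X) (p : X) : Prop :=
  p ∈ C ∧ ∀ q ∈ C, busemann ξ q p ≤ 0 → q = p

open Classical in
/-- The geodesic ray starting from the closest point to `ξ` on `C` and converging to `ξ`. -/
def perpRay (C : Set X) (ξ : Boundary X) : GeodesicRay X :=
  if h : ∃ ρ : GeodesicRay X, ρ.endpoint = ξ ∧ IsClosestPoint C ξ (ρ.1 0) then h.choose
  else Quotient.out ξ

/-- The distance-like map `d_C` on the points at infinity outside the boundary of `C`. -/
def convDist (C : Set X) (ξ η : Boundary X) : ℝ :=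
  limUnder atTop fun t : ℝ≥0 =>
    Real.exp (dist ((perpRay C ξ).1 t) ((perpRay C η).1 t) / 2 - t)

/-- The distance between two subsets. -/
def setDist (A B : Set X) : ℝ := ⨅ p : A × B, dist (p.1 : X) (p.2 : X)

/-! ### Groups of isometries -/

/-- Discrete groups of isometries (of a proper space): the action is properly discontinuous. -/
def IsDiscreteGroup (Γ : Subgroup (X ≃ᵢ X)) : Prop :=
  ∀ K : Set X, IsCompact K → {γ | γ ∈ Γ ∧ ((γ '' K) ∩ K).Nonempty}.Finite

/-- The limit set: the accumulation points at infinity of the orbits. -/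
def limitSet (Γ : Subgroup (X ≃ᵢ X)) : Set (Boundary X) :=
  {ξ | ∃ (x : X) (g : ℕ → (X ≃ᵢ X)), (∀ n, g n ∈ Γ) ∧ TendstoBoundary (fun n => g n x) ξ}

/-- Non-elementary groups: the limit set has at least three points. -/
def IsNonElementary (Γ : Subgroup (X ≃ᵢ X)) : Prop := 3 ≤ (limitSet Γ).encard

/-- The convex hull in `X` of a set of points at infinity: the smallest closed convex subset of
`X` containing all geodesic lines with both endpoints in this set. -/
def boundaryHull (Λ : Set (Boundary X)) : Set X :=
  ⋂₀ {C | IsClosed C ∧ IsGeodConvex C ∧ ∀ ℓ : ℝ → X, ∀ ρ σ : GeodesicRay X, Isometry ℓ →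
    (∀ t : ℝ≥0, ρ.1 t = ℓ t) → (∀ t : ℝ≥0, σ.1 t = ℓ (-t)) →
    ρ.endpoint ∈ Λ → σ.endpoint ∈ Λ → range ℓ ⊆ C}

/-- The convex hull of the limit set of a group. -/
def groupHull (Γ : Subgroup (X ≃ᵢ X)) : Set X := boundaryHull (limitSet Γ)

/-- Convex-cocompact groups: the limit set has at least two points and the group acts with compact
quotient on the convex hull of its limit set. -/
def IsConvexCocompact (Γ : Subgroup (X ≃ᵢ X)) : Prop :=
  2 ≤ (limitSet Γ).encard ∧
    ∃ K : Set X, IsCompact K ∧ K ⊆ groupHull Γ ∧ ∀ x ∈ groupHull Γ, ∃ γ ∈ Γ, γ x ∈ K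

/-- Almost malnormal subgroups: `γ Γ₀ γ⁻¹ ∩ Γ₀` is finite for every `γ ∈ Γ - Γ₀`. -/
def IsAlmostMalnormal (Γ₀ Γ : Subgroup (X ≃ᵢ X)) : Prop :=
  ∀ γ ∈ Γ, γ ∉ Γ₀ → {α | α ∈ Γ₀ ∧ γ⁻¹ * α * γ ∈ Γ₀}.Finite

/-- The critical exponent in `[0, ∞]` of the Poincaré series `∑ exp (-s d(x, γ x))`. -/
def criticalExponent (Γ : Subgroup (X ≃ᵢ X)) (x : X) : ℝ≥0∞ :=
  sInf {s | ∃ a : ℝ≥0, s = a ∧ Summable fun γ : Γ => Real.exp (-(a : ℝ) * dist x (γ.1 x))}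

/-- Conformal densities of dimension `δ` for `Γ`. -/
structure IsConformalDensity (Γ : Subgroup (X ≃ᵢ X)) (δ : ℝ) (μ : X → Measure (Boundary X)) :
    Prop where
  finite : ∀ x, IsFiniteMeasure (μ x)
  equivariant : ∀ γ ∈ Γ, ∀ x, (μ x).map (γ • ·) = μ (γ x)
  conformal : ∀ x y, μ x = (μ y).withDensity
    fun ξ => ENNReal.ofReal (Real.exp (-δ * busemann ξ x y))

/-! ### The quotient of the complement of the limit set -/

theorem TendstoBoundary.smul {u : ℕ → X} {ξ : Boundary X} (h : TendstoBoundary u ξ)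
    (g : X ≃ᵢ X) : TendstoBoundary (fun n => g (u n)) (g • ξ) := by
  intro ρ hρ t ε hε
  have h1 : (ρ.map g⁻¹).endpoint = ξ := by
    rw [← smul_endpoint, hρ, inv_smul_smul]
  have e : ∀ s : ℝ≥0, g ((ρ.map g⁻¹).1 s) = ρ.1 s := fun s => g.apply_symm_apply _
  filter_upwards [h _ h1 t ε hε] with n ⟨p, hp1, hp2, hp3⟩
  refine ⟨g p, ?_, ?_, ?_⟩
  · rw [← e 0, g.dist_eq, hp1]
  · rw [← e 0, g.dist_eq, g.dist_eq, g.dist_eq, hp2]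
  · rw [← e t, g.dist_eq]; exact hp3

theorem smul_mem_limitSet {Γ : Subgroup (X ≃ᵢ X)} {γ : X ≃ᵢ X} (hγ : γ ∈ Γ) {ξ : Boundary X}
    (hξ : ξ ∈ limitSet Γ) : γ • ξ ∈ limitSet Γ := by
  obtain ⟨x, g, hg, h⟩ := hξ
  exact ⟨x, fun n => γ * g n, fun n => Γ.mul_mem hγ (hg n), h.smul γ⟩

/-- The complement of the limit set in the boundary. -/
abbrev RegularSet (Γ : Subgroup (X ≃ᵢ X)) : Type _ := {ξ : Boundary X // ξ ∉ limitSet Γ}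

instance (Γ : Subgroup (X ≃ᵢ X)) : MulAction Γ (RegularSet Γ) where
  smul γ ξ := ⟨γ.1 • ξ.1, fun h => ξ.2 (by
    simpa using smul_mem_limitSet (Γ.inv_mem γ.2) h)⟩
  one_smul ξ := Subtype.ext (one_smul _ ξ.1)
  mul_smul a b ξ := Subtype.ext (mul_smul a.1 b.1 ξ.1)

/-- The quotient by `Γ` of the complement of its limit set, with the quotient topology and its
Borel sets. -/
def BoundaryQuot (Γ : Subgroup (X ≃ᵢ X)) : Type _ := MulAction.orbitRel.Quotient Γ (RegularSet Γ)

instance (Γ : Subgroup (X ≃ᵢ X)) : TopologicalSpace (BoundaryQuot Γ) :=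
  inferInstanceAs (TopologicalSpace (Quotient (MulAction.orbitRel Γ (RegularSet Γ))))

instance (Γ : Subgroup (X ≃ᵢ X)) : MeasurableSpace (BoundaryQuot Γ) := borel _

instance (Γ : Subgroup (X ≃ᵢ X)) : BorelSpace (BoundaryQuot Γ) := ⟨rfl⟩

/-- The canonical projection. -/
def quotMk (Γ : Subgroup (X ≃ᵢ X)) (ξ : RegularSet Γ) : BoundaryQuot Γ :=
  Quotient.mk (MulAction.orbitRel Γ (RegularSet Γ)) ξ

theorem quotMk_smul (Γ : Subgroup (X ≃ᵢ X)) (γ : Γ) (ξ : RegularSet Γ) :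
    quotMk Γ (γ • ξ) = quotMk Γ ξ := Quotient.sound ⟨γ, rfl⟩

theorem measurable_quotMk (Γ : Subgroup (X ≃ᵢ X)) : Measurable (quotMk Γ) := by
  have h : Continuous (quotMk Γ) := continuous_quot_mk
  exact h.measurable

/-! ### The measure on a quotient -/

section QuotientMeasure

variable {G Y Q : Type*} [Group G] [MulAction G Y] [MeasurableSpace Y]

/-- Measurable functions `f ≥ 0` on `Y` whose sum over orbits is at most the indicator of the
preimage of `B`. -/
abbrev Packing (G : Type*) {Y Q : Type*} [Group G] [MulAction G Y] [MeasurableSpace Y]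
    (π : Y → Q) (B : Set Q) : Type _ :=
  {f : Y → ℝ≥0∞ // Measurable f ∧ ∀ y, ∑' g : G, f (g • y) ≤ (π ⁻¹' B).indicator 1 y}

/-- The supremum of the integrals of the packing functions. -/
def packingMass (G : Type*) {Y Q : Type*} [Group G] [MulAction G Y] [MeasurableSpace Y]
    (μ : Measure Y) (π : Y → Q) (B : Set Q) : ℝ≥0∞ :=
  ⨆ f : Packing G π B, ∫⁻ y, f.1 y ∂μ

instance {π : Y → Q} {B : Set Q} : Nonempty (Packing G π B) :=
  ⟨⟨fun _ => 0, measurable_const, fun _ => by simp⟩⟩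

theorem Packing.le {π : Y → Q} {B : Set Q} (f : Packing G π B) (y : Y) :
    f.1 y ≤ (π ⁻¹' B).indicator 1 y := by
  refine le_trans ?_ (f.2.2 y)
  simpa using ENNReal.le_tsum (f := fun g : G => f.1 (g • y)) 1

theorem packingMass_empty (μ : Measure Y) (π : Y → Q) : packingMass G μ π ∅ = 0 := by
  refine le_antisymm (iSup_le fun f => ?_) bot_le
  have : ∀ y, f.1 y = 0 := fun y => le_antisymm (by simpa using Packing.le f y) bot_le
  simp [this]

theorem packingMass_mono (μ : Measure Y) (π : Y → Q) {A B : Set Q} (h : A ⊆ B) :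
    packingMass G μ π A ≤ packingMass G μ π B := by
  refine iSup_le fun f => ?_
  refine le_iSup_of_le (⟨f.1, f.2.1, fun y => (f.2.2 y).trans ?_⟩ : Packing G π B) le_rfl
  exact indicator_le_indicator_of_subset (preimage_mono h) (fun _ => bot_le) y

theorem packingMass_add_le (μ : Measure Y) (π : Y → Q) {A B : Set Q} (h : Disjoint A B) :
    packingMass G μ π A + packingMass G μ π B ≤ packingMass G μ π (A ∪ B) := by
  refine ENNReal.iSup_add_iSup_le fun f k => ?_
  rw [← lintegral_add_left f.2.1]
  refine le_iSup_of_le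
    (⟨fun y => f.1 y + k.1 y, f.2.1.add k.2.1, fun y => ?_⟩ : Packing G π (A ∪ B)) le_rfl
  rw [ENNReal.tsum_add, preimage_union, indicator_union_of_disjoint (h.preimage π)]
  exact add_le_add (f.2.2 y) (k.2.2 y)

theorem packingMass_iUnion [MeasurableSpace Q] (μ : Measure Y) (π : Y → Q) (hπ : Measurable π)
    (hG : ∀ (g : G) y, π (g • y) = π y) (B : ℕ → Set Q) (hB : ∀ i, MeasurableSet (B i))
    (hd : Pairwise (Function.onFun Disjoint B)) :
    packingMass G μ π (⋃ i, B i) = ∑' i, packingMass G μ π (B i) := by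
  apply le_antisymm
  · refine iSup_le fun f => ?_
    have h1 : ∫⁻ y, f.1 y ∂μ = ∫⁻ y in ⋃ i, π ⁻¹' B i, f.1 y ∂μ := by
      rw [← lintegral_indicator (MeasurableSet.iUnion fun i => hπ (hB i))]
      congr 1
      ext y
      by_cases hy : y ∈ ⋃ i, π ⁻¹' B i
      · rw [indicator_of_mem hy]
      · rw [indicator_of_notMem hy]
        refine le_antisymm ((Packing.le f y).trans ?_) bot_le
        rw [preimage_iUnion, indicator_of_notMem hy]
    rw [h1, lintegral_iUnion (fun i => hπ (hB i)) (fun i j hij => (hd hij).preimage π)]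
    refine ENNReal.tsum_le_tsum fun i => ?_
    rw [← lintegral_indicator (hπ (hB i))]
    refine le_iSup_of_le (⟨(π ⁻¹' B i).indicator f.1, f.2.1.indicator (hπ (hB i)), fun y => ?_⟩ :
      Packing G π (B i)) le_rfl
    by_cases hy : y ∈ π ⁻¹' B i
    · have hy' : ∀ g : G, g • y ∈ π ⁻¹' B i := fun g => by
        simpa only [mem_preimage, hG] using hy
      simp only [indicator_of_mem (hy' _), indicator_of_mem hy]
      refine (f.2.2 y).trans ?_
      exact indicator_le_self' (fun _ _ => bot_le) y
    · have hy' : ∀ g : G, g • y ∉ π ⁻¹' B i := fun g => by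
        simpa only [mem_preimage, hG] using hy
      simp only [indicator_of_notMem (hy' _), tsum_zero]
      exact bot_le
  · rw [ENNReal.tsum_eq_iSup_sum]
    refine iSup_le fun s => ?_
    have : ∀ s : Finset ℕ, ∑ i ∈ s, packingMass G μ π (B i) ≤
        packingMass G μ π (⋃ i ∈ s, B i) := by
      intro s
      induction s using Finset.induction_on with
      | empty => simp
      | insert a s ha ih =>
        rw [Finset.sum_insert ha, Finset.set_biUnion_insert]
        refine (add_le_add le_rfl ih).trans (packingMass_add_le μ π ?_)
        rw [disjoint_iUnion₂_right]
        intro i hi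
        exact hd (fun h => ha (h ▸ hi))
    exact (this s).trans (packingMass_mono μ π (iUnion₂_subset fun i _ => subset_iUnion B i))

/-- The measure on the quotient `π : Y → Q` of `Y` by a countable group `G` that is induced by a
`G`-invariant measure `μ` on `Y`, that is, the measure `ν` such that
`∫ f dμ = ∫ (∑_g f (g • y)) dν (π y)`. Its value at `B` is the supremum of the integrals of the
measurable functions `f ≥ 0` with `∑_g f (g • y) ≤ 1_B (π y)`. -/
def quotientMeasure (G : Type*) {Y Q : Type*} [Group G] [MulAction G Y] [MeasurableSpace Y]
    [MeasurableSpace Q] (μ : Measure Y) (π : Y → Q) (hπ : Measurable π)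
    (hG : ∀ (g : G) y, π (g • y) = π y) : Measure Q :=
  Measure.ofMeasurable (fun B _ => packingMass G μ π B) (packingMass_empty μ π)
    (fun B hB hd => packingMass_iUnion μ π hπ hG B hB hd)

/-- For any measurable weight `w` with sum `1` over orbits (for instance the indicator of a
fundamental domain of a free action), the quotient measure is the image of `w μ`. -/
theorem quotientMeasure_apply [MeasurableSpace Q] [Countable G] (μ : Measure Y)
    (hm : ∀ g : G, MeasurePreserving (fun y : Y => g • y) μ μ) (π : Y → Q) (hπ : Measurable π)
    (hG : ∀ (g : G) y, π (g • y) = π y) (w : Y → ℝ≥0∞) (hw : Measurable w)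
    (hw1 : ∀ y, ∑' g : G, w (g • y) = 1) {B : Set Q} (hB : MeasurableSet B) :
    quotientMeasure G μ π hπ hG B = ∫⁻ y in π ⁻¹' B, w y ∂μ := by
  rw [quotientMeasure, Measure.ofMeasurable_apply B hB]
  apply le_antisymm
  · refine iSup_le fun f => ?_
    have hmeas : ∀ g : G, Measurable fun y => f.1 (g • y) :=
      fun g => f.2.1.comp (hm g).measurable
    calc ∫⁻ y, f.1 y ∂μ = ∫⁻ y, ∑' g : G, f.1 y * w (g • y) ∂μ := by
          simp only [ENNReal.tsum_mul_left, hw1, mul_one]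
      _ = ∑' g : G, ∫⁻ y, f.1 y * w (g • y) ∂μ :=
          lintegral_tsum fun g => (f.2.1.mul (hw.comp (hm g).measurable)).aemeasurable
      _ = ∑' g : G, ∫⁻ y, f.1 (g⁻¹ • y) * w y ∂μ := by
          refine tsum_congr fun g => ?_
          have := (hm g).lintegral_comp (f := fun y => f.1 (g⁻¹ • y) * w y)
            ((hmeas g⁻¹).mul hw)
          simpa only [inv_smul_smul] using this
      _ = ∑' g : G, ∫⁻ y, f.1 (g • y) * w y ∂μ :=
          (Equiv.inv G).tsum_eq fun g : G => ∫⁻ y, f.1 (g • y) * w y ∂μ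
      _ = ∫⁻ y, (∑' g : G, f.1 (g • y)) * w y ∂μ := by
          simp only [← ENNReal.tsum_mul_right]
          exact (lintegral_tsum fun g => ((hmeas g).mul hw).aemeasurable).symm
      _ ≤ ∫⁻ y, (π ⁻¹' B).indicator w y ∂μ := by
          refine lintegral_mono fun y => ?_
          refine (mul_le_mul_left (f.2.2 y) (w y)).trans ?_
          by_cases hy : y ∈ π ⁻¹' B <;> simp [indicator_of_mem, indicator_of_notMem, hy]
      _ = ∫⁻ y in π ⁻¹' B, w y ∂μ := lintegral_indicator (hπ hB) _
  · rw [← lintegral_indicator (hπ hB)]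
    refine le_iSup_of_le (⟨(π ⁻¹' B).indicator w, hw.indicator (hπ hB), fun y => ?_⟩ :
      Packing G π B) le_rfl
    by_cases hy : y ∈ π ⁻¹' B
    · rw [indicator_of_mem hy, Pi.one_apply, ← hw1 y]
      exact ENNReal.tsum_le_tsum fun g => indicator_le_self' (fun _ _ => bot_le) _
    · have hy' : ∀ g : G, g • y ∉ π ⁻¹' B := fun g => by
        simpa only [mem_preimage, hG] using hy
      simp only [indicator_of_notMem (hy' _), tsum_zero]
      exact bot_le

end QuotientMeasure

/-! ### The objects attached to a double coset -/

/-- The measure `∑_{α ∈ Γ₀} μ_{α x₀}` on the complement of the limit set of `Γ₀`. -/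
def orbitSumMeasure (Γ₀ : Subgroup (X ≃ᵢ X)) (μ : X → Measure (Boundary X)) (x₀ : X) :
    Measure (RegularSet Γ₀) :=
  (Measure.sum fun α : Γ₀ => μ (α.1 x₀)).comap Subtype.val

/-- The measure `μ_{Γ₀ x₀}` on the quotient of the complement of the limit set of `Γ₀`. -/
def quotMeasure (Γ₀ : Subgroup (X ≃ᵢ X)) (μ : X → Measure (Boundary X)) (x₀ : X) :
    Measure (BoundaryQuot Γ₀) :=
  quotientMeasure Γ₀ (orbitSumMeasure Γ₀ μ x₀) (quotMk Γ₀) (measurable_quotMk Γ₀) (quotMk_smul Γ₀)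

/-- The quotient distance-like map `d₀`. -/
def quotDist (Γ₀ : Subgroup (X ≃ᵢ X)) (a b : BoundaryQuot Γ₀) : ℝ :=
  sInf {d | ∃ ξ η : RegularSet Γ₀, quotMk Γ₀ ξ = a ∧ quotMk Γ₀ η = b ∧
    d = convDist (groupHull Γ₀) ξ.1 η.1}

/-- `D(r) = d(C₀, γ C₀)` for the double coset `r = Γ₀ γ Γ₀`. -/
def cosetDepth (Γ₀ : Subgroup (X ≃ᵢ X)) (γ : X ≃ᵢ X) : ℝ :=
  setDist (groupHull Γ₀) (γ '' groupHull Γ₀)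

/-- The image `Λ_r` of `γ ΛΓ₀` in the quotient, for the double coset `r = Γ₀ γ Γ₀`. -/
def cosetLimitSet (Γ₀ : Subgroup (X ≃ᵢ X)) (γ : X ≃ᵢ X) : Set (BoundaryQuot Γ₀) :=
  quotMk Γ₀ '' {ξ | ∃ ζ ∈ limitSet Γ₀, ξ.1 = γ • ζ}

/-- The closed `ε`-neighbourhood of `Λ_r` for `d₀`. -/
def cosetNhd (Γ₀ : Subgroup (X ≃ᵢ X)) (γ : X ≃ᵢ X) (ε : ℝ) : Set (BoundaryQuot Γ₀) :=
  {a | ∃ b ∈ cosetLimitSet Γ₀ γ, quotDist Γ₀ a b ≤ ε}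

end Spiral

end

noncomputable section

namespace Spiral

/-! ### Comparison with the hyperbolic plane -/

/-! Seen from `o = x₀`, the theorem is a count of shadows. Multiplying γ on both sides by elements
of Γ₀ brings d(o, γo) within a constant of D(r) (`exists_isReduced`). Almost malnormality and a
pigeonhole argument then give a single bound on how long C₀ and such a translate γC₀ can run
together from o (`exists_uniform_gp_bound`). Hence γΛΓ₀ projects to C₀ near o, and a segment from o
to a point of γC₀ essentially goes to γo and then follows γC₀.

Put T = -log ε. If a point is ε-close to γΛΓ₀, its perpendicular ray follows one ending in γΛΓ₀ for
a time about T. So, up to Γ₀, the point lies in the shadow of some γαo with α in Γ₀ and d(o, αo)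
about T - D(r) (`exists_shadow_of_mem_cosetNhd`). Conversely, points projecting to γC₀ near such a
γαo, slightly farther out, are ε-close to γΛΓ₀ (`mem_cosetNhd_of_translate_mem_nearSet`). There are
about exp(δ₀(T - D(r))) such α and each contributes mass about exp(-δT). The product is exp(-δ₀D(r))
ε^(δ-δ₀).

The count of orbit points in annuli must be exact up to a factor. The lower bound
(`exp_le_card_annulus`) factors long elements along the convex core: if annuli were too small, the
Poincaré series would converge below its exponent. The upper bound (`card_annulus_le`) is a
dichotomy: either finitely many elements push orbit points away from any direction, and a shadow
argument on the Poincaré series applies, or the group fixes a point at infinity and its annuli have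
bounded size.

The mass of a shadow is bounded above by conformality alone (`measure_shadow_le`). Below, the
translates of `nearSet`, the points projecting near o, are used: this set is not null
(`measure_nearSet_ne_zero`) and its translates overlap boundedly. The same overlap shows that the
Poincaré series of Γ₀ converges at δ, which compares the quotient measure with μ_o on `nearSet`. -/

/-- Distances in the upper half-plane to the points of the imaginary axis. -/
theorem cosh_dist_axis (z : ℍ) (a : ℝ) :
    Real.cosh (dist (UpperHalfPlane.mk ⟨0, Real.exp a⟩ (Real.exp_pos a)) z) =
      (z.re ^ 2 + z.im ^ 2) / (2 * z.im) * Real.exp (-a) + 1 / (2 * z.im) * Real.exp a := by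
  have hz := z.im_pos
  have he := Real.exp_pos a
  rw [UpperHalfPlane.cosh_dist']
  have h1 : (UpperHalfPlane.mk ⟨0, Real.exp a⟩ (Real.exp_pos a)).re = 0 := rfl
  have h2 : (UpperHalfPlane.mk ⟨0, Real.exp a⟩ (Real.exp_pos a)).im = Real.exp a := rfl
  rw [h1, h2, Real.exp_neg]
  field_simp
  ring

/-- Along the imaginary axis cosh of the distance to z has the form A exp(-a) + B exp(a), with B =
1/(2 im z) and A/B = |z|². Prescribing the values at a = 0 and a = L determines A and B, hence z.
This produces the comparison triangle together with the length of every cevian. -/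
theorem exists_comparison_point {L r s : ℝ} (hL : 0 < L) (hr : 0 ≤ r) (hs : 0 ≤ s)
    (h1 : L ≤ r + s) (h2 : r ≤ L + s) (h3 : s ≤ L + r) :
    ∃ z : ℍ, ∀ a : ℝ,
      Real.cosh (dist (UpperHalfPlane.mk ⟨0, Real.exp a⟩ (Real.exp_pos a)) z) * Real.sinh L =
        Real.cosh r * Real.sinh (L - a) + Real.cosh s * Real.sinh a := by
  have hS : 0 < Real.sinh L := Real.sinh_pos_iff.2 hL
  have hu : Real.cosh s ≤ Real.cosh (r + L) := by
    rw [Real.cosh_le_cosh, abs_of_nonneg hs, abs_of_nonneg (by linarith)]; linarith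
  have hl : Real.cosh (r - L) ≤ Real.cosh s := by
    rw [Real.cosh_le_cosh, abs_of_nonneg hs, abs_le]; constructor <;> linarith
  have hsr : Real.sinh r < Real.cosh r := Real.sinh_lt_cosh r
  have hsL : Real.sinh L < Real.cosh L := Real.sinh_lt_cosh L
  rw [Real.cosh_add] at hu
  rw [Real.cosh_sub] at hl
  have er := Real.cosh_sq r
  have eL := Real.cosh_sq L
  have eL1 : Real.exp L = Real.cosh L + Real.sinh L := (Real.cosh_add_sinh L).symm
  have eL2 : Real.exp (-L) = Real.cosh L - Real.sinh L := (Real.cosh_sub_sinh L).symm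
  have hpr : 0 < Real.sinh L * (Real.cosh r - Real.sinh r) := mul_pos hS (by linarith)
  set A : ℝ := (Real.cosh r * Real.exp L - Real.cosh s) / (2 * Real.sinh L) with hA
  set B : ℝ := (Real.cosh s - Real.cosh r * Real.exp (-L)) / (2 * Real.sinh L) with hB
  have hBpos : 0 < B := by
    apply div_pos _ (by linarith); rw [eL2]; nlinarith
  -- This is the condition (re z)² ≥ 0. After clearing denominators it reads (cosh(r + L) - cosh
  -- s)(cosh s - cosh(r - L)) ≥ 0, which is where the triangle inequalities enter.
  have hAB : 1 ≤ 4 * (A * B) := by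
    have : 4 * (A * B) = ((Real.cosh r * Real.exp L - Real.cosh s) *
        (Real.cosh s - Real.cosh r * Real.exp (-L))) / (Real.sinh L) ^ 2 := by
      rw [hA, hB]; field_simp; ring
    rw [this, le_div_iff₀ (by positivity), eL1, eL2]
    nlinarith [mul_nonneg (sub_nonneg.2 hu) (sub_nonneg.2 hl)]
  have hv : 0 < 1 / (2 * B) := by positivity
  have hN : 0 ≤ A / B - (1 / (2 * B)) ^ 2 := by
    have : A / B - (1 / (2 * B)) ^ 2 = (4 * (A * B) - 1) / (4 * B ^ 2) := by field_simp; ring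
    rw [this]; apply div_nonneg <;> nlinarith [sq_nonneg B]
  refine ⟨UpperHalfPlane.mk ⟨√(A / B - (1 / (2 * B)) ^ 2), 1 / (2 * B)⟩ hv, fun a => ?_⟩
  rw [cosh_dist_axis]
  have e1 : (UpperHalfPlane.mk ⟨√(A / B - (1 / (2 * B)) ^ 2), 1 / (2 * B)⟩ hv).re =
    √(A / B - (1 / (2 * B)) ^ 2) := rfl
  have e2 : (UpperHalfPlane.mk ⟨√(A / B - (1 / (2 * B)) ^ 2), 1 / (2 * B)⟩ hv).im =
    1 / (2 * B) := rfl
  rw [e1, e2, Real.sq_sqrt hN]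
  have e3 : (A / B - (1 / (2 * B)) ^ 2 + (1 / (2 * B)) ^ 2) / (2 * (1 / (2 * B))) = A := by
    field_simp; ring
  have e4 : 1 / (2 * (1 / (2 * B))) = B := by field_simp
  rw [e3, e4, hA, hB, Real.sinh_eq (L - a), Real.sinh_eq a, sub_eq_add_neg L a, neg_add,
    Real.exp_add, Real.exp_add, neg_neg]
  field_simp
  ring

/-- The CAT(-1) inequality for the distance between a vertex of a triangle and a point of the
opposite side. -/
theorem IsCATNegOne.cosh_dist_le {X : Type*} [MetricSpace X] (hX : IsCATNegOne X) {x y p : X}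
    (z : X) (hp : dist x p + dist p y = dist x y) :
    Real.cosh (dist p z) * Real.sinh (dist x y) ≤
      Real.cosh (dist x z) * Real.sinh (dist p y) + Real.cosh (dist y z) * Real.sinh
          (dist x p) := by
  rcases (dist_nonneg : 0 ≤ dist x y).eq_or_lt with h0 | hL
  · rw [← h0]
    have := Real.cosh_pos (dist x z)
    have := Real.cosh_pos (dist y z)
    have := Real.sinh_nonneg_iff.2 (dist_nonneg : 0 ≤ dist x p)
    have := Real.sinh_nonneg_iff.2 (dist_nonneg : 0 ≤ dist p y)
    rw [Real.sinh_zero, mul_zero]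
    positivity
  · obtain ⟨z', hz'⟩ := exists_comparison_point hL (dist_nonneg : 0 ≤ dist x z)
      (dist_nonneg : 0 ≤ dist y z)
      (by rw [dist_comm y z]; exact dist_triangle x z y) (dist_triangle x y z)
      (by rw [dist_comm x y]; exact dist_triangle y x z)
    have hS : 0 < Real.sinh (dist x y) := Real.sinh_pos_iff.2 hL
    have hinj : ∀ {a b : ℝ}, 0 ≤ a → 0 ≤ b → Real.cosh a = Real.cosh b → a = b :=
      fun ha hb h => Real.cosh_injOn ha hb h
    have hiso := UpperHalfPlane.isometry_vertical_line 0
    have hd : ∀ a b : ℝ, dist (UpperHalfPlane.mk ⟨0, Real.exp a⟩ (Real.exp_pos a))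
        (UpperHalfPlane.mk ⟨0, Real.exp b⟩ (Real.exp_pos b)) = |a - b| := fun a b => by
      rw [hiso.dist_eq, Real.dist_eq]
    have hpy : dist p y = dist x y - dist x p := by linarith
    -- The second comparison point is the vertex z itself, so only cevians are compared.
    have key := hX.comparison x y z p z (UpperHalfPlane.mk ⟨0, Real.exp 0⟩ (Real.exp_pos 0))
      (UpperHalfPlane.mk ⟨0, Real.exp (dist x y)⟩ (Real.exp_pos _)) z'
      (UpperHalfPlane.mk ⟨0, Real.exp (dist x p)⟩ (Real.exp_pos _)) z'
      (by rw [hd, zero_sub, abs_neg, abs_of_pos hL])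
      (by
        refine hinj dist_nonneg dist_nonneg ?_
        have := hz' (dist x y)
        rw [sub_self, Real.sinh_zero, mul_zero, zero_add] at this
        exact mul_right_cancel₀ hS.ne' this)
      (by
        refine hinj dist_nonneg dist_nonneg ?_
        have := hz' 0
        rw [sub_zero, Real.sinh_zero, mul_zero, add_zero] at this
        exact mul_right_cancel₀ hS.ne' this)
      hp (by simp)
      (by rw [hd, zero_sub, abs_neg, abs_of_nonneg dist_nonneg])
      (by
        have := (dist_nonneg : 0 ≤ dist p y)
        rw [hd, abs_sub_comm, abs_of_nonneg (by linarith), hpy])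
      (by
        refine hinj dist_nonneg dist_nonneg ?_
        have := hz' 0
        rw [sub_zero, Real.sinh_zero, mul_zero, add_zero] at this
        exact mul_right_cancel₀ hS.ne' this)
      (by simp)
    rw [hpy, ← hz' (dist x p)]
    refine mul_le_mul_of_nonneg_right ?_ hS.le
    rw [Real.cosh_le_cosh, abs_of_nonneg dist_nonneg, abs_of_nonneg dist_nonneg]
    exact key

/-! ### Hyperbolicity -/

/-- The hyperbolicity constant. -/
def κ : ℝ := Real.log 4

theorem κ_pos : 0 < κ := Real.log_pos (by norm_num)

section Hyperbolicity

variable {X : Type*} [MetricSpace X]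

/-- The Gromov product of `u` and `w` seen from `o`. -/
def gp (o u w : X) : ℝ := (dist o u + dist o w - dist u w) / 2

theorem gp_comm (o u w : X) : gp o u w = gp o w u := by
  unfold gp; rw [dist_comm u w]; ring

theorem gp_nonneg (o u w : X) : 0 ≤ gp o u w := by
  have := dist_triangle u o w
  rw [dist_comm u o] at this
  unfold gp; linarith

theorem gp_le_left (o u w : X) : gp o u w ≤ dist o u := by
  have := dist_triangle o u w
  unfold gp; linarith

theorem gp_le_right (o u w : X) : gp o u w ≤ dist o w := by
  rw [gp_comm]; exact gp_le_left o w u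

theorem gp_add (o u w : X) : gp o u w + gp u o w = dist o u := by
  unfold gp; rw [dist_comm u o]; ring

theorem gp_le_add_dist (o u w v : X) : gp o u w ≤ gp o u v + dist w v := by
  have h1 := dist_triangle o v w
  have h2 := dist_triangle u w v
  rw [dist_comm v w] at h1
  unfold gp; linarith

theorem gp_map (g : X ≃ᵢ X) (o u w : X) : gp (g o) (g u) (g w) = gp o u w := by
  simp only [gp, g.dist_eq]

theorem IsCATNegOne.exists_point (hX : IsCATNegOne X) (x y : X) {t : ℝ} (h0 : 0 ≤ t)
    (ht : t ≤ dist x y) :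
    ∃ p, dist x p = t ∧ dist p y = dist x y - t ∧ dist x p + dist p y = dist x y := by
  obtain ⟨c, h1, h2, h3⟩ := hX.geodesic x y
  have e1 := h3 0 ⟨le_rfl, dist_nonneg⟩ t ⟨h0, ht⟩
  have e2 := h3 t ⟨h0, ht⟩ (dist x y) ⟨dist_nonneg, le_rfl⟩
  rw [h1, zero_sub, abs_neg, abs_of_nonneg h0] at e1
  rw [h2, abs_sub_comm, abs_of_nonneg (by linarith)] at e2
  exact ⟨c t, e1, e2, by rw [e1, e2]; ring⟩

/-- The weights sinh b / sinh(a + b) of the exact cevian inequality are at most exp(-a). -/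
theorem IsCATNegOne.cosh_dist_le_exp (hX : IsCATNegOne X) {x y p : X} (z : X)
    (hp : dist x p + dist p y = dist x y) :
    Real.cosh (dist p z) ≤ Real.cosh (dist x z) * Real.exp (-dist x p) +
      Real.cosh (dist y z) * Real.exp (-dist p y) := by
  rcases (dist_nonneg : 0 ≤ dist x y).eq_or_lt with h0 | hL
  · have h1 : dist x p = 0 := by
      have := (dist_nonneg : 0 ≤ dist x p); have := (dist_nonneg : 0 ≤ dist p y); linarith
    have h2 : dist p y = 0 := by linarith
    have := Real.cosh_pos (dist y z)
    rw [h1, h2, dist_eq_zero.1 h1]; simp [this.le]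
  · have hS : 0 < Real.sinh (dist x y) := Real.sinh_pos_iff.2 hL
    have hle : ∀ a b : ℝ, 0 ≤ a → 0 ≤ b → Real.sinh b ≤ Real.exp (-a) * Real.sinh (a + b) := by
      intro a b ha hb
      rw [Real.sinh_eq, Real.sinh_eq]
      have e1 : Real.exp (-a) * ((Real.exp (a + b) - Real.exp (-(a + b))) / 2) =
          (Real.exp b - Real.exp (-(2 * a + b))) / 2 := by
        have e1 : Real.exp b = Real.exp (-a) * Real.exp (a + b) := by
          rw [← Real.exp_add]; congr 1; ring
        have e2 : Real.exp (-(2 * a + b)) = Real.exp (-a) * Real.exp (-(a + b)) := by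
          rw [← Real.exp_add]; congr 1; ring
        rw [e1, e2]; ring
      rw [e1]
      have : Real.exp (-(2 * a + b)) ≤ Real.exp (-b) := Real.exp_le_exp.2 (by linarith)
      linarith
    have h1 := hle (dist x p) (dist p y) dist_nonneg dist_nonneg
    have h2 := hle (dist p y) (dist x p) dist_nonneg dist_nonneg
    rw [hp] at h1
    rw [add_comm, hp] at h2
    have h3 := hX.cosh_dist_le z hp
    have c1 := Real.cosh_pos (dist x z)
    have c2 := Real.cosh_pos (dist y z)
    refine le_of_mul_le_mul_right ?_ hS
    calc _ ≤ _ := h3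
      _ ≤ Real.cosh (dist x z) * (Real.exp (-dist x p) * Real.sinh (dist x y)) +
          Real.cosh (dist y z) * (Real.exp (-dist p y) * Real.sinh (dist x y)) := by gcongr
      _ = _ := by ring

/-- Triangles are thin: the distance to a point of a geodesic segment is, up to a constant, the
one in a tree. -/
theorem IsCATNegOne.dist_le_max (hX : IsCATNegOne X) {x y p : X} (z : X)
    (hp : dist x p + dist p y = dist x y) :
    dist p z ≤ max (dist x z - dist x p) (dist y z - dist p y) + κ := by
  have h := hX.cosh_dist_le_exp z hp
  set m := max (dist x z - dist x p) (dist y z - dist p y) with hm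
  have hc : ∀ a b : ℝ, 0 ≤ a → a - b ≤ m → Real.cosh a * Real.exp (-b) ≤ Real.exp m := by
    intro a b ha hab
    have : Real.cosh a ≤ Real.exp a := by
      rw [Real.cosh_eq]
      have : Real.exp (-a) ≤ Real.exp a := Real.exp_le_exp.2 (by linarith)
      linarith
    calc Real.cosh a * Real.exp (-b) ≤ Real.exp a * Real.exp (-b) := by gcongr
      _ = Real.exp (a - b) := by rw [← Real.exp_add]; rfl
      _ ≤ _ := Real.exp_le_exp.2 hab
  have h1 := hc (dist x z) (dist x p) dist_nonneg (le_max_left _ _)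
  have h2 := hc (dist y z) (dist p y) dist_nonneg (le_max_right _ _)
  -- One factor 2 comes from here and one from the two terms bounded by exp m, whence κ = log 4.
  have h3 : Real.exp (dist p z) ≤ 2 * Real.cosh (dist p z) := by
    rw [Real.cosh_eq]; have := Real.exp_pos (-dist p z); linarith
  rw [← Real.exp_le_exp, Real.exp_add, κ, Real.exp_log (by norm_num)]
  linarith

/-- Thinness is used twice: for p on [o, u] with opposite vertex w, then for q on [o, w] with
opposite vertex p. -/
theorem IsCATNegOne.fellow_travel' (hX : IsCATNegOne X) {o u w p q : X}
    (hp : dist o p + dist p u = dist o u)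
    (hq : dist o q + dist q w = dist o w) (hpq : dist o p = dist o q) :
    dist p q ≤ max 0 (2 * dist o p - 2 * gp o u w) + 2 * κ := by
  have h1 := hX.dist_le_max w hp
  have h2 := hX.dist_le_max p hq
  rw [dist_comm q p, dist_comm w p, hpq, sub_self] at h2
  have hk := κ_pos
  unfold gp
  rcases max_cases (dist o w - dist o p) (dist u w - dist p u) with ⟨e, -⟩ | ⟨e, -⟩ <;>
  rcases max_cases 0 (dist p w - dist q w) with ⟨e', -⟩ | ⟨e', -⟩ <;>
  rcases max_cases 0 (2 * dist o p - 2 * ((dist o u + dist o w - dist u w) / 2)) with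
    ⟨e'', h''⟩ | ⟨e'', h''⟩ <;>
  rw [e] at h1 <;> rw [e'] at h2 <;> rw [e''] <;> linarith

/-- Geodesic segments from `o` to `u` and `w` stay close up to the time `gp o u w`. -/
theorem IsCATNegOne.fellow_travel (hX : IsCATNegOne X) {o u w p q : X}
    (hp : dist o p + dist p u = dist o u)
    (hq : dist o q + dist q w = dist o w) (hpq : dist o p = dist o q)
    (ht : dist o p ≤ gp o u w) : dist p q ≤ 2 * κ := by
  have := hX.fellow_travel' hp hq hpq
  rwa [max_eq_left (by linarith), zero_add] at this

/-- At the time given by the minimum, the points on [o, u] and [o, w] are both 2κ-close to the one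
on [o, v]. The resulting path from u to w has an excess of 4κ, which is halved in the Gromov
product. -/
theorem IsCATNegOne.gp_min (hX : IsCATNegOne X) (o u v w : X) :
    min (gp o u v) (gp o v w) ≤ gp o u w + 2 * κ := by
  set t := min (gp o u v) (gp o v w) with ht
  have h0 : 0 ≤ t := le_min (gp_nonneg _ _ _) (gp_nonneg _ _ _)
  have h1 : t ≤ gp o u v := min_le_left _ _
  have h2 : t ≤ gp o v w := min_le_right _ _
  obtain ⟨p, p1, p2, p3⟩ := hX.exists_point o u h0 (h1.trans (gp_le_left _ _ _))
  obtain ⟨q, q1, q2, q3⟩ := hX.exists_point o v h0 (h1.trans (gp_le_right _ _ _))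
  obtain ⟨r, r1, r2, r3⟩ := hX.exists_point o w h0 (h2.trans (gp_le_right _ _ _))
  have e1 := hX.fellow_travel p3 q3 (by rw [p1, q1]) (by rw [p1]; exact h1)
  have e2 := hX.fellow_travel q3 r3 (by rw [q1, r1]) (by rw [q1]; exact h2)
  have e3 := dist_triangle4 u p r w
  have e4 := dist_triangle p q r
  rw [dist_comm u p] at e3
  have : gp o u w = (dist o u + dist o w - dist u w) / 2 := rfl
  linarith

theorem IsCATNegOne.gp_le_of_le (hX : IsCATNegOne X) {o u v w : X} {a : ℝ} (h : gp o u w ≤ a)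
    (h' : a + 2 * κ < gp o v w) : gp o u v ≤ a + 2 * κ := by
  have := hX.gp_min o u v w
  by_contra! hc
  have : a + 2 * κ < min (gp o u v) (gp o v w) := lt_min hc h'
  linarith

theorem IsCATNegOne.le_gp_of_le (hX : IsCATNegOne X) {o u v w : X} {a : ℝ} (h : a ≤ gp o u v)
    (h' : a ≤ gp o v w) : a - 2 * κ ≤ gp o u w := by
  have := hX.gp_min o u v w
  have : a ≤ min (gp o u v) (gp o v w) := le_min h h'
  linarith

/-! ### Sharp estimates -/

/-- A broken geodesic from `y` to `u` through a point `p` that lies on a geodesic segment from `x`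
to `u`, far away from `x` and `y`, is almost a geodesic. -/
theorem IsCATNegOne.exp_dist_ge (hX : IsCATNegOne X) {x u p : X} (y : X)
    (hp : dist x p + dist p u = dist x u)
    (ht : 0 < dist x p) :
    Real.exp (dist y p + dist p u) *
      (1 - Real.cosh (dist x y) * Real.exp (dist x y - dist x p) / Real.sinh (dist x p)) ≤
      Real.exp (dist y u) := by
  have h := hX.cosh_dist_le y hp
  set t := dist x p
  set b := dist p u
  set r := dist x y
  have hS : 0 < Real.sinh t := Real.sinh_pos_iff.2 ht
  rw [← hp, Real.sinh_add, dist_comm p y, dist_comm u y] at h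
  set a := dist y p with ha
  set e := dist y u with he
  have hb : 0 ≤ b := dist_nonneg
  have hr : 0 < Real.cosh r := Real.cosh_pos r
  have hsc : Real.sinh t < Real.cosh t := Real.sinh_lt_cosh t
  have hsb : 0 ≤ Real.sinh b := Real.sinh_nonneg_iff.2 hb
  have hca : 0 < Real.cosh a := Real.cosh_pos a
  have eb : Real.cosh b + Real.sinh b = Real.exp b := Real.cosh_add_sinh b
  have h1 : Real.cosh a * Real.exp b - Real.cosh r * Real.sinh b / Real.sinh t ≤ Real.cosh e := by
    rw [sub_le_iff_le_add, ← eb]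
    refine le_of_mul_le_mul_right ?_ hS
    rw [add_mul, div_mul_cancel₀ _ hS.ne']
    have : Real.cosh a * (Real.sinh t * Real.sinh b) ≤ Real.cosh a *
        (Real.cosh t * Real.sinh b) := by
      gcongr
    linarith
  have h2 : Real.exp (-e) ≤ Real.exp (b - a) := by
    apply Real.exp_le_exp.2
    have := dist_triangle y u p
    rw [dist_comm u p] at this
    linarith
  have h3 : Real.sinh b ≤ Real.exp b / 2 := by
    rw [Real.sinh_eq]; have := Real.exp_pos (-b); linarith
  have h4 : Real.exp (r - t) ≥ Real.exp (-a) := by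
    apply Real.exp_le_exp.2
    have := dist_triangle x y p
    linarith
  have h5 : Real.cosh r * Real.sinh b / Real.sinh t ≤
      Real.cosh r * (Real.exp b / 2) / Real.sinh t := by gcongr
  have h6 : Real.exp (a + b) * (Real.cosh r * Real.exp (-a) / Real.sinh t) ≤
      Real.exp (a + b) * (Real.cosh r * Real.exp (r - t) / Real.sinh t) := by gcongr
  have h7 : Real.exp (a + b) * (Real.cosh r * Real.exp (-a) / Real.sinh t) =
      2 * (Real.cosh r * (Real.exp b / 2) / Real.sinh t) := by
    have : Real.exp b = Real.exp (a + b) * Real.exp (-a) := by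
      rw [← Real.exp_add]; congr 1; ring
    rw [this]; ring
  have h8 : 2 * (Real.cosh a * Real.exp b) = Real.exp (a + b) + Real.exp (b - a) := by
    rw [Real.cosh_eq, Real.exp_add, sub_eq_add_neg b a, Real.exp_add]; ring
  have h9 : 2 * Real.cosh e = Real.exp e + Real.exp (-e) := by rw [Real.cosh_eq]; ring
  rw [mul_sub, mul_one]
  linarith

/-- The error factor of `exp_dist_ge` tends to 1 as p goes far from x, uniformly for y in a ball
about x. Thin triangles only give an error of order κ; an arbitrarily small one is needed for
Busemann functions to be well defined and continuous. -/
theorem IsCATNegOne.exists_almost_geodesic (hX : IsCATNegOne X) (r : ℝ) {ε : ℝ} (hε : 0 < ε) :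
    ∃ t₀ : ℝ, ∀ x u p y : X, dist x p + dist p u = dist x u → t₀ ≤ dist x p → dist x y ≤ r →
      dist y p + dist p u ≤ dist y u + ε := by
  have h1 : 0 < 1 - Real.exp (-ε) := by
    have : Real.exp (-ε) < 1 := (Real.exp_lt_exp.2 (by linarith : -ε < 0)).trans_eq Real.exp_zero
    linarith
  refine ⟨max 1 (Real.cosh r * Real.exp r / (1 - Real.exp (-ε))), fun x u p y hp ht hr => ?_⟩
  have ht1 : 1 ≤ dist x p := (le_max_left _ _).trans ht
  have hpos : 0 < dist x p := by linarith
  have hS : 0 < Real.sinh (dist x p) := Real.sinh_pos_iff.2 hpos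
  have h := hX.exp_dist_ge y hp hpos
  have hself : dist x p ≤ Real.sinh (dist x p) := Real.self_le_sinh_iff.2 hpos.le
  have hc : Real.cosh (dist x y) ≤ Real.cosh r := by
    rw [Real.cosh_le_cosh, abs_of_nonneg dist_nonneg]; exact hr.trans (le_abs_self r)
  have he : Real.exp (dist x y - dist x p) ≤ Real.exp r := Real.exp_le_exp.2 (by linarith)
  have hq : Real.cosh (dist x y) * Real.exp (dist x y - dist x p) / Real.sinh (dist x p) ≤
      1 - Real.exp (-ε) := by
    rw [div_le_iff₀ hS]
    have h2 : Real.cosh r * Real.exp r ≤ dist x p * (1 - Real.exp (-ε)) :=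
      (div_le_iff₀ h1).1 ((le_max_right _ _).trans ht)
    calc _ ≤ Real.cosh r * Real.exp r := by gcongr
      _ ≤ dist x p * (1 - Real.exp (-ε)) := h2
      _ ≤ Real.sinh (dist x p) * (1 - Real.exp (-ε)) := by gcongr
      _ = _ := mul_comm _ _
  have h3 : Real.exp (dist y p + dist p u - ε) ≤ Real.exp (dist y u) := by
    refine le_trans ?_ h
    rw [sub_eq_add_neg, Real.exp_add]
    gcongr
    linarith
  have := Real.exp_le_exp.1 h3
  linarith

/-- Two cevian inequalities are combined: from q to the side [x, u] and from u to the side [x, w].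
The dominant terms are cosh² t sinh L - sinh² t cosh L, which is at most sinh L. -/
theorem IsCATNegOne.cosh_dist_le_of_close (hX : IsCATNegOne X) {x u w p q : X}
    (hp : dist x p + dist p u = dist x u)
    (hq : dist x q + dist q w = dist x w) (hpq : dist x p = dist x q) (hu : 0 < dist x u)
    (hw : 1 ≤ dist x w) :
    Real.cosh (dist p q) ≤
      1 + (1 + Real.sinh (dist x p) ^ 2 * Real.cosh (dist u w)) / Real.sinh (dist x u) := by
  have h1 := hX.cosh_dist_le q hp
  have h2 := hX.cosh_dist_le u hq
  rw [dist_comm q u, dist_comm w u] at h2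
  rw [← hpq] at h1 h2
  have e1 : dist p u = dist x u - dist x p := by linarith
  have e2 : dist q w = dist x w - dist x p := by linarith
  rw [e1, Real.sinh_sub] at h1
  rw [e2, Real.sinh_sub] at h2
  set t := dist x p
  set L := dist x u
  set N := dist x w
  set M := dist u w
  have ht : 0 ≤ t := dist_nonneg
  have hSL : 0 < Real.sinh L := Real.sinh_pos_iff.2 hu
  have hSN : 1 ≤ Real.sinh N := hw.trans (Real.self_le_sinh_iff.2 (by linarith))
  have hSt : 0 ≤ Real.sinh t := Real.sinh_nonneg_iff.2 ht
  have hL : Real.cosh L - Real.sinh L = Real.exp (-L) := Real.cosh_sub_sinh L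
  have hN : Real.sinh N < Real.cosh N := Real.sinh_lt_cosh N
  have hLc : Real.sinh L < Real.cosh L := Real.sinh_lt_cosh L
  have ht' : Real.cosh t - Real.sinh t = Real.exp (-t) := Real.cosh_sub_sinh t
  have hcL := Real.cosh_pos L
  have hct := Real.cosh_pos t
  have hcM := Real.cosh_pos M
  have hsq := Real.cosh_sq t
  have k1 : Real.cosh (dist u q) ≤ Real.cosh L * (Real.cosh t - Real.sinh t) +
      Real.cosh M * Real.sinh t := by
    refine le_of_mul_le_mul_right ?_ (by linarith : 0 < Real.sinh N)
    have i1 : Real.cosh L * (Real.sinh N * Real.sinh t) ≤ Real.cosh L *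
        (Real.cosh N * Real.sinh t) := by
      gcongr
    have i2 : Real.cosh M * Real.sinh t * 1 ≤ Real.cosh M * Real.sinh t * Real.sinh N := by gcongr
    linarith
  have k2 : Real.sinh t * (Real.cosh t - Real.sinh t) ≤ 1 := by
    rw [ht', Real.sinh_eq, div_mul_eq_mul_div, sub_mul, ← Real.exp_add, ← Real.exp_add]
    have : Real.exp (-t + -t) > 0 := Real.exp_pos _
    simp; linarith
  have k3 : Real.exp (-L) ≤ 1 := Real.exp_le_one_iff.2 (by linarith)
  have k4 : Real.sinh t * Real.cosh (dist u q) ≤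
      Real.sinh t * (Real.cosh L * (Real.cosh t - Real.sinh t) + Real.cosh M * Real.sinh t) := by
    gcongr
  have k5 : Real.sinh t * (Real.cosh t - Real.sinh t) * (Real.cosh L - Real.sinh L) ≤ 1 * 1 := by
    rw [hL]
    apply mul_le_mul k2 k3 (Real.exp_pos _).le zero_le_one
  refine le_of_mul_le_mul_right ?_ hSL
  rw [add_mul, div_mul_cancel₀ _ hSL.ne']
  have k6 : Real.cosh t * (Real.cosh L * Real.sinh t) - Real.sinh t *
      (Real.cosh L * Real.cosh t) = 0 := by
    ring
  nlinarith

/-- Points at the same distance `t` from `x` on two long geodesic segments from `x` with nearby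
endpoints are close. -/
theorem IsCATNegOne.exists_close (hX : IsCATNegOne X) (t M : ℝ) {ε : ℝ} (hε : 0 < ε) :
    ∃ n₀ : ℝ, ∀ x u w p q : X, dist x p + dist p u = dist x u → dist x q + dist q w = dist x w →
      dist x p = t → dist x q = t → dist u w ≤ M → n₀ ≤ dist x u → n₀ ≤ dist x w →
      dist p q < ε := by
  have h1 : 0 < Real.cosh ε - 1 := by
    have : 1 < Real.cosh ε := Real.one_lt_cosh.2 hε.ne'
    linarith
  refine ⟨max 1 ((1 + Real.sinh t ^ 2 * Real.cosh M) / (Real.cosh ε - 1) + 1),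
    fun x u w p q hp hq htp htq hM hu hw => ?_⟩
  have hu1 : 1 ≤ dist x u := (le_max_left _ _).trans hu
  have hself : dist x u ≤ Real.sinh (dist x u) := Real.self_le_sinh_iff.2 (by linarith)
  have h := hX.cosh_dist_le_of_close hp hq (htp.trans htq.symm) (by linarith)
    ((le_max_left _ _).trans hw)
  have hc : Real.cosh (dist u w) ≤ Real.cosh M := by
    rw [Real.cosh_le_cosh, abs_of_nonneg dist_nonneg]; exact hM.trans (le_abs_self M)
  have h2 : (1 + Real.sinh t ^ 2 * Real.cosh M) / (Real.cosh ε - 1) < Real.sinh (dist x u) := by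
    have := (le_max_right _ _).trans hu
    linarith
  have h3 : (1 + Real.sinh t ^ 2 * Real.cosh (dist u w)) / Real.sinh (dist x u) <
      Real.cosh ε - 1 := by
    rw [div_lt_iff₀ (by linarith)]
    rw [div_lt_iff₀ h1] at h2
    have : Real.sinh t ^ 2 * Real.cosh (dist u w) ≤ Real.sinh t ^ 2 * Real.cosh M := by gcongr
    linarith
  rw [htp] at h
  have h4 : Real.cosh (dist p q) < Real.cosh ε := by linarith
  rwa [Real.cosh_lt_cosh, abs_of_nonneg dist_nonneg, abs_of_pos hε] at h4

end Hyperbolicity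

section Rays

variable {X : Type*} [MetricSpace X]

/-! ### Geodesic rays -/

theorem ray_dist_of_le (ρ : GeodesicRay X) {s t : ℝ≥0} (h : s ≤ t) :
    dist (ρ.1 s) (ρ.1 t) = t - s := by
  rw [ρ.2.dist_eq, NNReal.dist_eq, abs_sub_comm, abs_of_nonneg]
  exact sub_nonneg.2 (NNReal.coe_le_coe.2 h)

theorem ray_dist_zero (ρ : GeodesicRay X) (t : ℝ≥0) : dist (ρ.1 0) (ρ.1 t) = t := by
  rw [ray_dist_of_le ρ zero_le]; simp

theorem ray_between (ρ : GeodesicRay X) {s t : ℝ≥0} (h : s ≤ t) :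
    dist (ρ.1 0) (ρ.1 s) + dist (ρ.1 s) (ρ.1 t) = dist (ρ.1 0) (ρ.1 t) := by
  rw [ray_dist_zero, ray_dist_zero, ray_dist_of_le ρ h]; ring

theorem sub_le_dist_ray (ρ : GeodesicRay X) (x : X) (t : ℝ≥0) :
    t - dist x (ρ.1 0) ≤ dist x (ρ.1 t) := by
  have := dist_triangle (ρ.1 0) x (ρ.1 t)
  rw [ray_dist_zero, dist_comm (ρ.1 0) x] at this
  linarith

theorem dist_ray_le (ρ : GeodesicRay X) (x : X) (t : ℝ≥0) :
    dist x (ρ.1 t) ≤ t + dist x (ρ.1 0) := by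
  have := dist_triangle x (ρ.1 0) (ρ.1 t)
  rw [ray_dist_zero] at this
  linarith

theorem tendsto_dist_ray (ρ : GeodesicRay X) (x : X) :
    Tendsto (fun t => dist x (ρ.1 t)) atTop atTop := by
  refine tendsto_atTop_mono (sub_le_dist_ray ρ x) ?_
  exact tendsto_atTop_add_const_right _ _ (NNReal.tendsto_coe_atTop.2 tendsto_id)

/-- The Busemann function of a ray, normalized at its origin. -/
def rayBus (ρ : GeodesicRay X) (x : X) : ℝ := ⨅ t : ℝ≥0, (dist x (ρ.1 t) - t)

theorem antitone_dist_ray_sub (ρ : GeodesicRay X) (x : X) :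
    Antitone fun t : ℝ≥0 => dist x (ρ.1 t) - t := by
  intro s t h
  have := dist_triangle x (ρ.1 s) (ρ.1 t)
  rw [ray_dist_of_le ρ h] at this
  simp only
  linarith

theorem bddBelow_dist_ray_sub (ρ : GeodesicRay X) (x : X) :
    BddBelow (range fun t : ℝ≥0 => dist x (ρ.1 t) - t) := by
  refine ⟨-dist x (ρ.1 0), ?_⟩
  rintro _ ⟨t, rfl⟩
  have := sub_le_dist_ray ρ x t
  simp only
  linarith

theorem tendsto_rayBus (ρ : GeodesicRay X) (x : X) :
    Tendsto (fun t : ℝ≥0 => dist x (ρ.1 t) - t) atTop (𝓝 (rayBus ρ x)) :=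
  tendsto_atTop_ciInf (antitone_dist_ray_sub ρ x) (bddBelow_dist_ray_sub ρ x)

theorem rayBus_le (ρ : GeodesicRay X) (x : X) (t : ℝ≥0) : rayBus ρ x ≤ dist x (ρ.1 t) - t :=
  ciInf_le (bddBelow_dist_ray_sub ρ x) t

theorem rayBus_apply (ρ : GeodesicRay X) (s : ℝ≥0) : rayBus ρ (ρ.1 s) = -s := by
  refine tendsto_nhds_unique (tendsto_rayBus ρ _) ?_
  refine tendsto_const_nhds.congr' ?_
  filter_upwards [eventually_ge_atTop s] with t ht
  rw [ray_dist_of_le ρ ht]; ring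

theorem tendsto_dist_sub_dist (ρ : GeodesicRay X) (x y : X) :
    Tendsto (fun t : ℝ≥0 => dist x (ρ.1 t) - dist y (ρ.1 t)) atTop
      (𝓝 (rayBus ρ x - rayBus ρ y)) := by
  refine ((tendsto_rayBus ρ x).sub (tendsto_rayBus ρ y)).congr fun t => ?_
  ring

theorem endpoint_eq_iff {ρ σ : GeodesicRay X} :
    ρ.endpoint = σ.endpoint ↔ ∃ M : ℝ, ∀ t, dist (ρ.1 t) (σ.1 t) ≤ M :=
  ⟨fun h => Quotient.exact h, fun h => Quotient.sound h⟩

theorem endpoint_out (ξ : Boundary X) : (Quotient.out ξ : GeodesicRay X).endpoint = ξ :=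
  Quotient.out_eq ξ

/-- The segments from x to ρ(s) and to σ(s) pass, at a fixed distance from x, through ε-close points
p and q, and the detours from y through p and q are almost geodesic. This makes `busemann`
independent of the representative ray. -/
theorem rayBus_sub_eq (hX : IsCATNegOne X) {ρ σ : GeodesicRay X} (h : ρ.endpoint = σ.endpoint)
    (x y : X) :
    rayBus ρ x - rayBus ρ y = rayBus σ x - rayBus σ y := by
  obtain ⟨M, hM⟩ := endpoint_eq_iff.1 h
  have key : ∀ ε > 0, |(rayBus ρ x - rayBus ρ y) - (rayBus σ x - rayBus σ y)| ≤ 2 * ε := by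
    intro ε hε
    obtain ⟨t₀, ht₀⟩ := hX.exists_almost_geodesic (dist x y) hε
    obtain ⟨n₀, hn₀⟩ := hX.exists_close (max t₀ 0) M hε
    refine le_of_tendsto
      ((tendsto_dist_sub_dist ρ x y).sub (tendsto_dist_sub_dist σ x y)).abs ?_
    filter_upwards [(tendsto_dist_ray ρ x).eventually_ge_atTop (max n₀ (max t₀ 0)),
      (tendsto_dist_ray σ x).eventually_ge_atTop (max n₀ (max t₀ 0))] with s h1 h2
    obtain ⟨p, p1, p2, p3⟩ := hX.exists_point x (ρ.1 s) (le_max_right t₀ 0)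
      ((le_max_right _ _).trans h1)
    obtain ⟨q, q1, q2, q3⟩ := hX.exists_point x (σ.1 s) (le_max_right t₀ 0)
      ((le_max_right _ _).trans h2)
    have h3 := hn₀ x _ _ p q p3 q3 p1 q1 (hM s) ((le_max_left _ _).trans h1)
      ((le_max_left _ _).trans h2)
    have h4 := ht₀ x _ p y p3 (by rw [p1]; exact le_max_left _ _) le_rfl
    have h5 := ht₀ x _ q y q3 (by rw [q1]; exact le_max_left _ _) le_rfl
    have h6 := dist_triangle y p (ρ.1 s)
    have h7 := dist_triangle y q (σ.1 s)
    have h8 := dist_triangle y p q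
    have h9 := dist_triangle y q p
    rw [dist_comm q p] at h9
    rw [abs_le]
    constructor <;> linarith
  have h0 : |(rayBus ρ x - rayBus ρ y) - (rayBus σ x - rayBus σ y)| ≤ 0 := by
    refine le_of_forall_pos_le_add fun ε hε => ?_
    have := key (ε / 2) (by linarith)
    linarith
  have := abs_eq_zero.1 (le_antisymm h0 (abs_nonneg _))
  linarith

theorem busemann_endpoint (hX : IsCATNegOne X) (ρ : GeodesicRay X) (x y : X) :
    busemann ρ.endpoint x y = rayBus ρ x - rayBus ρ y := by
  rw [← rayBus_sub_eq hX (endpoint_out ρ.endpoint)]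
  exact (tendsto_dist_sub_dist _ x y).limUnder_eq

theorem tendsto_busemann (hX : IsCATNegOne X) {ρ : GeodesicRay X} {ξ : Boundary X}
    (h : ρ.endpoint = ξ) (x y : X) :
    Tendsto (fun t : ℝ≥0 => dist x (ρ.1 t) - dist y (ρ.1 t)) atTop (𝓝 (busemann ξ x y)) := by
  rw [← h, busemann_endpoint hX]
  exact tendsto_dist_sub_dist ρ x y

theorem busemann_add (hX : IsCATNegOne X) (ξ : Boundary X) (x y z : X) :
    busemann ξ x y + busemann ξ y z = busemann ξ x z := by
  rw [← endpoint_out ξ, busemann_endpoint hX, busemann_endpoint hX, busemann_endpoint hX]; ring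

theorem busemann_self (hX : IsCATNegOne X) (ξ : Boundary X) (x : X) : busemann ξ x x = 0 := by
  have := busemann_add hX ξ x x x; linarith

theorem busemann_neg (hX : IsCATNegOne X) (ξ : Boundary X) (x y : X) :
    busemann ξ x y = -busemann ξ y x := by
  have := busemann_add hX ξ x y x
  rw [busemann_self hX] at this; linarith

theorem busemann_le_dist (hX : IsCATNegOne X) (ξ : Boundary X) (x y : X) :
    busemann ξ x y ≤ dist x y := by
  refine le_of_tendsto (tendsto_busemann hX (endpoint_out ξ) x y) (Eventually.of_forall fun t => ?_)
  have := dist_triangle x y ((Quotient.out ξ : GeodesicRay X).1 t)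
  linarith

theorem neg_dist_le_busemann (hX : IsCATNegOne X) (ξ : Boundary X) (x y : X) :
    -dist x y ≤ busemann ξ x y := by
  have := busemann_le_dist hX ξ y x
  rw [busemann_neg hX, dist_comm]; linarith

theorem busemann_smul (hX : IsCATNegOne X) (g : X ≃ᵢ X) (ξ : Boundary X) (x y : X) :
    busemann (g • ξ) (g x) (g y) = busemann ξ x y := by
  have h : ((Quotient.out ξ : GeodesicRay X).map g).endpoint = g • ξ := by
    rw [← smul_endpoint, endpoint_out]
  refine tendsto_nhds_unique (tendsto_busemann hX h (g x) (g y)) ?_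
  refine (tendsto_busemann hX (endpoint_out ξ) x y).congr fun t => ?_
  change _ = dist (g x) (g _) - dist (g y) (g _)
  rw [g.dist_eq, g.dist_eq]

/-- The defining limit is reached up to ε at a time depending only on a bound for the distance from
x to the origin of the ray. So the function is a locally uniform limit of functions of a single
evaluation point. -/
theorem continuous_rayBus (hX : IsCATNegOne X) (x : X) :
    Continuous fun ρ : GeodesicRay X => rayBus ρ x := by
  have key : ∀ (r : ℝ) {ε : ℝ}, 0 < ε → ∃ t : ℝ≥0, ∀ ρ : GeodesicRay X, dist (ρ.1 0) x ≤ r →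
      dist x (ρ.1 t) - t ≤ rayBus ρ x + ε := by
    intro r ε hε
    obtain ⟨t₀, ht₀⟩ := hX.exists_almost_geodesic r hε
    refine ⟨t₀.toNNReal, fun ρ hρ => ?_⟩
    rw [← sub_le_iff_le_add]
    refine ge_of_tendsto (tendsto_rayBus ρ x) ?_
    filter_upwards [eventually_ge_atTop t₀.toNNReal] with s hs
    have := ht₀ _ _ _ x (ray_between ρ hs) (by rw [ray_dist_zero]; exact Real.le_coe_toNNReal t₀) hρ
    rw [ray_dist_of_le ρ hs] at this
    linarith
  have hev : ∀ t : ℝ≥0, Continuous fun ρ : GeodesicRay X => ρ.1 t := fun t =>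
    (continuous_apply t).comp continuous_subtype_val
  rw [continuous_iff_continuousAt]
  intro ρ₀
  rw [ContinuousAt, Metric.tendsto_nhds]
  intro ε hε
  obtain ⟨t, ht⟩ := key (dist (ρ₀.1 0) x + 1) (ε := ε / 3) (by linarith)
  have e1 := Metric.tendsto_nhds.1 ((hev 0).tendsto ρ₀) 1 one_pos
  have e2 := Metric.tendsto_nhds.1 ((hev t).tendsto ρ₀) (ε / 3) (by linarith)
  filter_upwards [e1, e2] with ρ h1 h2
  have h3 := dist_triangle (ρ.1 0) (ρ₀.1 0) x
  have h4 := ht ρ (by linarith)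
  have h5 := ht ρ₀ (by linarith)
  have h6 := rayBus_le ρ x t
  have h7 := rayBus_le ρ₀ x t
  have h8 := dist_triangle x (ρ.1 t) (ρ₀.1 t)
  have h9 := dist_triangle x (ρ₀.1 t) (ρ.1 t)
  rw [dist_comm (ρ₀.1 t) (ρ.1 t)] at h9
  rw [Real.dist_eq, abs_lt]
  constructor <;> linarith

theorem continuous_busemann (hX : IsCATNegOne X) (x y : X) :
    Continuous fun ξ : Boundary X => busemann ξ x y := by
  refine continuous_coinduced_dom.2 ?_
  have : (fun ρ : GeodesicRay X => rayBus ρ x - rayBus ρ y) =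
      (fun ξ : Boundary X => busemann ξ x y) ∘ Quotient.mk (asymptotic X) := by
    funext ρ
    exact (busemann_endpoint hX ρ x y).symm
  exact this ▸ (continuous_rayBus hX x).sub (continuous_rayBus hX y)

theorem continuous_smul_boundary (g : X ≃ᵢ X) : Continuous fun ξ : Boundary X => g • ξ := by
  refine continuous_coinduced_dom.2 ?_
  have h1 : Continuous (GeodesicRay.map g : GeodesicRay X → GeodesicRay X) := by
    refine Continuous.subtype_mk (continuous_pi fun t => ?_) _
    exact g.continuous.comp ((continuous_apply t).comp continuous_subtype_val)
  exact continuous_quot_mk.comp h1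

/-! ### Gromov products with points at infinity -/

/-- The Gromov product, seen from `o`, of a point at infinity and a point. -/
def bgp (ξ : Boundary X) (o w : X) : ℝ := (dist o w + busemann ξ o w) / 2

theorem tendsto_bgp (hX : IsCATNegOne X) {ρ : GeodesicRay X} {ξ : Boundary X} (h : ρ.endpoint = ξ)
    (o w : X) :
    Tendsto (fun t => gp o w (ρ.1 t)) atTop (𝓝 (bgp ξ o w)) := by
  refine (((tendsto_busemann hX h o w).const_add (dist o w)).div_const 2).congr fun t => ?_
  unfold gp; ring

theorem bgp_add (hX : IsCATNegOne X) (ξ : Boundary X) (o w : X) :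
    bgp ξ o w + bgp ξ w o = dist o w := by
  unfold bgp; rw [busemann_neg hX ξ w o, dist_comm w o]; ring

theorem bgp_nonneg (hX : IsCATNegOne X) (ξ : Boundary X) (o w : X) : 0 ≤ bgp ξ o w := by
  have := neg_dist_le_busemann hX ξ o w
  unfold bgp; linarith

theorem bgp_le_dist (hX : IsCATNegOne X) (ξ : Boundary X) (o w : X) : bgp ξ o w ≤ dist o w := by
  have := busemann_le_dist hX ξ o w
  unfold bgp; linarith

theorem bgp_le_add_dist (hX : IsCATNegOne X) (ξ : Boundary X) (o w v : X) :
    bgp ξ o w ≤ bgp ξ o v + dist w v := by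
  have h1 := busemann_add hX ξ o v w
  have h2 := busemann_le_dist hX ξ v w
  have h3 := dist_triangle o v w
  rw [dist_comm v w] at h2 h3
  unfold bgp; linarith

theorem bgp_smul (hX : IsCATNegOne X) (g : X ≃ᵢ X) (ξ : Boundary X) (o w : X) :
    bgp (g • ξ) (g o) (g w) = bgp ξ o w := by
  unfold bgp; rw [busemann_smul hX, g.dist_eq]

theorem bgp_min_left (hX : IsCATNegOne X) (ξ : Boundary X) (o v w : X) :
    min (bgp ξ o v) (gp o v w) ≤ bgp ξ o w + 2 * κ := by
  have h1 := tendsto_bgp hX (endpoint_out ξ) o v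
  have h2 := tendsto_bgp hX (endpoint_out ξ) o w
  refine le_of_tendsto_of_tendsto' (h1.min tendsto_const_nhds) (h2.add_const _) fun t => ?_
  have := hX.gp_min o ((Quotient.out ξ : GeodesicRay X).1 t) v w
  rw [gp_comm o w]
  rwa [gp_comm o _ v] at this

theorem bgp_min_right (hX : IsCATNegOne X) (ξ : Boundary X) (o v w : X) :
    min (bgp ξ o v) (bgp ξ o w) ≤ gp o v w + 2 * κ := by
  have h1 := tendsto_bgp hX (endpoint_out ξ) o v
  have h2 := tendsto_bgp hX (endpoint_out ξ) o w
  refine le_of_tendsto (h1.min h2) (Eventually.of_forall fun t => ?_)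
  have := hX.gp_min o v ((Quotient.out ξ : GeodesicRay X).1 t) w
  rwa [gp_comm o _ w] at this

end Rays

section LimitSets

variable {X : Type*} [MetricSpace X]

/-! ### Existence of rays -/

/-- Limits of geodesic segments from `x` to points going to infinity are geodesic rays. -/
theorem exists_ray_of_tendsto [ProperSpace X] (hX : IsCATNegOne X) (𝒰 : Ultrafilter ℕ) (x : X)
    (y : ℕ → X) (hy : Tendsto (fun k => dist x (y k)) 𝒰 atTop) :
    ∃ ρ : GeodesicRay X, ρ.1 0 = x ∧ ∀ t : ℝ≥0, ∀ ε > 0, ∀ᶠ k in (𝒰 : Filter ℕ),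
      ∃ p, dist x p = t ∧ dist x p + dist p (y k) = dist x (y k) ∧ dist p (ρ.1 t) < ε := by
  choose c h1 h2 h3 using fun k => hX.geodesic x (y k)
  have hev : ∀ t : ℝ≥0, ∀ᶠ k in (𝒰 : Filter ℕ), (t : ℝ) ≤ dist x (y k) := fun t =>
    hy.eventually_ge_atTop _
  -- Along an ultrafilter the points converge for all times t at once, so no diagonal extraction is
  -- needed.
  have hlim : ∀ t : ℝ≥0, ∃ z, Tendsto (fun k => c k t) 𝒰 (𝓝 z) := by
    intro t
    have hmem : ↑(𝒰.map fun k => c k t) ≤ 𝓟 (Metric.closedBall x t) := by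
      rw [le_principal_iff, Ultrafilter.coe_map, mem_map]
      filter_upwards [hev t] with k hk
      have := h3 k 0 ⟨le_rfl, dist_nonneg⟩ t ⟨t.2, hk⟩
      rw [h1, zero_sub, abs_neg, abs_of_nonneg t.coe_nonneg] at this
      simp [dist_comm _ x, this]
    obtain ⟨z, -, hz⟩ := (isCompact_closedBall x (t : ℝ)).ultrafilter_le_nhds _ hmem
    exact ⟨z, hz⟩
  choose ρ hρ using hlim
  have hdist : ∀ s t : ℝ≥0, dist (ρ s) (ρ t) = dist s t := by
    intro s t
    refine tendsto_nhds_unique ((hρ s).dist (hρ t)) (tendsto_const_nhds.congr' ?_)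
    filter_upwards [hev s, hev t] with k hs ht
    rw [h3 k s ⟨s.2, hs⟩ t ⟨t.2, ht⟩, NNReal.dist_eq]
  refine ⟨⟨ρ, Isometry.of_dist_eq hdist⟩, ?_, fun t ε hε => ?_⟩
  · refine tendsto_nhds_unique (hρ 0) (tendsto_const_nhds.congr fun k => ?_)
    simp [h1 k]
  · filter_upwards [hev t, Metric.tendsto_nhds.1 (hρ t) ε hε] with k hk hk'
    have e1 := h3 k 0 ⟨le_rfl, dist_nonneg⟩ t ⟨t.2, hk⟩
    have e2 := h3 k t ⟨t.2, hk⟩ _ ⟨dist_nonneg, le_rfl⟩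
    rw [h1, zero_sub, abs_neg, abs_of_nonneg t.coe_nonneg] at e1
    rw [h2, abs_sub_comm, abs_of_nonneg (by linarith)] at e2
    exact ⟨c k t, e1, by rw [e1, e2]; ring, hk'⟩

/-- The ray is a limit of segments from x to σ(n), where σ is any ray ending at ξ; thinness keeps
these segments at bounded distance from σ. -/
theorem exists_ray [ProperSpace X] (hX : IsCATNegOne X) (x : X) (ξ : Boundary X) :
    ∃ ρ : GeodesicRay X, ρ.endpoint = ξ ∧ ρ.1 0 = x := by
  obtain ⟨σ, hσ⟩ : ∃ σ : GeodesicRay X, σ.endpoint = ξ := ⟨_, endpoint_out ξ⟩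
  have hcast : Tendsto (fun n : ℕ => (n : ℝ≥0)) (hyperfilter ℕ) atTop :=
    tendsto_natCast_atTop_atTop.mono_left (Nat.hyperfilter_le_atTop)
  obtain ⟨ρ, h0, h1⟩ := exists_ray_of_tendsto hX (hyperfilter ℕ) x (fun n => σ.1 n)
    ((tendsto_dist_ray σ x).comp hcast)
  refine ⟨ρ, ?_, h0⟩
  rw [← hσ, endpoint_eq_iff]
  refine ⟨dist x (σ.1 0) + κ + 1, fun t => ?_⟩
  obtain ⟨n, ⟨p, p1, p2, p3⟩, hn⟩ :=
    ((h1 t 1 one_pos).and (hcast.eventually_ge_atTop t)).exists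
  have h2 := hX.dist_le_max (σ.1 t) p2
  have h3 := dist_ray_le σ x t
  have h4 := ray_dist_of_le σ hn
  have h5 := sub_le_dist_ray σ x n
  rw [dist_comm (σ.1 (n : ℝ≥0)), h4, p1] at h2
  have h6 : max (dist x (σ.1 t) - t) ((n : ℝ≥0) - t - dist p (σ.1 n)) ≤ dist x (σ.1 0) :=
    max_le (by linarith) (by linarith)
  have h7 := dist_triangle (ρ.1 t) p (σ.1 t)
  rw [dist_comm (ρ.1 t) p] at h7
  linarith

theorem dist_ray_le_max (hX : IsCATNegOne X) (ρ : GeodesicRay X) (t : ℝ≥0) (z : X) :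
    dist (ρ.1 t) z ≤ max (dist (ρ.1 0) z - t) (rayBus ρ z + t) + κ := by
  refine ge_of_tendsto ((tendsto_const_nhds.max
    ((tendsto_rayBus ρ z).add_const _)).add_const _) ?_
  filter_upwards [eventually_ge_atTop t] with s hs
  have e := hX.dist_le_max z (ray_between ρ hs)
  rw [ray_dist_zero, ray_dist_of_le ρ hs, dist_comm (ρ.1 s)] at e
  refine e.trans (add_le_add (max_le_max le_rfl ?_) le_rfl)
  linarith

/-- An explicit bound replaces the unspecified constant in the definition of asymptotic rays; this
explicitness is what makes limit sets closed below. -/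
theorem dist_ray_ray_le (hX : IsCATNegOne X) {ρ σ : GeodesicRay X}
    (h : ρ.endpoint = σ.endpoint) (t : ℝ≥0) :
    dist (ρ.1 t) (σ.1 t) ≤ dist (ρ.1 0) (σ.1 0) + κ := by
  have e1 := rayBus_sub_eq hX h (σ.1 t) (σ.1 0)
  rw [rayBus_apply, rayBus_apply] at e1
  have e2 := rayBus_le ρ (σ.1 0) 0
  rw [dist_comm] at e2
  simp only [NNReal.coe_zero] at e1 e2
  have e3 := dist_triangle (ρ.1 0) (σ.1 0) (σ.1 t)
  rw [ray_dist_zero] at e3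
  refine (dist_ray_le_max hX ρ t (σ.1 t)).trans (add_le_add (max_le ?_ ?_) le_rfl) <;> linarith

theorem dist_ray_le_of_lt_bgp (hX : IsCATNegOne X) {ρ : GeodesicRay X} {ξ : Boundary X}
    (hρ : ρ.endpoint = ξ) {o q p : X} (hρ0 : ρ.1 0 = o) {t : ℝ≥0} (ht : t < bgp ξ o q)
    (hp : dist o p + dist p q = dist o q) (hpt : dist o p = t) : dist p (ρ.1 t) ≤ 2 * κ := by
  obtain ⟨s, hs1, hs2⟩ := (((tendsto_bgp hX hρ o q).eventually (lt_mem_nhds ht)).and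
    (eventually_ge_atTop t)).exists
  have hr := ray_between ρ hs2
  have hr0 := ray_dist_zero ρ t
  rw [hρ0] at hr hr0
  refine hX.fellow_travel hp hr (hpt.trans hr0.symm) ?_
  rw [hpt]; exact hs1.le

/-! ### Closest points -/

/-- Multiply the cevian inequality with vertex ρ(t) by 2 exp(-t) and let t tend to infinity. -/
theorem exp_rayBus_le (hX : IsCATNegOne X) (ρ : GeodesicRay X) {x y p : X}
    (hp : dist x p + dist p y = dist x y) :
    Real.exp (rayBus ρ p) * Real.sinh (dist x y) ≤
      Real.exp (rayBus ρ x) * Real.sinh (dist p y) +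
        Real.exp (rayBus ρ y) * Real.sinh (dist x p) := by
  have hlim : ∀ z, Tendsto (fun t : ℝ≥0 => 2 * Real.exp (-t) * Real.cosh (dist z (ρ.1 t))) atTop
      (𝓝 (Real.exp (rayBus ρ z))) := by
    intro z
    have h0 : Tendsto (fun t : ℝ≥0 => Real.exp (-dist z (ρ.1 t) - t)) atTop (𝓝 0) := by
      refine Real.tendsto_exp_atBot.comp (tendsto_atBot_mono (fun t => ?_)
        (tendsto_neg_atTop_atBot.comp (tendsto_dist_ray ρ z)))
      have : (0 : ℝ) ≤ t := t.2
      simp only [Function.comp]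
      linarith
    have h1 := ((Real.continuous_exp.tendsto _).comp (tendsto_rayBus ρ z)).add h0
    rw [add_zero] at h1
    refine h1.congr fun t => ?_
    simp only [Function.comp]
    rw [Real.cosh_eq, sub_eq_add_neg, sub_eq_add_neg, Real.exp_add, Real.exp_add]
    ring
  refine le_of_tendsto_of_tendsto' ((hlim p).mul_const _)
    (((hlim x).mul_const _).add ((hlim y).mul_const _)) fun t => ?_
  have h := hX.cosh_dist_le (ρ.1 t) hp
  have := mul_le_mul_of_nonneg_left h (by positivity : (0 : ℝ) ≤ 2 * Real.exp (-t))
  linarith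

theorem busemann_closest_nonneg (hX : IsCATNegOne X) {C : Set X} {ξ : Boundary X} {p q : X}
    (hp : IsClosestPoint C ξ p) (hq : q ∈ C) : 0 ≤ busemann ξ q p := by
  by_contra! h
  have := hp.2 q hq h.le
  rw [this, busemann_self hX] at h
  exact lt_irrefl _ h

/-- The point of [p, w] at distance `bgp ξ p w` from p lies in C, and its Busemann value relative to
p is at most κ minus that distance. It cannot be negative. -/
theorem bgp_closest_le (hX : IsCATNegOne X) {C : Set X} (hC : IsGeodConvex C) {ξ : Boundary X}
    {p w : X} (hp : IsClosestPoint C ξ p) (hw : w ∈ C) : bgp ξ p w ≤ κ := by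
  obtain ⟨m, m1, m2, m3⟩ := hX.exists_point p w (bgp_nonneg hX ξ p w) (bgp_le_dist hX ξ p w)
  have h1 := busemann_closest_nonneg hX hp (hC p hp.1 w hw m m3)
  have h2 : busemann ξ m p ≤
      max (-bgp ξ p w) (busemann ξ w p - (dist p w - bgp ξ p w)) + κ := by
    obtain ⟨ρ, hρ⟩ : ∃ ρ : GeodesicRay X, ρ.endpoint = ξ := ⟨_, endpoint_out ξ⟩
    refine le_of_tendsto_of_tendsto' (tendsto_busemann hX hρ m p)
      ((tendsto_const_nhds.max ((tendsto_busemann hX hρ w p).sub_const _)).add_const _)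
      fun t => ?_
    have e := hX.dist_le_max (ρ.1 t) m3
    rw [m1, m2] at e
    have : max (dist p (ρ.1 t) - bgp ξ p w) (dist w (ρ.1 t) - (dist p w - bgp ξ p w)) =
        dist p (ρ.1 t) + max (-bgp ξ p w)
          (dist w (ρ.1 t) - dist p (ρ.1 t) - (dist p w - bgp ξ p w)) := by
      rw [← max_add_add_left]; congr 1; ring
    linarith
  have h3 : busemann ξ w p - (dist p w - bgp ξ p w) = -bgp ξ p w := by
    rw [busemann_neg hX]; unfold bgp; ring
  rw [h3, max_self] at h2
  linarith

/-- Uniqueness is strict convexity of horofunctions: the midpoint of two distinct minimal points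
would lie strictly lower, the gain being a factor cosh of half their distance. -/
theorem isClosestPoint_of_minimal (hX : IsCATNegOne X) {C : Set X} (hC : IsGeodConvex C)
    {ξ : Boundary X} {p : X} (hp : p ∈ C) (h : ∀ q ∈ C, 0 ≤ busemann ξ q p) :
    IsClosestPoint C ξ p := by
  refine ⟨hp, fun q hq hqp => ?_⟩
  by_contra hne
  have hL : 0 < dist q p := dist_pos.2 hne
  obtain ⟨m, m1, m2, m3⟩ := hX.exists_point q p (t := dist q p / 2) (by linarith) (by linarith)
  have hm := h m (hC q hq p hp m m3)
  obtain ⟨ρ, hρ⟩ : ∃ ρ : GeodesicRay X, ρ.endpoint = ξ := ⟨_, endpoint_out ξ⟩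
  rw [← hρ, busemann_endpoint hX] at hm hqp
  have e := exp_rayBus_le hX ρ m3
  have m4 : dist m p = dist q p / 2 := by linarith
  rw [m1, m4] at e
  have hs : 0 < Real.sinh (dist q p / 2) := Real.sinh_pos_iff.2 (by linarith)
  have hd : Real.sinh (dist q p) = 2 * Real.sinh (dist q p / 2) * Real.cosh (dist q p / 2) := by
    rw [← Real.sinh_two_mul]; congr 1; ring
  have hc : 1 < Real.cosh (dist q p / 2) := Real.one_lt_cosh.2 (by linarith)
  have e1 : Real.exp (rayBus ρ p) ≤ Real.exp (rayBus ρ m) := Real.exp_le_exp.2 (by linarith)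
  have e2 : Real.exp (rayBus ρ q) ≤ Real.exp (rayBus ρ p) := Real.exp_le_exp.2 (by linarith)
  have e3 := Real.exp_pos (rayBus ρ p)
  rw [hd] at e
  have e4 : Real.exp (rayBus ρ p) * (2 * Real.sinh (dist q p / 2) * Real.cosh (dist q p / 2)) ≤
      Real.exp (rayBus ρ m) * (2 * Real.sinh (dist q p / 2) * Real.cosh (dist q p / 2)) := by
    gcongr
  have e5 : Real.exp (rayBus ρ q) * Real.sinh (dist q p / 2) ≤
      Real.exp (rayBus ρ p) * Real.sinh (dist q p / 2) := by gcongr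
  have e6 : 0 < Real.exp (rayBus ρ p) * Real.sinh (dist q p / 2) *
      (Real.cosh (dist q p / 2) - 1) := by
    have : 0 < Real.cosh (dist q p / 2) - 1 := by linarith
    positivity
  linarith

theorem isClosestPoint_map (hX : IsCATNegOne X) {C : Set X} {g : X ≃ᵢ X}
    (hg : ∀ x, g x ∈ C ↔ x ∈ C) {ξ : Boundary X} {p : X} (h : IsClosestPoint C ξ p) :
    IsClosestPoint C (g • ξ) (g p) := by
  refine ⟨(hg p).2 h.1, fun q hq hb => ?_⟩
  obtain ⟨q, rfl⟩ := g.surjective q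
  rw [busemann_smul hX] at hb
  rw [h.2 q ((hg q).1 hq) hb]

/-! ### Convex cores -/

/-- A closed convex subset on which the group acts cocompactly, with a point on it whose orbit is
`R`-dense. -/
structure IsCore (Γ : Subgroup (X ≃ᵢ X)) (C : Set X) (o : X) (R : ℝ) : Prop where
  closed : IsClosed C
  convex : IsGeodConvex C
  map_mem : ∀ α ∈ Γ, ∀ x ∈ C, α x ∈ C
  base_mem : o ∈ C
  dense : ∀ x ∈ C, ∃ α ∈ Γ, dist x (α o) ≤ R

theorem IsCore.nonneg {Γ : Subgroup (X ≃ᵢ X)} {C : Set X} {o : X} {R : ℝ}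
    (h : IsCore Γ C o R) : 0 ≤ R := by
  obtain ⟨α, -, hα⟩ := h.dense o h.base_mem
  exact dist_nonneg.trans hα

theorem IsCore.map_mem_iff {Γ : Subgroup (X ≃ᵢ X)} {C : Set X} {o : X} {R : ℝ}
    (h : IsCore Γ C o R) {α : X ≃ᵢ X} (hα : α ∈ Γ) (x : X) : α x ∈ C ↔ x ∈ C := by
  refine ⟨fun hx => ?_, h.map_mem α hα x⟩
  have := h.map_mem α⁻¹ (Γ.inv_mem hα) _ hx
  rwa [show α⁻¹ (α x) = x from α.symm_apply_apply x] at this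

theorem isCore_groupHull {Γ : Subgroup (X ≃ᵢ X)} (h : IsConvexCocompact Γ) {o : X}
    (ho : o ∈ groupHull Γ) : ∃ R, IsCore Γ (groupHull Γ) o R := by
  obtain ⟨-, K, hK, -, hcov⟩ := h
  obtain ⟨R, hR⟩ := hK.isBounded.subset_closedBall o
  refine ⟨R, ?_, ?_, ?_, ho, ?_⟩
  · exact isClosed_sInter fun C hC => hC.1
  · intro x hx y hy p hp C hC
    exact hC.2.1 x (hx C hC) y (hy C hC) p hp
  · intro α hα x hx C hC
    -- The preimage of a competitor for the hull is again a competitor, because α preserves the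
    -- limit set.
    refine hx (α ⁻¹' C) ⟨hC.1.preimage α.continuous, ?_, ?_⟩
    · intro y hy z hz p hp
      exact hC.2.1 _ hy _ hz _ (by rw [α.dist_eq, α.dist_eq, α.dist_eq, hp])
    · intro ℓ ρ σ hℓ hρ hσ hρΛ hσΛ
      have := hC.2.2 (fun t => α (ℓ t)) (ρ.map α) (σ.map α) (α.isometry.comp hℓ)
        (fun t => congrArg α (hρ t)) (fun t => congrArg α (hσ t))
        (smul_mem_limitSet hα hρΛ) (smul_mem_limitSet hα hσΛ)
      rintro _ ⟨t, rfl⟩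
      exact this ⟨t, rfl⟩
  · intro x hx
    obtain ⟨γ, hγ, hγx⟩ := hcov x hx
    refine ⟨γ⁻¹, Γ.inv_mem hγ, ?_⟩
    have := hR hγx
    rw [Metric.mem_closedBall] at this
    rw [← γ.dist_eq, show γ (γ⁻¹ o) = o from γ.apply_symm_apply o]
    exact this

/-! ### Limit points and closest points for a group with a core. -/

section Core

variable {Γ : Subgroup (X ≃ᵢ X)} {C : Set X} {o : X} {R : ℝ}

/-- The ray follows the segment from its origin to a far point of the orbit of this origin, and that
segment stays in C by convexity and invariance. -/
theorem exists_near_of_mem_limitSet (hX : IsCATNegOne X) (hC : IsCore Γ C o R)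
    {ρ : GeodesicRay X} (h0 : ρ.1 0 ∈ C) (hρ : ρ.endpoint ∈ limitSet Γ) (t : ℝ≥0) :
    ∃ y ∈ C, dist (ρ.1 t) y ≤ 3 * κ := by
  obtain ⟨x, g, hg, hlim⟩ := hρ
  have e1 := hlim ρ rfl t κ κ_pos
  -- Used only to make g n x far enough away that replacing x by the origin of the ray leaves a
  -- Gromov product of at least t.
  have e2 := hlim ρ rfl (t + ⟨dist x (ρ.1 0), dist_nonneg⟩) 1 one_pos
  obtain ⟨n, ⟨p, p1, p2, p3⟩, ⟨q, q1, q2, -⟩⟩ := (e1.and e2).exists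
  have hd : dist (g n x) (g n (ρ.1 0)) = dist x (ρ.1 0) := (g n).dist_eq _ _
  have hq : t + dist x (ρ.1 0) ≤ dist (ρ.1 0) (g n x) := by
    have : (0 : ℝ) ≤ dist q (g n x) := dist_nonneg
    rw [q1] at q2
    push_cast at q2
    change (t : ℝ) + dist x (ρ.1 0) + _ = _ at q2
    linarith
  have ht := dist_triangle (ρ.1 0) (g n (ρ.1 0)) (g n x)
  rw [dist_comm (g n (ρ.1 0)) (g n x), hd] at ht
  obtain ⟨r, r1, r2, r3⟩ := hX.exists_point (ρ.1 0) (g n (ρ.1 0)) t.2 (by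
    change (t : ℝ) ≤ _; linarith)
  refine ⟨r, hC.convex _ h0 _ (hC.map_mem _ (hg n) _ h0) r r3, ?_⟩
  have hft := hX.fellow_travel p2 r3 (p1.trans r1.symm) (by
    rw [p1]; unfold gp; rw [hd]; linarith)
  have := dist_triangle (ρ.1 t) p r
  rw [dist_comm (ρ.1 t) p] at this
  linarith

theorem mem_limitSet_of_near (hX : IsCATNegOne X) (hC : IsCore Γ C o R) {ρ : GeodesicRay X}
    {M : ℝ} (h : ∀ t : ℝ≥0, ∃ y ∈ C, dist (ρ.1 t) y ≤ M) : ρ.endpoint ∈ limitSet Γ := by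
  have h' : ∀ n : ℕ, ∃ g ∈ Γ, dist (ρ.1 n) (g o) ≤ M + R := by
    intro n
    obtain ⟨y, hy, hyM⟩ := h n
    obtain ⟨g, hg, hgR⟩ := hC.dense y hy
    exact ⟨g, hg, (dist_triangle _ y _).trans (add_le_add hyM hgR)⟩
  choose g hg hd using h'
  refine ⟨o, g, hg, fun σ hσ t ε hε => ?_⟩
  obtain ⟨N, hN⟩ := endpoint_eq_iff.1 hσ
  obtain ⟨n₀, hn₀⟩ := hX.exists_close t (N + (M + R)) hε
  filter_upwards [eventually_ge_atTop ⌈(N + (M + R) + max (t : ℝ) n₀)⌉₊, eventually_ge_atTop ⌈t⌉₊,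
    eventually_ge_atTop ⌈n₀⌉₊]
    with n hn hnt hnn
  have hn1 : N + (M + R) + max (t : ℝ) n₀ ≤ n := (Nat.le_ceil _).trans (Nat.cast_le.2 hn)
  have hn2 : t ≤ (n : ℝ≥0) := (Nat.le_ceil _).trans (Nat.cast_le.2 hnt)
  have hn3 : n₀ ≤ n := (Nat.le_ceil _).trans (Nat.cast_le.2 hnn)
  have h1 : dist (g n o) (σ.1 n) ≤ N + (M + R) := by
    have := dist_triangle (σ.1 n) (ρ.1 n) (g n o)
    rw [dist_comm (g n o)]
    have := hN n; have := hd n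
    linarith
  have h2 := dist_triangle (σ.1 0) (g n o) (σ.1 n)
  have h3 : dist (σ.1 0) (σ.1 (n : ℝ≥0)) = n := by rw [ray_dist_zero]; simp
  have h4 : max (t : ℝ) n₀ ≤ dist (σ.1 0) (g n o) := by linarith
  obtain ⟨p, p1, p2, p3⟩ := hX.exists_point (σ.1 0) (g n o) t.2 ((le_max_left _ _).trans h4)
  refine ⟨p, p1, p3, ?_⟩
  exact hn₀ _ _ _ _ _ p3 (ray_between σ hn2) p1 (ray_dist_zero σ t) h1
    ((le_max_right _ _).trans h4) (by rw [h3]; exact hn3)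

variable [ProperSpace X]

/-- Moving the origin of the ray to its nearest point on C costs that distance plus κ, and the moved
ray stays 3κ-close to C. With this explicit bound the criterion is an intersection of closed
conditions on the ray. -/
theorem endpoint_mem_limitSet_iff (hX : IsCATNegOne X) (hC : IsCore Γ C o R)
    (ρ : GeodesicRay X) : ρ.endpoint ∈ limitSet Γ ↔
      ∀ t : ℝ≥0, Metric.infDist (ρ.1 t) C ≤ Metric.infDist (ρ.1 0) C + 4 * κ := by
  constructor
  · intro h t
    obtain ⟨a, ha, had⟩ := hC.closed.exists_infDist_eq_dist ⟨o, hC.base_mem⟩ (ρ.1 0)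
    obtain ⟨σ, hσ, hσ0⟩ := exists_ray hX a ρ.endpoint
    obtain ⟨y, hy, hyd⟩ := exists_near_of_mem_limitSet hX hC (ρ := σ) (by rwa [hσ0])
      (by rwa [hσ]) t
    have h1 := dist_ray_ray_le hX hσ.symm t
    have h2 := Metric.infDist_le_dist_of_mem (x := ρ.1 t) hy
    have h3 := dist_triangle (ρ.1 t) (σ.1 t) y
    rw [hσ0, ← had] at h1
    linarith
  · intro h
    refine mem_limitSet_of_near hX hC (M := Metric.infDist (ρ.1 0) C + 4 * κ) fun t => ?_
    obtain ⟨a, ha, had⟩ := hC.closed.exists_infDist_eq_dist ⟨o, hC.base_mem⟩ (ρ.1 t)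
    exact ⟨a, ha, had ▸ h t⟩

theorem exists_near_bound (hX : IsCATNegOne X) (hC : IsCore Γ C o R) {ρ : GeodesicRay X}
    (hρ : ρ.endpoint ∈ limitSet Γ) : ∃ M, ∀ t : ℝ≥0, ∃ y ∈ C, dist (ρ.1 t) y ≤ M := by
  refine ⟨Metric.infDist (ρ.1 0) C + 4 * κ, fun t => ?_⟩
  obtain ⟨a, ha, had⟩ := hC.closed.exists_infDist_eq_dist ⟨o, hC.base_mem⟩ (ρ.1 t)
  exact ⟨a, ha, had ▸ (endpoint_mem_limitSet_iff hX hC ρ).1 hρ t⟩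

theorem isClosed_limitSet (hX : IsCATNegOne X) (hC : IsCore Γ C o R) :
    IsClosed (limitSet Γ) := by
  have : Quotient.mk (asymptotic X) ⁻¹' limitSet Γ =
      ⋂ t : ℝ≥0, {ρ : GeodesicRay X |
        Metric.infDist (ρ.1 t) C ≤ Metric.infDist (ρ.1 0) C + 4 * κ} := by
    ext ρ
    rw [mem_iInter]
    exact endpoint_mem_limitSet_iff hX hC ρ
  refine isClosed_coinduced.2 (this ▸ ?_ : IsClosed (Quotient.mk (asymptotic X) ⁻¹' limitSet Γ))
  have hev : ∀ t : ℝ≥0, Continuous fun ρ : GeodesicRay X => ρ.1 t := fun t =>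
    (continuous_apply t).comp continuous_subtype_val
  have hinf : ∀ t : ℝ≥0, Continuous fun ρ : GeodesicRay X => Metric.infDist (ρ.1 t) C := fun t =>
    (Metric.continuous_infDist_pt C).comp (hev t)
  exact isClosed_iInter fun t => isClosed_le (hinf t) ((hinf 0).add continuous_const)

/-- If a horoball centred at ξ met C in an unbounded set, segments of C from o to far points of it
would follow the ray from o to ξ, making ξ a limit point. Otherwise the intersection is compact and
the Busemann function attains its minimum there. -/
theorem exists_isClosestPoint (hX : IsCATNegOne X) (hC : IsCore Γ C o R) {ξ : Boundary X}
    (hξ : ξ ∉ limitSet Γ) : ∃ p, IsClosestPoint C ξ p := by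
  set f : X → ℝ := fun q => busemann ξ q o with hf
  have hfc : Continuous f := by
    refine (LipschitzWith.of_le_add fun q r => ?_).continuous
    have h1 := busemann_add hX ξ q r o
    have h2 := busemann_le_dist hX ξ q r
    simp only [hf]
    linarith
  set S : Set X := C ∩ {q | f q ≤ 0} with hS
  have hSb : Bornology.IsBounded S := by
    by_contra hb
    have hfar : ∀ r : ℝ, ∃ q ∈ S, r < dist o q := by
      intro r
      by_contra! hc
      refine hb ((Metric.isBounded_closedBall (x := o) (r := r)).subset fun q hq => ?_)
      rw [Metric.mem_closedBall, dist_comm]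
      exact hc q hq
    obtain ⟨ρ, hρ, hρ0⟩ := exists_ray hX o ξ
    refine hξ (hρ ▸ mem_limitSet_of_near hX hC (M := 2 * κ) fun t => ?_)
    -- In the horoball the Gromov product with ξ is at least half the distance, hence the factor 2.
    obtain ⟨q, hq, hqd⟩ := hfar (2 * t)
    have hb : (t : ℝ) < bgp ξ o q := by
      have : f q ≤ 0 := hq.2
      have e := busemann_neg hX ξ o q
      unfold bgp; simp only [hf] at this; linarith
    obtain ⟨p, p1, p2, p3⟩ := hX.exists_point o q t.2 (by
      have : (0 : ℝ) ≤ t := t.2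
      change (t : ℝ) ≤ _; linarith)
    refine ⟨p, hC.convex _ hC.base_mem _ hq.1 _ p3, ?_⟩
    rw [dist_comm]
    exact dist_ray_le_of_lt_bgp hX hρ hρ0 hb p3 p1
  have hScl : IsClosed S := hC.closed.inter (isClosed_le hfc continuous_const)
  have hSc : IsCompact S := Metric.isCompact_of_isClosed_isBounded hScl hSb
  obtain ⟨p, hp, hmin⟩ := hSc.exists_isMinOn ⟨o, hC.base_mem, (busemann_self hX ξ o).le⟩
    hfc.continuousOn
  refine ⟨p, isClosestPoint_of_minimal hX hC.convex hp.1 fun q hq => ?_⟩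
  have h1 := busemann_add hX ξ q p o
  have h2 : f p ≤ 0 := hp.2
  have h3 : f p ≤ f q := by
    by_cases hq0 : f q ≤ 0
    · exact hmin ⟨hq, hq0⟩
    · linarith
  simp only [hf] at h3
  linarith

theorem perpRay_spec (hX : IsCATNegOne X) (hC : IsCore Γ C o R) {ξ : Boundary X}
    (hξ : ξ ∉ limitSet Γ) :
    (perpRay C ξ).endpoint = ξ ∧ IsClosestPoint C ξ ((perpRay C ξ).1 0) := by
  obtain ⟨p, hp⟩ := exists_isClosestPoint hX hC hξ
  obtain ⟨ρ, hρ, hρ0⟩ := exists_ray hX p ξ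
  have h : ∃ ρ : GeodesicRay X, ρ.endpoint = ξ ∧ IsClosestPoint C ξ (ρ.1 0) :=
    ⟨ρ, hρ, by rwa [hρ0]⟩
  rw [perpRay, dif_pos h]
  exact h.choose_spec

end Core

end LimitSets

section Counting

variable {X : Type*} [MetricSpace X]

/-! ### Orbital counting -/

/-- The displacement of the base point. -/
def len (o : X) (g : X ≃ᵢ X) : ℝ := dist o (g o)

theorem len_nonneg (o : X) (g : X ≃ᵢ X) : 0 ≤ len o g := dist_nonneg

theorem inv_apply_self (g : X ≃ᵢ X) (x : X) : g⁻¹ (g x) = x := g.symm_apply_apply x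

theorem apply_inv_self (g : X ≃ᵢ X) (x : X) : g (g⁻¹ x) = x := g.apply_symm_apply x

theorem len_inv (o : X) (g : X ≃ᵢ X) : len o g⁻¹ = len o g := by
  unfold len
  rw [← g.dist_eq, apply_inv_self, dist_comm]

theorem dist_apply_apply (o : X) (g h : X ≃ᵢ X) : dist (g o) (h o) = len o (g⁻¹ * h) := by
  unfold len
  rw [← g⁻¹.dist_eq, inv_apply_self]
  rfl

theorem len_mul_le (o : X) (g h : X ≃ᵢ X) : len o (g * h) ≤ len o g + len o h := by
  unfold len
  refine (dist_triangle o (g o) _).trans (add_le_add le_rfl ?_)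
  exact (g.dist_eq o (h o)).le

theorem IsDiscreteGroup.mono {Γ Γ' : Subgroup (X ≃ᵢ X)} (h : IsDiscreteGroup Γ) (hle : Γ' ≤ Γ) :
    IsDiscreteGroup Γ' := fun K hK =>
  (h K hK).subset fun _ hγ => ⟨hle hγ.1, hγ.2⟩

theorem IsDiscreteGroup.finite_ball [ProperSpace X] {Γ : Subgroup (X ≃ᵢ X)}
    (h : IsDiscreteGroup Γ) (o : X) (r : ℝ) : {α : Γ | len o α.1 ≤ r}.Finite := by
  have h1 := h (Metric.closedBall o (max r 0)) (isCompact_closedBall _ _)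
  refine Set.Finite.of_finite_image (f := Subtype.val) (h1.subset ?_) Subtype.val_injective.injOn
  rintro _ ⟨α, hα, rfl⟩
  refine ⟨α.2, α.1 o, ⟨o, by simp, rfl⟩, ?_⟩
  rw [Metric.mem_closedBall, dist_comm]
  exact le_trans hα (le_max_left _ _)

theorem IsDiscreteGroup.countable [ProperSpace X] [Nonempty X] {Γ : Subgroup (X ≃ᵢ X)}
    (h : IsDiscreteGroup Γ) : Countable Γ := by
  obtain ⟨o⟩ := ‹Nonempty X›
  have : (univ : Set Γ) = ⋃ n : ℕ, {α : Γ | len o α.1 ≤ n} := by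
    refine (eq_univ_of_forall fun α => ?_).symm
    rw [mem_iUnion]
    exact exists_nat_ge (len o α.1)
  rw [← countable_univ_iff, this]
  exact countable_iUnion fun n => (h.finite_ball o n).countable

theorem IsDiscreteGroup.finite_annulus [ProperSpace X] {Γ : Subgroup (X ≃ᵢ X)}
    (h : IsDiscreteGroup Γ) (o : X) (n L : ℝ) : {α : Γ | |len o α.1 - n| ≤ L}.Finite := by
  refine (h.finite_ball o (n + L)).subset fun α hα => ?_
  have := (abs_le.1 (mem_ofPred_eq ▸ hα)).2
  rw [mem_ofPred_eq]; linarith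

/-- The terms of the Poincaré series. -/
def poincareTerm (o : X) (s : ℝ) (g : X ≃ᵢ X) : ℝ≥0∞ := ENNReal.ofReal (Real.exp (-s * len o g))

theorem poincareTerm_mul_le {o : X} {s : ℝ} (hs : 0 ≤ s) {a b c : ℝ} {g h k : X ≃ᵢ X}
    (hle : a + len o g + len o h ≤ len o k + b + c) :
    poincareTerm o s k ≤
      ENNReal.ofReal (Real.exp (-s * (a + len o g - b - c))) * poincareTerm o s h := by
  unfold poincareTerm
  rw [← ENNReal.ofReal_mul (Real.exp_pos _).le, ← Real.exp_add]
  refine ENNReal.ofReal_le_ofReal (Real.exp_le_exp.2 ?_)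
  nlinarith

theorem summable_iff_tsum_poincareTerm {Γ : Subgroup (X ≃ᵢ X)} {o : X} {s : ℝ} :
    (Summable fun α : Γ => Real.exp (-s * dist o (α.1 o))) ↔
      ∑' α : Γ, poincareTerm o s α.1 ≠ ⊤ := by
  constructor
  · intro h
    exact h.tsum_ofReal_ne_top
  · intro h
    have := ENNReal.summable_toReal h
    refine this.congr fun α => ?_
    exact ENNReal.toReal_ofReal (Real.exp_pos _).le

theorem tsum_poincareTerm_ne_top {Γ : Subgroup (X ≃ᵢ X)} {o : X}
    (hfin : criticalExponent Γ o ≠ ⊤) {s : ℝ} (hs : (criticalExponent Γ o).toReal < s) :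
    ∑' α : Γ, poincareTerm o s α.1 ≠ ⊤ := by
  have hs0 : 0 < s := ENNReal.toReal_nonneg.trans_lt hs
  have h1 : criticalExponent Γ o < ENNReal.ofReal s :=
    (ENNReal.lt_ofReal_iff_toReal_lt hfin).2 hs
  obtain ⟨_, ⟨a, rfl, ha⟩, has⟩ := sInf_lt_iff.1 h1
  have has' : (a : ℝ) < s := by
    rw [ENNReal.ofReal, ENNReal.coe_lt_coe] at has
    exact Real.lt_toNNReal_iff_coe_lt.1 has
  rw [summable_iff_tsum_poincareTerm] at ha
  refine ne_top_of_le_ne_top ha (ENNReal.tsum_le_tsum fun α => ?_)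
  refine ENNReal.ofReal_le_ofReal (Real.exp_le_exp.2 ?_)
  have := len_nonneg o α.1
  nlinarith

theorem tsum_poincareTerm_eq_top {Γ : Subgroup (X ≃ᵢ X)} {o : X} {s : ℝ} (hs0 : 0 ≤ s)
    (hs : s < (criticalExponent Γ o).toReal) : ∑' α : Γ, poincareTerm o s α.1 = ⊤ := by
  by_contra h
  have h1 := summable_iff_tsum_poincareTerm.2 h
  have h2 : criticalExponent Γ o ≤ (s.toNNReal : ℝ≥0∞) :=
    sInf_le ⟨s.toNNReal, rfl, by rwa [Real.coe_toNNReal s hs0]⟩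
  have h3 := ENNReal.toReal_mono ENNReal.coe_ne_top h2
  rw [ENNReal.coe_toReal, Real.coe_toNNReal s hs0] at h3
  linarith

/-! ### Lower bound for orbital counting. -/

section Core

variable {Γ : Subgroup (X ≃ᵢ X)} {C : Set X} {o : X} {R : ℝ}

/-- The segment from `o` to `α o` passes close to the orbit at time `n`. -/
theorem exists_factor (hX : IsCATNegOne X) (hC : IsCore Γ C o R) {n : ℝ} (hn : 0 ≤ n) (α : Γ)
    (hα : n ≤ len o α.1) : ∃ β : Γ, |len o β.1 - n| ≤ R ∧
      len o (β⁻¹ * α : Γ).1 ≤ len o α.1 - n + R ∧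
      len o β.1 + len o (β⁻¹ * α : Γ).1 ≤ len o α.1 + 2 * R := by
  obtain ⟨p, p1, p2, p3⟩ := hX.exists_point o (α.1 o) hn hα
  obtain ⟨β, hβ, hβd⟩ := hC.dense p
    (hC.convex _ hC.base_mem _ (hC.map_mem _ α.2 _ hC.base_mem) _ p3)
  have e : len o (β⁻¹ * α.1) = dist (β o) (α.1 o) := (dist_apply_apply o β α.1).symm
  have h1 := dist_triangle o p (β o)
  have h2 := dist_triangle o (β o) p
  have h3 := dist_triangle (β o) p (α.1 o)
  rw [dist_comm (β o) p] at h2 h3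
  have e2 : len o β = dist o (β o) := rfl
  have e3 : len o α.1 = dist o (α.1 o) := rfl
  refine ⟨⟨β, hβ⟩, ?_, ?_, ?_⟩
  · change |len o β - n| ≤ R
    rw [abs_le]; constructor <;> linarith
  · change len o (β⁻¹ * α.1) ≤ _
    linarith
  · change len o β + len o (β⁻¹ * α.1) ≤ _
    linarith

variable [ProperSpace X]

/-- A renewal argument: every element longer than n is β times an element that is no longer than it,
with β in the annulus and lengths additive up to 2R. So the series is at most a finite part plus q
times itself, with q < 1. -/
theorem tsum_poincareTerm_ne_top_of_lt_one (hX : IsCATNegOne X) (hD : IsDiscreteGroup Γ)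
    (hC : IsCore Γ C o R) {n s : ℝ} (hn : R ≤ n) (hs : 0 ≤ s)
    (hq : ∑ β ∈ (hD.finite_annulus o n R).toFinset,
      Real.exp (-s * (len o β.1 - 2 * R)) < 1) :
    ∑' α : Γ, poincareTerm o s α.1 ≠ ⊤ := by
  classical
  set A := (hD.finite_annulus o n R).toFinset with hA
  set q := ∑ β ∈ A, Real.exp (-s * (len o β.1 - 2 * R)) with hqdef
  have hn0 : 0 ≤ n := hC.nonneg.trans hn
  -- The series is truncated at length t so that q times it can be subtracted; the bound obtained
  -- does not depend on t.
  set E : ℝ → Γ → ℝ≥0∞ := fun t α => if len o α.1 ≤ t then poincareTerm o s α.1 else 0 with hE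
  have hfin : ∀ t, ∑' α, E t α ≠ ⊤ := by
    intro t
    rw [tsum_eq_sum (s := (hD.finite_ball o t).toFinset)]
    · refine (ENNReal.sum_lt_top.2 fun α _ => ?_).ne
      simp only [hE]
      split_ifs
      · exact ENNReal.ofReal_lt_top
      · exact ENNReal.zero_lt_top
    · intro α hα
      rw [Finite.mem_toFinset, mem_ofPred_eq] at hα
      simp [hE, hα]
  have hrec : ∀ t, ∑' α, E t α ≤ ∑' α, E n α + ENNReal.ofReal q * ∑' α, E t α := by
    intro t
    have hpt : ∀ α, E t α ≤ E n α +
        ∑ β ∈ A, ENNReal.ofReal (Real.exp (-s * (len o β.1 - 2 * R))) * E t (β⁻¹ * α) := by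
      intro α
      by_cases h1 : len o α.1 ≤ n
      · refine le_add_right ?_
        simp only [hE, if_pos h1]
        split_ifs <;> simp
      · by_cases h2 : len o α.1 ≤ t
        · obtain ⟨β, b1, b2, b3⟩ := exists_factor hX hC hn0 α (not_le.1 h1).le
          refine le_add_left ?_
          have hβ : β ∈ A := by rw [hA, Finite.mem_toFinset]; exact b1
          refine le_trans ?_ (Finset.single_le_sum
            (f := fun β : Γ => ENNReal.ofReal (Real.exp (-s * (len o β.1 - 2 * R))) *
              E t (β⁻¹ * α)) (fun _ _ => zero_le) hβ)
          have hle : len o (β⁻¹ * α : Γ).1 ≤ t := by linarith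
          simp only [hE, if_pos h2, if_pos hle]
          have := poincareTerm_mul_le (o := o) hs (a := 0) (b := 2 * R) (c := 0) (g := β.1)
            (h := (β⁻¹ * α : Γ).1) (k := α.1) (by linarith)
          simpa using this
        · simp [hE, if_neg h2]
    calc ∑' α, E t α ≤ ∑' α, (E n α + ∑ β ∈ A,
          ENNReal.ofReal (Real.exp (-s * (len o β.1 - 2 * R))) * E t (β⁻¹ * α)) :=
          ENNReal.tsum_le_tsum hpt
      _ = ∑' α, E n α + ∑ β ∈ A, ENNReal.ofReal (Real.exp (-s * (len o β.1 - 2 * R))) *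
          ∑' α, E t α := by
          rw [ENNReal.tsum_add, Summable.tsum_finsetSum (fun _ _ => ENNReal.summable)]
          congr 1
          refine Finset.sum_congr rfl fun β _ => ?_
          rw [ENNReal.tsum_mul_left]
          congr 1
          exact (Equiv.mulLeft β⁻¹).tsum_eq (E t)
      _ = _ := by
          rw [← Finset.sum_mul, ENNReal.ofReal_sum_of_nonneg fun _ _ => (Real.exp_pos _).le]
  have hq0 : 0 ≤ q := Finset.sum_nonneg fun _ _ => (Real.exp_pos _).le
  have hbound : ∀ t, ∑' α, E t α ≤ ENNReal.ofReal ((∑' α, E n α).toReal / (1 - q)) := by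
    intro t
    have h1 := ENNReal.toReal_mono (by
      exact ENNReal.add_ne_top.2 ⟨hfin n, ENNReal.mul_ne_top ENNReal.ofReal_ne_top (hfin t)⟩)
      (hrec t)
    rw [ENNReal.toReal_add (hfin n) (ENNReal.mul_ne_top ENNReal.ofReal_ne_top (hfin t)),
      ENNReal.toReal_mul, ENNReal.toReal_ofReal hq0] at h1
    rw [← ENNReal.ofReal_toReal (hfin t)]
    refine ENNReal.ofReal_le_ofReal ?_
    rw [le_div_iff₀ (by linarith)]
    linarith
  refine ne_top_of_le_ne_top
    (ENNReal.ofReal_ne_top (r := (∑' α, E n α).toReal / (1 - q))) ?_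
  rw [ENNReal.tsum_eq_iSup_sum]
  refine iSup_le fun F => ?_
  have hF : ∑ α ∈ F, poincareTerm o s α.1 = ∑ α ∈ F, E (∑ β ∈ F, len o β.1) α := by
    refine Finset.sum_congr rfl fun α hα => ?_
    have : len o α.1 ≤ ∑ β ∈ F, len o β.1 :=
      Finset.single_le_sum (f := fun β : Γ => len o β.1) (fun _ _ => len_nonneg _ _) hα
    simp only [hE, if_pos this]
  rw [hF]
  exact (ENNReal.sum_le_tsum F).trans (hbound _)

theorem infinite_of_limitSet (hX : IsCATNegOne X) (hC : IsCore Γ C o R)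
    (hΛ : (limitSet Γ).Nonempty) : Infinite Γ := by
  rw [← not_finite_iff_infinite]
  intro hfinite
  obtain ⟨ξ, hξ⟩ := hΛ
  obtain ⟨ρ, hρ, h0⟩ := exists_ray hX o ξ
  obtain ⟨B, hB⟩ := (Set.finite_range fun α : Γ => len o α.1).bddAbove
  obtain ⟨t, ht⟩ : ∃ t : ℝ≥0, B + R + 3 * κ < t := by
    refine ⟨(B + R + 3 * κ + 1).toNNReal, ?_⟩
    have := Real.le_coe_toNNReal (B + R + 3 * κ + 1)
    linarith
  obtain ⟨y, hy, hyd⟩ := exists_near_of_mem_limitSet hX hC (by rw [h0]; exact hC.base_mem)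
    (hρ.symm ▸ hξ) t
  obtain ⟨α, hα, hαd⟩ := hC.dense y hy
  have h1 : len o α ≤ B := hB ⟨⟨α, hα⟩, rfl⟩
  have h2 := dist_triangle4 o (α o) y (ρ.1 t)
  have h3 := ray_dist_zero ρ t
  rw [h0] at h3
  rw [dist_comm (α o) y, dist_comm y (ρ.1 t)] at h2
  unfold len at h1
  linarith

/-- Lower bound on the number of orbit points in annuli. -/
theorem exp_le_card_annulus (hX : IsCATNegOne X) (hD : IsDiscreteGroup Γ) (hC : IsCore Γ C o R)
    (hΛ : (limitSet Γ).Nonempty) {n : ℝ} (hn : R ≤ n) :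
    Real.exp ((criticalExponent Γ o).toReal * (n - 3 * R)) ≤
      (hD.finite_annulus o n R).toFinset.card := by
  set A := (hD.finite_annulus o n R).toFinset with hA
  set δ := (criticalExponent Γ o).toReal with hδ
  have hδ0 : 0 ≤ δ := ENNReal.toReal_nonneg
  have hge : ∀ s, 0 ≤ s → ∑' α : Γ, poincareTerm o s α.1 = ⊤ →
      1 ≤ ∑ β ∈ A, Real.exp (-s * (len o β.1 - 2 * R)) := by
    intro s hs h
    by_contra! hlt
    exact tsum_poincareTerm_ne_top_of_lt_one hX hD hC hn hs hlt h
  have hδge : 1 ≤ ∑ β ∈ A, Real.exp (-δ * (len o β.1 - 2 * R)) := by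
    -- At exponent 0 the divergence is the infiniteness of the group. For a positive exponent the
    -- inequality is obtained below it and passes to the limit, since the sum over the annulus is
    -- finite.
    rcases hδ0.eq_or_lt with h0 | hpos
    · have := infinite_of_limitSet hX hC hΛ
      refine hge δ hδ0 ?_
      rw [← h0]
      simp [poincareTerm]
    · have hcont : Continuous fun s : ℝ => ∑ β ∈ A, Real.exp (-s * (len o β.1 - 2 * R)) := by
        fun_prop
      refine ge_of_tendsto (hcont.continuousWithinAt (s := Iio δ) (x := δ)) ?_
      filter_upwards [Ioo_mem_nhdsLT hpos] with s hs
      exact hge s hs.1.le (tsum_poincareTerm_eq_top hs.1.le hs.2)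
  have hle : ∑ β ∈ A, Real.exp (-δ * (len o β.1 - 2 * R)) ≤
      A.card * Real.exp (-δ * (n - 3 * R)) := by
    rw [← nsmul_eq_mul]
    refine Finset.sum_le_card_nsmul _ _ _ fun β hβ => Real.exp_le_exp.2 ?_
    rw [hA, Finite.mem_toFinset, mem_ofPred_eq, abs_le] at hβ
    nlinarith [hβ.1]
  have h1 := hδge.trans hle
  rw [neg_mul, Real.exp_neg, ← div_eq_mul_inv, le_div_iff₀ (Real.exp_pos _), one_mul] at h1
  exact h1

end Core

end Counting

/-! ### Upper bound for orbital counting. -/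

section UpperCounting

variable {X : Type*} [MetricSpace X] {Γ : Subgroup (X ≃ᵢ X)} {C : Set X} {o : X} {R : ℝ}

/-- Finitely many elements of the group suffice to move any orbit point away from any given
direction. -/
def HasSpreading (Γ : Subgroup (X ≃ᵢ X)) (o : X) : Prop :=
  ∃ (F : Finset Γ) (r : ℝ), ∀ (β : Γ) (u : X), ∃ f ∈ F, gp o u ((f * β : Γ).1 o) ≤ r

theorem tsum_poincareTerm_ne_zero (Γ : Subgroup (X ≃ᵢ X)) (o : X) (s : ℝ) :
    ∑' α : Γ, poincareTerm o s α.1 ≠ 0 := by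
  intro h
  have := ENNReal.tsum_eq_zero.1 h 1
  rw [poincareTerm, ENNReal.ofReal_eq_zero] at this
  exact absurd (Real.exp_pos _) (not_lt.2 this)

theorem busemann_mul_of_fixed (hX : IsCATNegOne X) {ξ : Boundary X} {g h : X ≃ᵢ X}
    (hg : g • ξ = ξ) :
    busemann ξ ((g * h) o) o = busemann ξ (g o) o + busemann ξ (h o) o := by
  rw [← busemann_add hX ξ _ (g o) o, add_comm]
  congr 1
  conv_lhs => rw [← hg]
  exact busemann_smul hX g ξ (h o) o

variable [ProperSpace X]

/-- The orbit points γo in question lie near the point at distance about n from o on the segment to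
αo, so they are close to one another. -/
theorem card_filter_annulus_le (hX : IsCATNegOne X) (hD : IsDiscreteGroup Γ) (n L r : ℝ)
    (α : Γ) {S : Finset Γ} (hS : ∀ γ ∈ S, |len o γ.1 - n| ≤ L ∧ gp (γ.1 o) o (α.1 o) ≤ r) :
    S.card ≤ (hD.finite_ball o (2 * (2 * L + r + 2 * κ))).toFinset.card := by
  classical
  rcases S.eq_empty_or_nonempty with rfl | ⟨γ₁, h₁⟩
  · simp
  refine Finset.card_le_card_of_injOn (fun γ => γ₁⁻¹ * γ) (fun γ hγ => ?_)
    (fun a _ b _ h => mul_left_cancel h)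
  rw [Finset.mem_coe, Finite.mem_toFinset, mem_ofPred_eq]
  change len o (γ₁.1⁻¹ * γ.1) ≤ _
  rw [← dist_apply_apply]
  obtain ⟨a1, a2⟩ := hS γ hγ
  obtain ⟨b1, b2⟩ := hS γ₁ h₁
  rw [abs_le] at a1 b1
  have e1 := gp_add o (γ.1 o) (α.1 o)
  have e2 := gp_add o (γ₁.1 o) (α.1 o)
  have l1 : len o γ.1 = dist o (γ.1 o) := rfl
  have l2 : len o γ₁.1 = dist o (γ₁.1 o) := rfl
  have h := hX.le_gp_of_le (o := o) (u := γ₁.1 o) (v := α.1 o) (w := γ.1 o) (a := n - L - r)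
    (by linarith) (by rw [gp_comm]; linarith)
  have : gp o (γ₁.1 o) (γ.1 o) =
    (dist o (γ₁.1 o) + dist o (γ.1 o) - dist (γ₁.1 o) (γ.1 o)) / 2 := rfl
  linarith

/-- Upper bound on the number of orbit points in annuli. -/
theorem card_annulus_le_of_hasSpreading (hX : IsCATNegOne X) (hD : IsDiscreteGroup Γ)
    (hfin : criticalExponent Γ o ≠ ⊤) (hsp : HasSpreading Γ o) (L : ℝ) :
    ∃ c : ℝ, 0 < c ∧ ∀ n : ℝ, ((hD.finite_annulus o n L).toFinset.card : ℝ) ≤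
      c * Real.exp ((criticalExponent Γ o).toReal * n) := by
  classical
  obtain ⟨F, r, hF⟩ := hsp
  set δ := (criticalExponent Γ o).toReal with hδ
  set M := (hD.finite_ball o (2 * (2 * L + r + 2 * κ))).toFinset.card with hM
  -- The series may diverge at δ itself. The constant is continuous in s, so s is sent to δ at the
  -- end.
  have key : ∀ n s : ℝ, δ < s → ((hD.finite_annulus o n L).toFinset.card : ℝ) ≤
      (∑ f ∈ F, Real.exp (s * len o f.1)) * M * Real.exp (s * (n + L)) := by
    intro n s hs
    have hs0 : 0 ≤ s := ENNReal.toReal_nonneg.trans hs.le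
    set A := (hD.finite_annulus o n L).toFinset with hA
    have hAmem : ∀ γ ∈ A, |len o γ.1 - n| ≤ L := fun γ hγ => by
      rw [hA, Finite.mem_toFinset] at hγ; exact hγ
    set Z := ∑' α : Γ, poincareTerm o s α.1 with hZ
    have hZtop : Z ≠ ⊤ := tsum_poincareTerm_ne_top hfin hs
    have hZ0 : Z ≠ 0 := tsum_poincareTerm_ne_zero Γ o s
    set Q := ∑ f ∈ F, ENNReal.ofReal (Real.exp (s * len o f.1)) with hQ
    set G : X → Γ → ℝ≥0∞ := fun u β =>
      if gp o u (β.1 o) ≤ r then poincareTerm o s β.1 else 0 with hG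
    set G' : Γ → Γ → ℝ≥0∞ := fun γ α =>
      if gp (γ.1 o) o (α.1 o) ≤ r then poincareTerm o s α.1 else 0 with hG'
    -- Spreading: moving β by some f in F, at a cost bounded through Q, makes it avoid the direction
    -- of u. Hence the orbit points avoiding u carry a definite proportion of the series.
    have h1 : ∀ u, Z ≤ Q * ∑' β, G u β := by
      intro u
      calc Z ≤ ∑' β : Γ, ∑ f ∈ F, ENNReal.ofReal (Real.exp (s * len o f.1)) * G u (f * β) := by
            refine ENNReal.tsum_le_tsum fun β => ?_
            obtain ⟨f, hf, hfr⟩ := hF β u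
            refine le_trans ?_ (Finset.single_le_sum (f := fun f : Γ =>
              ENNReal.ofReal (Real.exp (s * len o f.1)) * G u (f * β)) (fun _ _ => zero_le) hf)
            simp only [hG, if_pos hfr, poincareTerm]
            rw [← ENNReal.ofReal_mul (Real.exp_pos _).le, ← Real.exp_add]
            refine ENNReal.ofReal_le_ofReal (Real.exp_le_exp.2 ?_)
            have := len_mul_le o f.1 β.1
            change _ ≤ s * len o f.1 + -s * len o (f.1 * β.1)
            nlinarith
        _ = _ := by
            rw [Summable.tsum_finsetSum (fun _ _ => ENNReal.summable), hQ, Finset.sum_mul]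
            refine Finset.sum_congr rfl fun f _ => ?_
            rw [ENNReal.tsum_mul_left]
            congr 1
            exact (Equiv.mulLeft f).tsum_eq (G u)
    set K := ENNReal.ofReal (Real.exp (-s * (n + L))) with hK
    -- Translated by γ with u = γ⁻¹o: the orbit points behind γo, as seen from o, carry a proportion
    -- exp(-s(n + L)) of the series, up to Q.
    have h2 : ∀ γ ∈ A, K * Z ≤ Q * ∑' α, G' γ α := by
      intro γ hγ
      have h3 : K * ∑' β, G (γ.1⁻¹ o) β ≤ ∑' α, G' γ α := by
        rw [← (Equiv.mulLeft γ).tsum_eq (G' γ), ← ENNReal.tsum_mul_left]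
        refine ENNReal.tsum_le_tsum fun β => ?_
        have e : gp (γ.1 o) o ((γ * β : Γ).1 o) = gp o (γ.1⁻¹ o) (β.1 o) := by
          rw [← gp_map γ.1 o, apply_inv_self]; rfl
        simp only [hG, hG', Equiv.coe_mulLeft, e]
        split_ifs
        · unfold poincareTerm
          rw [hK, ← ENNReal.ofReal_mul (Real.exp_pos _).le, ← Real.exp_add]
          refine ENNReal.ofReal_le_ofReal (Real.exp_le_exp.2 ?_)
          have h4 := len_mul_le o γ.1 β.1
          have h5 := (abs_le.1 (hAmem γ hγ)).2
          change _ ≤ -s * len o (γ.1 * β.1)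
          nlinarith
        · simp
      calc K * Z ≤ K * (Q * ∑' β, G (γ.1⁻¹ o) β) := by gcongr; exact h1 _
        _ = Q * (K * ∑' β, G (γ.1⁻¹ o) β) := by ring
        _ ≤ _ := by gcongr
    -- Summing over the annulus, each α is behind at most M of the points γo; the finite nonzero Z
    -- then cancels.
    have h6 : (A.card : ℝ≥0∞) * (K * Z) ≤ Q * (M * Z) := by
      calc (A.card : ℝ≥0∞) * (K * Z) = ∑ _γ ∈ A, K * Z := by
            rw [Finset.sum_const, nsmul_eq_mul]
        _ ≤ ∑ γ ∈ A, Q * ∑' α, G' γ α := Finset.sum_le_sum h2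
        _ = Q * ∑' α, ∑ γ ∈ A, G' γ α := by
            rw [← Finset.mul_sum, Summable.tsum_finsetSum (fun _ _ => ENNReal.summable)]
        _ ≤ Q * ∑' α : Γ, M * poincareTerm o s α.1 := by
            gcongr with α
            rw [← Finset.sum_filter, Finset.sum_const, nsmul_eq_mul]
            gcongr
            refine card_filter_annulus_le hX hD n L r α fun γ hγ => ?_
            rw [Finset.mem_filter] at hγ
            exact ⟨hAmem γ hγ.1, hγ.2⟩
        _ = Q * (M * Z) := by rw [ENNReal.tsum_mul_left]
    have h7 : (A.card : ℝ≥0∞) * K ≤ Q * M := by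
      rw [← mul_assoc, ← mul_assoc] at h6
      exact (ENNReal.mul_le_mul_iff_left hZ0 hZtop).1 h6
    have h8 : (A.card : ℝ≥0∞) * K = ENNReal.ofReal (A.card * Real.exp (-s * (n + L))) := by
      rw [ENNReal.ofReal_mul (by positivity), ENNReal.ofReal_natCast]
    have h9 : Q * M = ENNReal.ofReal ((∑ f ∈ F, Real.exp (s * len o f.1)) * M) := by
      rw [ENNReal.ofReal_mul (Finset.sum_nonneg fun _ _ => (Real.exp_pos _).le),
        ENNReal.ofReal_natCast, ENNReal.ofReal_sum_of_nonneg fun _ _ => (Real.exp_pos _).le]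
    rw [h8, h9, ENNReal.ofReal_le_ofReal_iff (mul_nonneg
      (Finset.sum_nonneg fun _ _ => (Real.exp_pos _).le) (by positivity)), neg_mul, Real.exp_neg,
      ← div_eq_mul_inv, div_le_iff₀ (Real.exp_pos _)] at h7
    exact h7
  refine ⟨(∑ f ∈ F, Real.exp (δ * len o f.1)) * M * Real.exp (δ * L) + 1, ?_, fun n => ?_⟩
  · have : 0 ≤ ∑ f ∈ F, Real.exp (δ * len o f.1) := Finset.sum_nonneg fun _ _ => (Real.exp_pos _).le
    positivity
  · have hcont : Continuous fun s : ℝ =>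
        (∑ f ∈ F, Real.exp (s * len o f.1)) * M * Real.exp (s * (n + L)) := by fun_prop
    have h := ge_of_tendsto (hcont.continuousWithinAt (s := Ioi δ) (x := δ)) (b :=
      ((hD.finite_annulus o n L).toFinset.card : ℝ)) (by
        filter_upwards [self_mem_nhdsWithin] with s hs
        exact key n s hs)
    refine h.trans ?_
    beta_reduce
    rw [mul_add δ n L, Real.exp_add]
    have := Real.exp_pos (δ * n)
    nlinarith

/-- Without spreading, the group fixes a point at infinity. -/
theorem exists_fixed_ray (hX : IsCATNegOne X) (hD : IsDiscreteGroup Γ) (hC : IsCore Γ C o R)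
    (hsp : ¬HasSpreading Γ o) : ∃ ρ : GeodesicRay X, ρ.1 0 = o ∧
      (∀ t, ∃ g : Γ, dist (ρ.1 t) (g.1 o) ≤ R + 1) ∧
      ∀ h : Γ, h.1 • ρ.endpoint = ρ.endpoint := by
  -- Spreading fails for the ball of radius k with bound k: all short elements leave the orbit point
  -- of β in the direction of u. A limit of these directions is then fixed by every element.
  have hk : ∀ k : ℕ, ∃ (β : Γ) (u : X), ∀ f : Γ, len o f.1 ≤ k →
      (k : ℝ) < gp o u ((f * β : Γ).1 o) := by
    intro k
    by_contra! hc
    refine hsp ⟨(hD.finite_ball o k).toFinset, k, fun β u => ?_⟩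
    obtain ⟨f, hf, hf'⟩ := hc β u
    exact ⟨f, by rw [Finite.mem_toFinset]; exact hf, hf'⟩
  choose β u hβu using hk
  have hu1 : ∀ k : ℕ, (k : ℝ) < gp o (u k) ((β k).1 o) := by
    intro k
    have := hβu k 1 (by simp [len])
    rwa [one_mul] at this
  have hcast : Tendsto (fun n : ℕ => (n : ℝ)) (hyperfilter ℕ) atTop :=
    tendsto_natCast_atTop_atTop.mono_left Nat.hyperfilter_le_atTop
  have hy : Tendsto (fun k => dist o ((β k).1 o)) (hyperfilter ℕ) atTop :=
    tendsto_atTop_mono (fun k => (hu1 k).le.trans (gp_le_right _ _ _)) hcast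
  obtain ⟨ρ, h0, hρ⟩ := exists_ray_of_tendsto hX (hyperfilter ℕ) o (fun k => (β k).1 o) hy
  refine ⟨ρ, h0, fun t => ?_, fun h => ?_⟩
  · obtain ⟨k, p, p1, p2, p3⟩ := (hρ t 1 one_pos).exists
    obtain ⟨g, hg, hgd⟩ := hC.dense p
      (hC.convex _ hC.base_mem _ (hC.map_mem _ (β k).2 _ hC.base_mem) _ p2)
    refine ⟨⟨g, hg⟩, ?_⟩
    have := dist_triangle (ρ.1 t) p (g o)
    rw [dist_comm (ρ.1 t) p] at this
    change dist (ρ.1 t) (g o) ≤ _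
    linarith
  · rw [smul_endpoint, endpoint_eq_iff]
    refine ⟨len o h.1 + 3 * κ + 2, fun t => ?_⟩
    obtain ⟨k, ⟨p, p1, p2, p3⟩, hk1, hk2⟩ := ((hρ t 1 one_pos).and
      ((hcast.eventually_ge_atTop (len o h.1)).and
        (hcast.eventually_ge_atTop (t + 2 * κ)))).exists
    change dist (h.1 (ρ.1 t)) (ρ.1 t) ≤ _
    have g1 := hu1 k
    have g2 := hβu k h hk1
    set y := (β k).1 o with hy
    change (k : ℝ) < gp o (u k) (h.1 y) at g2
    have g3 := hX.le_gp_of_le (o := o) (u := y) (v := u k) (w := h.1 y) (a := k)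
      (by rw [gp_comm]; exact g1.le) g2.le
    obtain ⟨q, q1, q2, q3⟩ := hX.exists_point o (h.1 y) t.2
      (le_trans (by change (t : ℝ) ≤ k - 2 * κ; linarith) (g3.trans (gp_le_right _ _ _)))
    change dist o q = t at q1
    change dist q _ = dist o (h.1 y) - t at q2
    have f1 := hX.fellow_travel p2 q3 (p1.trans q1.symm) (by rw [p1]; linarith)
    have f2 := hX.dist_le_max (h.1 p) q3
    rw [q1, q2, h.1.dist_eq] at f2
    have hlen : len o h.1 = dist o (h.1 o) := rfl
    have f3 := dist_triangle o (h.1 o) (h.1 p)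
    have f4 := dist_triangle (h.1 o) o (h.1 y)
    rw [h.1.dist_eq] at f3 f4
    rw [dist_comm (h.1 o) o] at f4
    have f5 : max (dist o (h.1 p) - t) (dist y p - (dist o (h.1 y) - t)) ≤ len o h.1 := by
      refine max_le (by linarith) ?_
      rw [dist_comm y p]; linarith
    have f6 := dist_triangle4 (h.1 (ρ.1 t)) (h.1 p) q p
    have f7 := dist_triangle (h.1 (ρ.1 t)) p (ρ.1 t)
    rw [h.1.dist_eq, dist_comm (ρ.1 t) p, dist_comm (h.1 p) q, dist_comm q p] at f6
    linarith

/-! ### Groups fixing a point at infinity. -/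

section Fixed

variable {ρ : GeodesicRay X}

/-- Far along the ray, such elements move ρ(t) by a bounded amount. Conjugating any finite family by
a group element carrying o near ρ(t) puts it in a fixed ball of the discrete group, which bounds its
size. -/
theorem finite_busemann_le_of_fixed (hX : IsCATNegOne X) (hD : IsDiscreteGroup Γ)
    (h0 : ρ.1 0 = o) (hnear : ∀ t, ∃ g : Γ, dist (ρ.1 t) (g.1 o) ≤ R + 1)
    (hfix : ∀ h : Γ, h.1 • ρ.endpoint = ρ.endpoint) (L : ℝ) :
    {h : Γ | |busemann ρ.endpoint (h.1 o) o| ≤ L}.Finite := by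
  classical
  by_contra hinf
  set N := (hD.finite_ball o (L + 1 + κ + 2 * (R + 1))).toFinset.card with hN
  obtain ⟨S, hS, hScard⟩ := Set.Infinite.exists_subset_card_eq hinf (N + 1)
  have hev : ∀ h ∈ S, ∀ᶠ t : ℝ≥0 in atTop, dist (ρ.1 t) (h.1 (ρ.1 t)) ≤ L + 1 + κ := by
    intro h hh
    have hb : |busemann ρ.endpoint (h.1 o) o| ≤ L := hS hh
    rw [abs_le] at hb
    have hmap : (ρ.map h.1).endpoint = ρ.endpoint := by rw [← smul_endpoint, hfix h]
    have h1 : rayBus (ρ.map h.1) o < L + 1 := by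
      have e := busemann_endpoint hX (ρ.map h.1) o (h.1 o)
      have e0 : rayBus (ρ.map h.1) (h.1 o) = 0 := by
        have := rayBus_apply (ρ.map h.1) 0
        rw [show (ρ.map h.1).1 0 = h.1 o from congrArg h.1 h0] at this
        simpa using this
      rw [hmap, busemann_neg hX, e0] at e
      linarith
    filter_upwards [(tendsto_rayBus (ρ.map h.1) o).eventually (gt_mem_nhds h1)] with t ht
    change dist o (h.1 (ρ.1 t)) - t < L + 1 at ht
    have h2 : rayBus ρ (h.1 (ρ.1 t)) + t ≤ L := by
      have e0 : rayBus ρ o = 0 := by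
        have := rayBus_apply ρ 0
        rw [h0] at this
        simpa using this
      have e1 := busemann_endpoint hX ρ (h.1 (ρ.1 t)) o
      have e2 := busemann_add hX ρ.endpoint (h.1 (ρ.1 t)) (h.1 o) o
      have e3 := busemann_smul hX h.1 ρ.endpoint (ρ.1 t) o
      have e4 := busemann_endpoint hX ρ (ρ.1 t) o
      rw [hfix h] at e3
      rw [rayBus_apply] at e4
      linarith
    refine (dist_ray_le_max hX ρ t _).trans (add_le_add (max_le ?_ ?_) le_rfl)
    · rw [h0]; exact ht.le
    · linarith
  obtain ⟨t, ht⟩ := ((Finset.eventually_all S).2 hev).exists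
  obtain ⟨g, hg⟩ := hnear t
  have hcard : S.card ≤ N := by
    refine Finset.card_le_card_of_injOn (fun h => g⁻¹ * h * g) (fun h hh => ?_)
      (fun a _ b _ h => mul_left_cancel (mul_right_cancel h))
    rw [Finset.mem_coe, Finite.mem_toFinset, mem_ofPred_eq]
    change len o (g.1⁻¹ * h.1 * g.1) ≤ _
    rw [mul_assoc, ← dist_apply_apply]
    change dist (g.1 o) (h.1 (g.1 o)) ≤ _
    have h1 := ht h hh
    have h2 := dist_triangle4 (g.1 o) (ρ.1 t) (h.1 (ρ.1 t)) (h.1 (g.1 o))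
    rw [h.1.dist_eq, dist_comm (g.1 o) (ρ.1 t)] at h2
    linarith
  omega

/-- The Busemann displacement b is a homomorphism to ℝ with finite preimages of bounded sets. Orbit
points along the ray realize every value -t up to a constant, so length equals |b| up to a constant.
Up to inversion, the annulus therefore lies in one translate of a fixed finite set. -/
theorem card_annulus_le_of_fixed (hX : IsCATNegOne X) (hD : IsDiscreteGroup Γ)
    (h0 : ρ.1 0 = o) (hnear : ∀ t, ∃ g : Γ, dist (ρ.1 t) (g.1 o) ≤ R + 1)
    (hfix : ∀ h : Γ, h.1 • ρ.endpoint = ρ.endpoint) (L : ℝ) :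
    ∃ N : ℕ, ∀ n : ℝ, 0 ≤ n → (hD.finite_annulus o n L).toFinset.card ≤ N := by
  classical
  set b : Γ → ℝ := fun h => busemann ρ.endpoint (h.1 o) o with hb
  have hmul : ∀ g h : Γ, b (g * h) = b g + b h := fun g h =>
    busemann_mul_of_fixed hX (hfix g)
  have hinv : ∀ g : Γ, b g⁻¹ = -b g := by
    intro g
    have h1 := hmul g g⁻¹
    have h2 : b 1 = 0 := busemann_self hX _ _
    rw [mul_inv_cancel, h2] at h1
    linarith
  have hfinite := finite_busemann_le_of_fixed hX hD h0 hnear hfix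
  have hble : ∀ h : Γ, |b h| ≤ len o h.1 := by
    intro h
    have h1 := busemann_le_dist hX ρ.endpoint (h.1 o) o
    have h2 := neg_dist_le_busemann hX ρ.endpoint (h.1 o) o
    rw [dist_comm] at h1 h2
    exact abs_le.2 ⟨h2, h1⟩
  have hg : ∀ t : ℝ≥0, ∃ g : Γ, |b g + t| ≤ R + 1 ∧ len o g.1 ≤ t + (R + 1) := by
    intro t
    obtain ⟨g, hgt⟩ := hnear t
    have e0 := busemann_endpoint hX ρ (ρ.1 t) (ρ.1 0)
    rw [rayBus_apply, rayBus_apply, h0, NNReal.coe_zero] at e0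
    have e1 := busemann_add hX ρ.endpoint (g.1 o) (ρ.1 t) o
    have e2 := busemann_le_dist hX ρ.endpoint (g.1 o) (ρ.1 t)
    have e3 := neg_dist_le_busemann hX ρ.endpoint (g.1 o) (ρ.1 t)
    rw [dist_comm] at e2 e3
    have e4 := dist_triangle o (ρ.1 t) (g.1 o)
    have e5 := ray_dist_zero ρ t
    rw [h0] at e5
    refine ⟨g, ?_, ?_⟩
    · simp only [hb]
      rw [abs_le]; constructor <;> linarith
    · unfold len; linarith
  obtain ⟨B, hB⟩ := ((hfinite (R + 1)).image fun h => len o h.1).bddAbove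
  have hlen0 : ∀ α : Γ, b α ≤ 0 → len o α.1 ≤ |b α| + (R + 1 + B) := by
    intro α hα
    obtain ⟨g, hg1, hg2⟩ := hg ⟨-b α, by linarith⟩
    change |b g + -b α| ≤ R + 1 at hg1
    change len o g.1 ≤ -b α + (R + 1) at hg2
    have h1 : |b (g⁻¹ * α)| ≤ R + 1 := by
      rw [hmul, hinv, ← abs_neg]
      convert hg1 using 2; ring
    have h2 : len o (g⁻¹ * α : Γ).1 ≤ B := hB ⟨g⁻¹ * α, h1, rfl⟩
    have h3 := len_mul_le o g.1 (g⁻¹ * α : Γ).1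
    have h4 : g.1 * (g⁻¹ * α : Γ).1 = α.1 := congrArg Subtype.val (mul_inv_cancel_left g α)
    rw [h4] at h3
    rw [abs_of_nonpos hα]
    linarith
  set H := (hfinite (L + (R + 1 + B) + (R + 1))).toFinset with hH
  refine ⟨H.card + H.card, fun n hn => ?_⟩
  obtain ⟨g, hg1, -⟩ := hg ⟨n, hn⟩
  change |b g + n| ≤ R + 1 at hg1
  have hmem : ∀ α : Γ, |len o α.1 - n| ≤ L → b α ≤ 0 → g⁻¹ * α ∈ H := by
    intro α hα hα0
    rw [hH, Finite.mem_toFinset]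
    change |b (g⁻¹ * α)| ≤ _
    have h1 := hlen0 α hα0
    have h2 := hble α
    rw [abs_of_nonpos hα0] at h1 h2
    rw [abs_le] at hα hg1
    rw [hmul, hinv, abs_le]
    have hR : 0 ≤ R + 1 := by linarith
    constructor <;> linarith
  have hsub : (hD.finite_annulus o n L).toFinset ⊆
      H.image (fun h => g * h) ∪ H.image (fun h => (g * h)⁻¹) := by
    intro α hα
    rw [Finite.mem_toFinset, mem_ofPred_eq] at hα
    rw [Finset.mem_union, Finset.mem_image, Finset.mem_image]
    rcases le_total (b α) 0 with h | h
    · exact Or.inl ⟨_, hmem α hα h, mul_inv_cancel_left g α⟩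
    · refine Or.inr ⟨g⁻¹ * α⁻¹, hmem α⁻¹ ?_ (by rw [hinv]; linarith), by group⟩
      rwa [show (α⁻¹ : Γ).1 = α.1⁻¹ from rfl, len_inv]
  exact (Finset.card_le_card hsub).trans ((Finset.card_union_le _ _).trans
    (add_le_add Finset.card_image_le Finset.card_image_le))

end Fixed

theorem card_annulus_le (hX : IsCATNegOne X) (hD : IsDiscreteGroup Γ) (hC : IsCore Γ C o R)
    (hfin : criticalExponent Γ o ≠ ⊤) (L : ℝ) :
    ∃ c : ℝ, 0 < c ∧ ∀ n : ℝ, 0 ≤ n → ((hD.finite_annulus o n L).toFinset.card : ℝ) ≤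
      c * Real.exp ((criticalExponent Γ o).toReal * n) := by
  by_cases hsp : HasSpreading Γ o
  · obtain ⟨c, hc, h⟩ := card_annulus_le_of_hasSpreading hX hD hfin hsp L
    exact ⟨c, hc, fun n _ => h n⟩
  · obtain ⟨ρ, h0, hnear, hfix⟩ := exists_fixed_ray hX hD hC hsp
    obtain ⟨N, hN⟩ := card_annulus_le_of_fixed hX hD h0 hnear hfix L
    refine ⟨N + 1, by positivity, fun n hn => ?_⟩
    have h1 : ((hD.finite_annulus o n L).toFinset.card : ℝ) ≤ N := Nat.cast_le.2 (hN n hn)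
    have h2 : 1 ≤ Real.exp ((criticalExponent Γ o).toReal * n) :=
      Real.one_le_exp (mul_nonneg ENNReal.toReal_nonneg hn)
    nlinarith [Nat.cast_nonneg (α := ℝ) N]

end UpperCounting

section Translates

variable {X : Type*} [MetricSpace X] {Γ₀ Γ : Subgroup (X ≃ᵢ X)} {C : Set X} {o : X} {R : ℝ}

/-! ### Translates of the core -/

/-- The element `γ` almost realizes the distance between `C` and its translate `γ C`. -/
def IsReduced (C : Set X) (o : X) (A : ℝ) (γ : X ≃ᵢ X) : Prop :=
  ∀ w ∈ C, ∀ y ∈ C, len o γ ≤ dist w (γ y) + A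

theorem setDist_le {A B : Set X} {a b : X} (ha : a ∈ A) (hb : b ∈ B) :
    setDist A B ≤ dist a b :=
  ciInf_le (f := fun p : A × B => dist (p.1 : X) (p.2 : X))
    ⟨0, by rintro _ ⟨p, rfl⟩; exact dist_nonneg⟩ (⟨a, ha⟩, ⟨b, hb⟩)

theorem setDist_image_mul (hC : IsCore Γ₀ C o R) {α β : X ≃ᵢ X} (hα : α ∈ Γ₀) (hβ : β ∈ Γ₀)
    (γ : X ≃ᵢ X) : setDist C ((α * γ * β) '' C) = setDist C (γ '' C) := by
  have key : ∀ (γ : X ≃ᵢ X) {α β : X ≃ᵢ X}, α ∈ Γ₀ → β ∈ Γ₀ →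
      setDist C ((α * γ * β) '' C) ≤ setDist C (γ '' C) := by
    intro γ α β hα hβ
    have : Nonempty (C × (γ '' C)) :=
      ⟨⟨⟨o, hC.base_mem⟩, ⟨γ o, o, hC.base_mem, rfl⟩⟩⟩
    refine le_ciInf ?_
    rintro ⟨⟨w, hw⟩, ⟨_, y, hy, rfl⟩⟩
    have hmem : (α * γ * β) (β⁻¹ y) ∈ (α * γ * β) '' C :=
      ⟨β⁻¹ y, hC.map_mem _ (Γ₀.inv_mem hβ) y hy, rfl⟩
    refine (setDist_le (hC.map_mem α hα w hw) hmem).trans (le_of_eq ?_)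
    change dist (α w) (α (γ (β (β⁻¹ y)))) = _
    rw [α.dist_eq, apply_inv_self]
  refine le_antisymm (key γ hα hβ) ?_
  have := key (α * γ * β) (Γ₀.inv_mem hα) (Γ₀.inv_mem hβ)
  rwa [show α⁻¹ * (α * γ * β) * β⁻¹ = γ by group] at this

/-- The distance is realized up to 1, and each endpoint is then moved to the orbit of o at a cost R.
-/
theorem exists_isReduced (hC : IsCore Γ₀ C o R) (γ : X ≃ᵢ X) :
    ∃ α ∈ Γ₀, ∃ β ∈ Γ₀, IsReduced C o (2 * R + 1) (α * γ * β) ∧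
      setDist C (γ '' C) ≤ len o (α * γ * β) ∧
      len o (α * γ * β) ≤ setDist C (γ '' C) + (2 * R + 1) := by
  have : Nonempty (C × (γ '' C)) :=
    ⟨⟨⟨o, hC.base_mem⟩, ⟨γ o, o, hC.base_mem, rfl⟩⟩⟩
  obtain ⟨⟨⟨w, hw⟩, ⟨_, y, hy, rfl⟩⟩, hlt⟩ := exists_lt_of_ciInf_lt
    (show (⨅ p : C × (γ '' C), dist (p.1 : X) (p.2 : X)) < setDist C (γ '' C) + 1 from
      lt_add_one _)
  change dist w (γ y) < _ at hlt
  obtain ⟨α, hα, hαd⟩ := hC.dense w hw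
  obtain ⟨β, hβ, hβd⟩ := hC.dense y hy
  have hα' := Γ₀.inv_mem hα
  have hle : len o (α⁻¹ * γ * β) ≤ setDist C (γ '' C) + (2 * R + 1) := by
    rw [mul_assoc, ← dist_apply_apply]
    have := dist_triangle4 (α o) w (γ y) (γ (β o))
    rw [γ.dist_eq, dist_comm (α o) w] at this
    change dist (α o) (γ (β o)) ≤ _
    linarith
  have hge : ∀ w ∈ C, ∀ y ∈ C, setDist C (γ '' C) ≤ dist w ((α⁻¹ * γ * β) y) := fun w hw y hy => by
    rw [← setDist_image_mul hC hα' hβ]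
    exact setDist_le hw ⟨y, hy, rfl⟩
  exact ⟨α⁻¹, hα', β, hβ, fun w hw y hy => by linarith [hge w hw y hy],
    hge o hC.base_mem o hC.base_mem, hle⟩

/-- If the segments from γo to o and to γy stayed together longer, leaving γC at their last common
point would give a path to o too short for γ to be reduced. -/
theorem gp_translate_le (hX : IsCATNegOne X) (hC : IsCore Γ₀ C o R) {A : ℝ} {γ : X ≃ᵢ X}
    (hγ : IsReduced C o A γ) {y : X} (hy : y ∈ C) : gp (γ o) o (γ y) ≤ A + 2 * κ := by
  have ht0 := gp_nonneg (γ o) o (γ y)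
  obtain ⟨q, q1, q2, q3⟩ := hX.exists_point (γ o) o ht0 (gp_le_left _ _ _)
  obtain ⟨p, p1, p2, p3⟩ := hX.exists_point o y ht0
    ((gp_le_right _ _ _).trans_eq (γ.dist_eq o y))
  have h1 := hX.fellow_travel (o := γ o) (u := o) (w := γ y) (p := q) (q := γ p) q3
    (by rw [γ.dist_eq, γ.dist_eq, γ.dist_eq, p3]) (by rw [γ.dist_eq, p1, q1]) q1.le
  have h2 := hγ o hC.base_mem p (hC.convex _ hC.base_mem _ hy _ p3)
  have h3 := dist_triangle o q (γ p)
  have h4 : len o γ = dist (γ o) o := dist_comm _ _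
  rw [dist_comm o q] at h3
  linarith

theorem gp_core_le (hX : IsCATNegOne X) (hC : IsCore Γ₀ C o R) {A : ℝ} {γ : X ≃ᵢ X}
    (hγ : IsReduced C o A γ) {w : X} (hw : w ∈ C) : gp o w (γ o) ≤ A + 2 * κ := by
  have ht0 := gp_nonneg o w (γ o)
  obtain ⟨q, q1, q2, q3⟩ := hX.exists_point o (γ o) ht0 (gp_le_right _ _ _)
  obtain ⟨p, p1, p2, p3⟩ := hX.exists_point o w ht0 (gp_le_left _ _ _)
  have h1 := hX.fellow_travel p3 q3 (p1.trans q1.symm) p1.le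
  have h2 := hγ p (hC.convex _ hC.base_mem _ hw _ p3) o hC.base_mem
  have h3 := dist_triangle p q (γ o)
  have h4 : len o γ = dist o (γ o) := rfl
  linarith

theorem len_add_dist_le (hX : IsCATNegOne X) (hC : IsCore Γ₀ C o R) {A : ℝ} {γ : X ≃ᵢ X}
    (hγ : IsReduced C o A γ) {y : X} (hy : y ∈ C) :
    len o γ + dist o y ≤ dist o (γ y) + 2 * (A + 2 * κ) := by
  have h := gp_translate_le hX hC hγ hy
  unfold gp at h
  rw [γ.dist_eq, dist_comm (γ o) o] at h
  unfold len
  linarith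

/-- When γo is far from o, a segment from o to γy follows [o, γo] for a long time, while segments in
C leave it early. Malnormality matters only for the short γ. -/
theorem gp_le_of_long (hX : IsCATNegOne X) (hC : IsCore Γ₀ C o R) {A : ℝ} {γ : X ≃ᵢ X}
    (hγ : IsReduced C o A γ) (hlen : 2 * A + 6 * κ < len o γ) {w y : X} (hw : w ∈ C)
    (hy : y ∈ C) : gp o w (γ y) ≤ A + 4 * κ := by
  have h1 := gp_core_le hX hC hγ hw
  have h2 := gp_translate_le hX hC hγ hy
  have h3 := gp_add o (γ o) (γ y)
  have h4 : len o γ = dist o (γ o) := rfl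
  have := hX.gp_le_of_le h1 (v := γ y) (by rw [gp_comm]; linarith)
  linarith

/-- A point of a side of a triangle is close to a second side if the third one is short. -/
theorem exists_point_near_side (hX : IsCATNegOne X) {x x' v q : X}
    (hq : dist x q + dist q v = dist x v) :
    ∃ r, dist x' r + dist r v = dist x' v ∧ dist q r ≤ 2 * dist x x' + κ := by
  rcases le_total (dist q v) (dist x' v) with h | h
  · obtain ⟨r, r1, r2, r3⟩ := hX.exists_point x' v (t := dist x' v - dist q v) (by linarith)
      (by linarith [(dist_nonneg : 0 ≤ dist q v)])
    refine ⟨r, r3, (hX.dist_le_max r hq).trans (add_le_add (max_le ?_ ?_) le_rfl)⟩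
    · have h1 := dist_triangle x x' r
      have h2 := dist_triangle x' x v
      rw [dist_comm x' x] at h2
      linarith
    · rw [dist_comm v r]
      linarith [(dist_nonneg : 0 ≤ dist x x')]
  · refine ⟨x', by simp, (hX.dist_le_max x' hq).trans (add_le_add (max_le ?_ ?_) le_rfl)⟩
    · linarith [(dist_nonneg : 0 ≤ dist x x'), (dist_nonneg : 0 ≤ dist x q)]
    · rw [dist_comm v x']
      linarith [(dist_nonneg : 0 ≤ dist x x')]

variable [ProperSpace X]

/-- A long common stretch of C and γC yields many pairs with αⱼo near γβⱼo, so the elements αⱼ⁻¹γβⱼ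
lie in the finite set Φ. Those with a common value give elements αⱼα⁻¹ of Γ₀ ∩ γΓ₀γ⁻¹, more than its
m elements. -/
theorem exists_gp_bound (hX : IsCATNegOne X) (hD : IsDiscreteGroup Γ) (hle : Γ₀ ≤ Γ)
    (hmal : IsAlmostMalnormal Γ₀ Γ) (hC : IsCore Γ₀ C o R) {γ : X ≃ᵢ X} (hγ : γ ∈ Γ)
    (hγ₀ : γ ∉ Γ₀) : ∃ B, ∀ w ∈ C, ∀ y ∈ C, gp o w (γ y) ≤ B := by
  classical
  have hF := hmal γ hγ hγ₀
  set m := hF.toFinset.card with hm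
  set Φ := (hD.finite_ball o (2 * R + 3 * κ + 2 * len o γ)).toFinset with hΦ
  set n := Φ.card * m + 1 with hn
  -- The sampling points are spaced by more than 2R, so no element α of Γ₀ serves two of them.
  refine ⟨n * (2 * R + 1), fun w hw y hy => ?_⟩
  by_contra! hlt
  have hR := hC.nonneg
  have hj : ∀ j : ℕ, ∃ p : X, ∃ α ∈ Γ₀, ∃ β ∈ Γ₀, j < n →
      (dist o p = j * (2 * R + 1) ∧ dist o p + dist p w = dist o w) ∧ dist p (α o) ≤ R ∧
      dist (α o) (γ (β o)) ≤ 2 * R + 3 * κ + 2 * len o γ := by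
    intro j
    by_cases hjn : j < n
    · have hj0 : (0 : ℝ) ≤ j * (2 * R + 1) := by positivity
      have hj1 : (j : ℝ) * (2 * R + 1) ≤ gp o w (γ y) := by
        have : (j : ℝ) ≤ n := Nat.cast_le.2 hjn.le
        refine le_trans ?_ hlt.le
        gcongr
      obtain ⟨p, p1, p2, p3⟩ := hX.exists_point o w hj0 (hj1.trans (gp_le_left _ _ _))
      obtain ⟨q, q1, q2, q3⟩ := hX.exists_point o (γ y) hj0 (hj1.trans (gp_le_right _ _ _))
      have h1 := hX.fellow_travel p3 q3 (p1.trans q1.symm) (p1.trans_le hj1)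
      obtain ⟨r, r1, r2⟩ := exists_point_near_side hX (x' := γ o) q3
      obtain ⟨r, rfl⟩ := γ.surjective r
      rw [γ.dist_eq, γ.dist_eq, γ.dist_eq] at r1
      obtain ⟨α, hα, hαd⟩ := hC.dense p (hC.convex _ hC.base_mem _ hw _ p3)
      obtain ⟨β, hβ, hβd⟩ := hC.dense r (hC.convex _ hC.base_mem _ hy _ r1)
      refine ⟨p, α, hα, β, hβ, fun _ => ⟨⟨p1, p3⟩, hαd, ?_⟩⟩
      have h2 := dist_triangle4 (α o) p q (γ r)
      have h3 := dist_triangle (α o) (γ r) (γ (β o))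
      rw [γ.dist_eq] at h3
      rw [dist_comm (α o) p] at h2
      have h4 : len o γ = dist o (γ o) := rfl
      linarith
    · exact ⟨o, 1, Γ₀.one_mem, 1, Γ₀.one_mem, fun h => absurd h hjn⟩
  choose p α hα β hβ hp using hj
  have hmaps : ∀ j ∈ Finset.range n, (⟨(α j)⁻¹ * γ * β j,
      Γ.mul_mem (Γ.mul_mem (Γ.inv_mem (hle (hα j))) hγ) (hle (hβ j))⟩ : Γ) ∈ Φ := by
    intro j hj
    rw [hΦ, Finite.mem_toFinset, mem_ofPred_eq]
    change len o ((α j)⁻¹ * γ * β j) ≤ _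
    rw [mul_assoc, ← dist_apply_apply]
    exact (hp j (Finset.mem_range.1 hj)).2.2
  obtain ⟨g, -, hg⟩ := Finset.exists_lt_card_fiber_of_mul_lt_card_of_maps_to hmaps
    (n := m) (by rw [Finset.card_range]; omega)
  set S := {j ∈ Finset.range n | (⟨(α j)⁻¹ * γ * β j,
      Γ.mul_mem (Γ.mul_mem (Γ.inv_mem (hle (hα j))) hγ) (hle (hβ j))⟩ : Γ) = g} with hS
  have hSmem : ∀ j ∈ S, j < n ∧ (α j)⁻¹ * γ * β j = g.1 := by
    intro j hj
    rw [hS, Finset.mem_filter, Finset.mem_range] at hj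
    exact ⟨hj.1, congrArg Subtype.val hj.2⟩
  obtain ⟨j₀, hj₀⟩ : S.Nonempty := Finset.card_pos.1 (by omega)
  refine absurd hg (not_lt.2 ?_)
  refine Finset.card_le_card_of_injOn (fun j => α j * (α j₀)⁻¹) (fun j hj => ?_)
    (fun i hi j hj h => ?_)
  · rw [Finset.mem_coe, Finite.mem_toFinset]
    refine ⟨Γ₀.mul_mem (hα j) (Γ₀.inv_mem (hα j₀)), ?_⟩
    have e : γ⁻¹ * (α j * (α j₀)⁻¹) * γ = β j * (β j₀)⁻¹ := by
      have h1 : α j = γ * β j * g.1⁻¹ := by rw [← (hSmem j hj).2]; group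
      have h2 : α j₀ = γ * β j₀ * g.1⁻¹ := by rw [← (hSmem j₀ hj₀).2]; group
      rw [h1, h2]; group
    rw [e]
    exact Γ₀.mul_mem (hβ j) (Γ₀.inv_mem (hβ j₀))
  · have hij : α i = α j := mul_right_cancel h
    have hi' := hp i (hSmem i hi).1
    have hj' := hp j (hSmem j hj).1
    rw [hij] at hi'
    have key : ∀ a b : ℕ, dist o (p a) = a * (2 * R + 1) → dist o (p b) = b * (2 * R + 1) →
        dist (p a) (α j o) ≤ R → dist (p b) (α j o) ≤ R → a ≤ b := by
      intro a b ha hb ha' hb'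
      by_contra! hab
      have h1 := dist_triangle4 o (p b) (α j o) (p a)
      rw [dist_comm (α j o) (p a), ha, hb] at h1
      have h2 : (b : ℝ) + 1 ≤ a := by exact_mod_cast hab
      nlinarith
    exact le_antisymm (key i j hi'.1.1 hj'.1.1 hi'.2.1 hj'.2.1)
      (key j i hj'.1.1 hi'.1.1 hj'.2.1 hi'.2.1)

/-- The core and its translates diverge uniformly. -/
theorem exists_uniform_gp_bound (hX : IsCATNegOne X) (hD : IsDiscreteGroup Γ) (hle : Γ₀ ≤ Γ)
    (hmal : IsAlmostMalnormal Γ₀ Γ) (hC : IsCore Γ₀ C o R) (A : ℝ) :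
    ∃ B, 0 ≤ B ∧ ∀ γ ∈ Γ, γ ∉ Γ₀ → IsReduced C o A γ → ∀ w ∈ C, ∀ y ∈ C, gp o w (γ y) ≤ B := by
  classical
  have h : ∀ γ : Γ, ∃ B, γ.1 ∉ Γ₀ → ∀ w ∈ C, ∀ y ∈ C, gp o w (γ.1 y) ≤ B := by
    intro γ
    by_cases hγ : γ.1 ∈ Γ₀
    · exact ⟨0, fun h => absurd hγ h⟩
    · obtain ⟨B, hB⟩ := exists_gp_bound hX hD hle hmal hC γ.2 hγ
      exact ⟨B, fun _ => hB⟩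
  choose B hB using h
  -- Only finitely many elements are too short for `gp_le_of_long`; their individual bounds have a
  -- maximum.
  obtain ⟨M, hM⟩ := ((hD.finite_ball o (2 * A + 6 * κ)).image B).bddAbove
  refine ⟨max 0 (max M (A + 4 * κ)), le_max_left _ _, fun γ hγ hγ₀ hred w hw y hy => ?_⟩
  refine le_trans ?_ (le_max_right _ _)
  rcases le_or_gt (len o γ) (2 * A + 6 * κ) with hs | hl
  · exact (hB ⟨γ, hγ⟩ hγ₀ w hw y hy).trans ((hM ⟨⟨γ, hγ⟩, hs, rfl⟩).trans (le_max_left _ _))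
  · exact (gp_le_of_long hX hC hred hl hw hy).trans (le_max_right _ _)

theorem exists_near_translate (hX : IsCATNegOne X) (hC : IsCore Γ₀ C o R) {γ : X ≃ᵢ X}
    {ρ : GeodesicRay X} {ζ : Boundary X} (hζ : ζ ∈ limitSet Γ₀) (hρ : ρ.endpoint = γ • ζ) :
    ∃ M, ∀ t : ℝ≥0, ∃ y ∈ C, dist (ρ.1 t) (γ y) ≤ M := by
  have h : (ρ.map γ⁻¹).endpoint = ζ := by
    rw [← smul_endpoint, hρ, inv_smul_smul]
  obtain ⟨M, hM⟩ := exists_near_bound hX hC (h.symm ▸ hζ)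
  refine ⟨M, fun t => ?_⟩
  obtain ⟨y, hy, hyd⟩ := hM t
  refine ⟨y, hy, ?_⟩
  change dist (γ⁻¹ (ρ.1 t)) y ≤ M at hyd
  rwa [← γ.dist_eq, apply_inv_self] at hyd

/-- Points at infinity of a translate project close to the base point. -/
theorem bgp_translate_le (hX : IsCATNegOne X) (hC : IsCore Γ₀ C o R) {γ : X ≃ᵢ X} {B : ℝ}
    (hB : ∀ w ∈ C, ∀ y ∈ C, gp o w (γ y) ≤ B) {ζ : Boundary X} (hζ : ζ ∈ limitSet Γ₀) {w : X}
    (hw : w ∈ C) : bgp (γ • ζ) o w ≤ B + 2 * κ := by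
  by_contra! hlt
  obtain ⟨ρ, hρ, h0⟩ := exists_ray hX o (γ • ζ)
  obtain ⟨M, hM⟩ := exists_near_translate hX hC hζ hρ
  obtain ⟨t, ht1, ht2⟩ := (((tendsto_bgp hX hρ o w).eventually (lt_mem_nhds hlt)).and
    (tendsto_dist_ray ρ o |>.eventually_ge_atTop (B + 2 * κ + M + 1))).exists
  obtain ⟨y, hy, hyd⟩ := hM t
  have h1 : B + 2 * κ < gp o (ρ.1 t) (γ y) := by
    have := gp_le_add_dist o (ρ.1 t) (ρ.1 t) (γ y)
    have e : gp o (ρ.1 t) (ρ.1 t) = dist o (ρ.1 t) := by unfold gp; rw [dist_self]; ring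
    linarith
  have h2 := hX.gp_min o w (ρ.1 t) (γ y)
  have h3 := lt_min ht1 h1
  have h4 := hB w hw y hy
  linarith

theorem exists_bgp_gt_of_mem_limitSet (hX : IsCATNegOne X) (hC : IsCore Γ₀ C o R)
    {ξ : Boundary X} (hξ : ξ ∈ limitSet Γ₀) (B : ℝ) : ∃ α ∈ Γ₀, B < bgp ξ o (α o) := by
  obtain ⟨ρ, hρ, h0⟩ := exists_ray hX o ξ
  set t : ℝ≥0 := (B + 3 * κ + R + 1).toNNReal
  have ht : B + 3 * κ + R + 1 ≤ t := Real.le_coe_toNNReal _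
  obtain ⟨y, hy, hyd⟩ := exists_near_of_mem_limitSet hX hC (ρ := ρ) (by rw [h0]; exact hC.base_mem)
    (hρ.symm ▸ hξ) t
  obtain ⟨α, hα, hαd⟩ := hC.dense y hy
  refine ⟨α, hα, ?_⟩
  have h1 : bgp ξ o (ρ.1 t) = t := by
    unfold bgp
    rw [← hρ, busemann_endpoint hX, rayBus_apply, ← h0, rayBus_apply, ray_dist_zero]
    simp
  have h2 := bgp_le_add_dist hX ξ o (ρ.1 t) (α o)
  have h3 := dist_triangle (ρ.1 t) y (α o)
  linarith

/-- Gromov products with orbit points of Γ₀ are unbounded for a point of ΛΓ₀ and bounded for a point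
of γΛΓ₀. -/
theorem smul_limitSet_disjoint (hX : IsCATNegOne X) (hD : IsDiscreteGroup Γ) (hle : Γ₀ ≤ Γ)
    (hmal : IsAlmostMalnormal Γ₀ Γ) (hC : IsCore Γ₀ C o R) {γ : X ≃ᵢ X} (hγ : γ ∈ Γ)
    (hγ₀ : γ ∉ Γ₀) {ζ : Boundary X} (hζ : ζ ∈ limitSet Γ₀) : γ • ζ ∉ limitSet Γ₀ := by
  intro h
  obtain ⟨B, hB⟩ := exists_gp_bound hX hD hle hmal hC hγ hγ₀
  obtain ⟨α, hα, hlt⟩ := exists_bgp_gt_of_mem_limitSet hX hC h (B + 2 * κ)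
  exact absurd (bgp_translate_le hX hC hB hζ (hC.map_mem α hα o hC.base_mem)) (not_le.2 hlt)

end Translates

section Shadows

variable {X : Type*} [MetricSpace X] {Γ₀ : Subgroup (X ≃ᵢ X)} {C : Set X} {o : X} {R : ℝ}

/-! ### Points at infinity projecting near the base point -/

/-- The points at infinity whose closest point on the core is close to `o`. -/
def nearSet (Γ₀ : Subgroup (X ≃ᵢ X)) (o : X) (K : ℝ) : Set (Boundary X) :=
  {ξ | ∀ α : Γ₀, bgp ξ o (α.1 o) ≤ K}

theorem continuous_bgp (hX : IsCATNegOne X) (o w : X) :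
    Continuous fun ξ : Boundary X => bgp ξ o w :=
  ((continuous_busemann hX o w).const_add _).div_const 2

theorem isClosed_nearSet (hX : IsCATNegOne X) (Γ₀ : Subgroup (X ≃ᵢ X)) (o : X) (K : ℝ) :
    IsClosed (nearSet Γ₀ o K) := by
  rw [nearSet, ofPred_forall]
  exact isClosed_iInter fun α => isClosed_le (continuous_bgp hX o _) continuous_const

theorem dist_closest_le (hX : IsCATNegOne X) (hC : IsCore Γ₀ C o R) {B : ℝ} {ξ : Boundary X}
    (hξ : ∀ w ∈ C, bgp ξ o w ≤ B) {p : X} (hp : IsClosestPoint C ξ p) : dist o p ≤ B + κ := by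
  rw [← bgp_add hX ξ o p]
  exact add_le_add (hξ p hp.1) (bgp_closest_le hX hC.convex hp hC.base_mem)

theorem bgp_base_le (hX : IsCATNegOne X) (ξ : Boundary X) (o o' w : X) :
    bgp ξ o' w ≤ bgp ξ o w + dist o o' := by
  have h1 := busemann_add hX ξ o' o w
  have h2 := busemann_le_dist hX ξ o' o
  have h3 := dist_triangle o' o w
  rw [dist_comm o' o] at h2 h3
  unfold bgp; linarith

/-- Both orbit points are close to the projection of ξ; the two Gromov products add up to their
distance. With discreteness this bounds the overlap of the translates of `nearSet`. -/
theorem dist_le_of_mem_nearSet (hX : IsCATNegOne X) {K : ℝ} {ξ : Boundary X} {α β : Γ₀}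
    (hα : α.1⁻¹ • ξ ∈ nearSet Γ₀ o K) (hβ : β.1⁻¹ • ξ ∈ nearSet Γ₀ o K) :
    dist (α.1 o) (β.1 o) ≤ 2 * K := by
  have key : ∀ {α β : Γ₀}, α.1⁻¹ • ξ ∈ nearSet Γ₀ o K → bgp ξ (α.1 o) (β.1 o) ≤ K := by
    intro α β hα
    have h := hα (α⁻¹ * β)
    rw [← bgp_smul hX α.1, smul_inv_smul] at h
    change bgp ξ (α.1 o) (α.1 (α.1⁻¹ (β.1 o))) ≤ K at h
    rwa [apply_inv_self] at h
  rw [← bgp_add hX ξ]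
  linarith [key (β := β) hα, key (β := α) hβ]

/-- A point deep in a shadow cast by γC cannot also lie deep in one cast by C, since the two sets
diverge from o. So it projects to C near o. -/
theorem le_bgp_of_between (hX : IsCATNegOne X) {γ : X ≃ᵢ X} {B : ℝ}
    (hB : ∀ w ∈ C, ∀ y ∈ C, gp o w (γ y) ≤ B) {ξ : Boundary X} {y : X} (hy : y ∈ C)
    (hξ : B + 2 * κ < bgp ξ o (γ y)) {w : X} (hw : w ∈ C) : bgp ξ o w ≤ B + 2 * κ := by
  by_contra! hlt
  have h1 := lt_min hlt hξ
  have h2 := bgp_min_right hX ξ o w (γ y)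
  have h3 := hB w hw y hy
  linarith

/-- If the two feet were farther apart, a segment from ρ(t) to σ(t) would pass near both of them,
and its length would exceed 2t. -/
theorem dist_closest_closest_le (hX : IsCATNegOne X) (hC : IsGeodConvex C) {ξ η : Boundary X}
    {ρ σ : GeodesicRay X} (hρ : ρ.endpoint = ξ) (hσ : σ.endpoint = η)
    (hρC : IsClosestPoint C ξ (ρ.1 0)) (hσC : IsClosestPoint C η (σ.1 0)) {t : ℝ≥0}
    (ht : dist (ρ.1 t) (σ.1 t) ≤ 2 * t) : dist (ρ.1 0) (σ.1 0) ≤ 8 * κ := by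
  have key : ∀ {ξ : Boundary X} {ρ : GeodesicRay X}, ρ.endpoint = ξ →
      IsClosestPoint C ξ (ρ.1 0) → ∀ w ∈ C, t + dist (ρ.1 0) w - 2 * κ ≤ dist w (ρ.1 t) := by
    intro ξ ρ hρ hρC w hw
    have h1 := bgp_closest_le hX hC hρC hw
    unfold bgp at h1
    rw [← hρ, busemann_endpoint hX, rayBus_apply, NNReal.coe_zero] at h1
    have h2 := rayBus_le ρ w t
    linarith
  have h1 := key hρ hρC _ hσC.1
  have h2 := key hσ hσC _ hρC.1
  by_contra! hlt
  have hk := κ_pos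
  rw [dist_comm (σ.1 0) (ρ.1 0)] at h2
  have e0 := ray_dist_zero σ t
  have g1 : gp (σ.1 0) (ρ.1 0) (σ.1 t) ≤ κ := by
    unfold gp; rw [e0, dist_comm (σ.1 0) (ρ.1 0)]; linarith
  have g2 : dist (ρ.1 0) (σ.1 0) - κ ≤ gp (σ.1 0) (ρ.1 0) (ρ.1 t) := by
    unfold gp; rw [ray_dist_zero, dist_comm (σ.1 0) (ρ.1 0)]; linarith
  have g3 := hX.gp_min (σ.1 0) (ρ.1 0) (ρ.1 t) (σ.1 t)
  have g4 : gp (σ.1 0) (ρ.1 t) (σ.1 t) ≤ 3 * κ := by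
    by_contra! hc
    have : 3 * κ < min (gp (σ.1 0) (ρ.1 0) (ρ.1 t)) (gp (σ.1 0) (ρ.1 t) (σ.1 t)) :=
      lt_min (by linarith) hc
    linarith
  unfold gp at g4
  rw [e0] at g4
  linarith

/-! ### The distance-like map `d_C` -/

/-- The exponent is nonincreasing in t by the triangle inequality, so the limit in the definition
exists. -/
theorem tendsto_convDist (C : Set X) (ξ η : Boundary X) :
    Tendsto (fun t : ℝ≥0 => Real.exp (dist ((perpRay C ξ).1 t) ((perpRay C η).1 t) / 2 - t))
      atTop (𝓝 (convDist C ξ η)) := by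
  have hanti : Antitone fun t : ℝ≥0 =>
      Real.exp (dist ((perpRay C ξ).1 t) ((perpRay C η).1 t) / 2 - t) := by
    intro s t hst
    refine Real.exp_le_exp.2 ?_
    have h1 := dist_triangle4 ((perpRay C ξ).1 t) ((perpRay C ξ).1 s) ((perpRay C η).1 s)
      ((perpRay C η).1 t)
    rw [dist_comm _ ((perpRay C ξ).1 s), ray_dist_of_le _ hst, ray_dist_of_le _ hst] at h1
    linarith
  have hbdd : BddBelow (range fun t : ℝ≥0 =>
      Real.exp (dist ((perpRay C ξ).1 t) ((perpRay C η).1 t) / 2 - t)) :=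
    ⟨0, by rintro _ ⟨t, rfl⟩; exact (Real.exp_pos _).le⟩
  have h := tendsto_atTop_ciInf hanti hbdd
  rw [convDist, h.limUnder_eq]
  exact h

theorem convDist_nonneg (C : Set X) (ξ η : Boundary X) : 0 ≤ convDist C ξ η :=
  ge_of_tendsto' (tendsto_convDist C ξ η) fun _ => (Real.exp_pos _).le

variable [ProperSpace X]

theorem nearSet_disjoint (hX : IsCATNegOne X) (hC : IsCore Γ₀ C o R) {K : ℝ} {ξ : Boundary X}
    (hξ : ξ ∈ nearSet Γ₀ o K) : ξ ∉ limitSet Γ₀ := by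
  intro h
  obtain ⟨α, hα, hlt⟩ := exists_bgp_gt_of_mem_limitSet hX hC h K
  exact absurd (hξ ⟨α, hα⟩) (not_le.2 hlt)

theorem exists_smul_mem_nearSet (hX : IsCATNegOne X) (hC : IsCore Γ₀ C o R) {ξ : Boundary X}
    (hξ : ξ ∉ limitSet Γ₀) : ∃ α : Γ₀, α.1⁻¹ • ξ ∈ nearSet Γ₀ o (κ + R) := by
  obtain ⟨p, hp⟩ := exists_isClosestPoint hX hC hξ
  obtain ⟨α, hα, hd⟩ := hC.dense p hp.1
  refine ⟨⟨α, hα⟩, fun β => ?_⟩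
  change bgp (α⁻¹ • ξ) o (β.1 o) ≤ κ + R
  rw [← bgp_smul hX α, smul_inv_smul]
  have h1 := bgp_base_le hX ξ p (α o) (α (β.1 o))
  have h2 := bgp_closest_le hX hC.convex hp (hC.map_mem α hα _ (hC.map_mem β.1 β.2 _ hC.base_mem))
  linarith

/-- Two points at infinity in the shadow of `y` are close for `d_C`. -/
theorem convDist_le_of_bgp (hX : IsCATNegOne X) (hC : IsCore Γ₀ C o R) {B K : ℝ}
    {ξ η : Boundary X} (hξ : ξ ∉ limitSet Γ₀) (hη : η ∉ limitSet Γ₀)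
    (hξB : ∀ w ∈ C, bgp ξ o w ≤ B) (hηB : ∀ w ∈ C, bgp η o w ≤ B) {y : X}
    (hξy : dist o y - K ≤ bgp ξ o y) (hηy : dist o y - K ≤ bgp η o y) :
    convDist C ξ η ≤ Real.exp (B + 3 * κ + K + 1) * Real.exp (-dist o y) := by
  obtain ⟨h1, h2⟩ := perpRay_spec hX hC hξ
  obtain ⟨h3, h4⟩ := perpRay_spec hX hC hη
  have h5 := dist_closest_le hX hC hξB h2
  have h6 := dist_closest_le hX hC hηB h4
  rw [← Real.exp_add]
  refine le_of_tendsto (tendsto_convDist C ξ η) ?_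
  filter_upwards [(tendsto_bgp hX h1 o y).eventually
      (lt_mem_nhds (show dist o y - K - 1 < bgp ξ o y by linarith)),
    (tendsto_bgp hX h3 o y).eventually
      (lt_mem_nhds (show dist o y - K - 1 < bgp η o y by linarith))] with s e1 e2
  refine Real.exp_le_exp.2 ?_
  rw [gp_comm] at e1
  have e3 := hX.le_gp_of_le e1.le e2.le
  have e4 := dist_ray_le (perpRay C ξ) o s
  have e5 := dist_ray_le (perpRay C η) o s
  unfold gp at e3
  linarith

/-- Two points at infinity both seen in the direction of arbitrarily far points w have asymptotic
rays. This later supplies, for any direction, a limit point away from it. -/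
theorem exists_pair_bgp_le (hX : IsCATNegOne X) (o : X) {ξ₁ ξ₂ : Boundary X}
    (hne : ξ₁ ≠ ξ₂) : ∃ A, ∀ w, bgp ξ₁ o w ≤ A ∨ bgp ξ₂ o w ≤ A := by
  by_contra! h
  obtain ⟨ρ₁, h1, h1'⟩ := exists_ray hX o ξ₁
  obtain ⟨ρ₂, h2, h2'⟩ := exists_ray hX o ξ₂
  refine hne ?_
  rw [← h1, ← h2, endpoint_eq_iff]
  refine ⟨4 * κ, fun t => ?_⟩
  obtain ⟨w, hw1, hw2⟩ := h t
  obtain ⟨p, p1, p2, p3⟩ := hX.exists_point o w t.2 (hw1.le.trans (bgp_le_dist hX ξ₁ o w))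
  have e1 := dist_ray_le_of_lt_bgp hX h1 h1' hw1 p3 p1
  have e2 := dist_ray_le_of_lt_bgp hX h2 h2' hw2 p3 p1
  have e3 := dist_triangle (ρ₁.1 t) p (ρ₂.1 t)
  rw [dist_comm (ρ₁.1 t) p] at e3
  linarith

/-- A point at infinity that is close, for `d_C`, to the points at infinity of the translate
`γ C` lies in the shadow of an orbit point of `γ C`. -/
theorem exists_mem_shadow (hX : IsCATNegOne X) (hC : IsCore Γ₀ C o R) {γ : X ≃ᵢ X} {A B : ℝ}
    (hγ : IsReduced C o A γ) (hB : ∀ w ∈ C, ∀ y ∈ C, gp o w (γ y) ≤ B)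
    {ξ ζ : Boundary X} (hζ : ζ ∈ limitSet Γ₀) {ρ σ : GeodesicRay X} (hρ : ρ.endpoint = ξ)
    (hσ : σ.endpoint = γ • ζ) (hρC : IsClosestPoint C ξ (ρ.1 0))
    (hσC : IsClosestPoint C (γ • ζ) (σ.1 0)) {T : ℝ} (hT : len o γ ≤ T) {t : ℝ≥0}
    (ht : dist (ρ.1 t) (σ.1 t) ≤ 2 * t - 2 * T) :
    ∃ α : Γ₀, |len o α.1 - (T - len o γ)| ≤ R ∧
      T - (2 * (A + 2 * κ) + B + 15 * κ + R) ≤ bgp ξ o (γ (α.1 o)) := by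
  have hk := κ_pos
  have hT0 : 0 ≤ T := (len_nonneg o γ).trans hT
  have d1 := dist_closest_le hX hC (fun w hw => bgp_translate_le hX hC hB hζ hw) hσC
  have d2 := dist_closest_closest_le hX hC.convex hρ hσ hρC hσC (t := t) (by linarith)
  have d3 := dist_triangle o (σ.1 0) (ρ.1 0)
  rw [dist_comm (σ.1 0) (ρ.1 0)] at d3
  have hA0 : 0 ≤ A + 2 * κ :=
    (gp_nonneg _ _ _).trans (gp_core_le hX hC hγ hC.base_mem)
  have hB0 : 0 ≤ B := (gp_nonneg _ _ _).trans (hB o hC.base_mem o hC.base_mem)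
  obtain ⟨M, hM⟩ := exists_near_translate hX hC hζ hσ
  -- With γy near a far point of σ, take z on [o, y] so that γz is at distance about T from o. The
  -- directions of γz, γy, σ(s₁) and ρ(s) then agree pairwise up to time about T.
  have hkey : ∃ z ∈ C, dist o z = T - len o γ ∧
      T - (2 * (A + 2 * κ) + B + 15 * κ) ≤ bgp ξ o (γ z) := by
    obtain ⟨s₁, hs₁, hs₁t⟩ := (((tendsto_dist_ray σ o).eventually_ge_atTop (T + M)).and
      (eventually_ge_atTop t)).exists
    obtain ⟨y, hy, hyd⟩ := hM s₁
    have a1 := dist_triangle o (γ y) (σ.1 s₁)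
    have a2 := dist_triangle o (γ o) (γ y)
    rw [γ.dist_eq] at a2
    rw [dist_comm (γ y)] at a1
    have a3 : len o γ = dist o (γ o) := rfl
    obtain ⟨z, z1, z2, z3⟩ := hX.exists_point o y (t := T - len o γ) (by linarith) (by linarith)
    have hz := hC.convex _ hC.base_mem _ hy _ z3
    refine ⟨z, hz, z1, ?_⟩
    have b1 := len_add_dist_le hX hC hγ hz
    have b2 := len_add_dist_le hX hC hγ hy
    have c1 : T - (2 * (A + 2 * κ) + B + 11 * κ) ≤ gp o (γ z) (γ y) := by
      unfold gp; rw [γ.dist_eq]; linarith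
    have c2 : T - (2 * (A + 2 * κ) + B + 11 * κ) ≤ gp o (γ y) (σ.1 s₁) := by
      unfold gp; rw [dist_comm (γ y)]; linarith
    have c3 := hX.le_gp_of_le c1 c2
    refine ge_of_tendsto (tendsto_bgp hX hρ o (γ z)) ?_
    filter_upwards [eventually_ge_atTop s₁] with s hs
    have f1 := dist_triangle4 (σ.1 s₁) (σ.1 t) (ρ.1 t) (ρ.1 s)
    rw [dist_comm (σ.1 s₁) (σ.1 t), ray_dist_of_le σ hs₁t, ray_dist_of_le ρ (hs₁t.trans hs),
      dist_comm (σ.1 t)] at f1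
    have f2 := sub_le_dist_ray σ o s₁
    have f3 := sub_le_dist_ray ρ o s
    have c4 : T - (2 * (A + 2 * κ) + B + 11 * κ) - 2 * κ ≤ gp o (σ.1 s₁) (ρ.1 s) := by
      unfold gp; linarith
    have := hX.le_gp_of_le c3 c4
    linarith
  obtain ⟨z, hz, hzd, hzb⟩ := hkey
  obtain ⟨α, hα, hαd⟩ := hC.dense z hz
  have e1 := dist_triangle o z (α o)
  have e2 := dist_triangle o (α o) z
  rw [dist_comm (α o) z] at e2
  have e3 : len o α = dist o (α o) := rfl
  have e6 := bgp_le_add_dist hX ξ o (γ z) (γ (α o))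
  rw [γ.dist_eq] at e6
  refine ⟨⟨α, hα⟩, ?_, ?_⟩
  · change |len o α - _| ≤ R
    rw [abs_le]; constructor <;> linarith
  · change _ ≤ bgp ξ o (γ (α o))
    linarith

end Shadows

section Densities

variable {X : Type*} [MetricSpace X] {Γ₀ Γ : Subgroup (X ≃ᵢ X)} {C : Set X} {o : X} {R δ : ℝ}
  {μ : X → Measure (Boundary X)}

/-! ### Conformal densities -/

theorem measurable_smul_boundary (g : X ≃ᵢ X) : Measurable fun ξ : Boundary X => g • ξ :=
  (continuous_smul_boundary g).measurable

theorem IsConformalDensity.measure_smul (hμ : IsConformalDensity Γ δ μ) {γ : X ≃ᵢ X}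
    (hγ : γ ∈ Γ) (x : X) {E : Set (Boundary X)} (hE : MeasurableSet E) :
    μ (γ x) E = μ x {ξ | γ • ξ ∈ E} := by
  rw [← hμ.equivariant γ hγ x, Measure.map_apply (measurable_smul_boundary γ) hE]
  rfl

theorem IsConformalDensity.measure_univ (hμ : IsConformalDensity Γ δ μ) {γ : X ≃ᵢ X}
    (hγ : γ ∈ Γ) (x : X) : μ (γ x) univ = μ x univ := by
  rw [hμ.measure_smul hγ x MeasurableSet.univ]; rfl

theorem IsConformalDensity.measure_le (hμ : IsConformalDensity Γ δ μ) (hδ : 0 ≤ δ) {x y : X}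
    {E : Set (Boundary X)} (hE : MeasurableSet E) {b : ℝ} (hb : ∀ ξ ∈ E, b ≤ busemann ξ x y) :
    μ x E ≤ ENNReal.ofReal (Real.exp (-δ * b)) * μ y E := by
  rw [hμ.conformal x y, withDensity_apply _ hE, ← setLIntegral_const]
  refine setLIntegral_mono measurable_const fun ξ hξ => ENNReal.ofReal_le_ofReal
    (Real.exp_le_exp.2 ?_)
  have := hb ξ hξ
  nlinarith

theorem IsConformalDensity.le_measure (hX : IsCATNegOne X) (hμ : IsConformalDensity Γ δ μ)
    (hδ : 0 ≤ δ) {x y : X} {E : Set (Boundary X)} (hE : MeasurableSet E) {b : ℝ}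
    (hb : ∀ ξ ∈ E, busemann ξ x y ≤ b) :
    ENNReal.ofReal (Real.exp (-δ * b)) * μ y E ≤ μ x E := by
  rw [hμ.conformal x y, withDensity_apply _ hE, ← setLIntegral_const]
  refine setLIntegral_mono (ENNReal.measurable_ofReal.comp (Real.measurable_exp.comp
    ((continuous_busemann hX x y).measurable.const_mul _))) fun ξ hξ =>
    ENNReal.ofReal_le_ofReal (Real.exp_le_exp.2 ?_)
  have := hb ξ hξ
  nlinarith

theorem IsConformalDensity.le_measure_translate (hX : IsCATNegOne X)
    (hμ : IsConformalDensity Γ δ μ) (hδ : 0 ≤ δ) {g : X ≃ᵢ X} (hg : g ∈ Γ)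
    {E : Set (Boundary X)} (hE : MeasurableSet E) :
    ENNReal.ofReal (Real.exp (-δ * len o g)) * μ o E ≤ μ o {ξ | g⁻¹ • ξ ∈ E} := by
  rw [← hμ.measure_smul (Γ.inv_mem hg) o hE]
  refine hμ.le_measure hX hδ hE fun ξ _ => (busemann_le_dist hX ξ _ _).trans_eq ?_
  rw [dist_comm]
  exact len_inv o g

theorem tsum_ite_le_of_card {ι : Type*} {P : ι → Prop} [DecidablePred P] {N : ℕ}
    (h : ∀ F : Finset ι, (∀ i ∈ F, P i) → F.card ≤ N) :
    ∑' i, (if P i then (1 : ℝ≥0∞) else 0) ≤ N := by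
  rw [ENNReal.tsum_eq_iSup_sum]
  refine iSup_le fun F => ?_
  rw [← Finset.sum_filter, Finset.sum_const, nsmul_eq_mul, mul_one]
  exact Nat.cast_le.2 (h _ fun i hi => (Finset.mem_filter.1 hi).2)

/-- The sum of the measures of sets with bounded multiplicity. -/
theorem tsum_measure_le_of_card {Y ι : Type*} [MeasurableSpace Y] [Countable ι]
    (ν : Measure Y) {E : ι → Set Y} (hE : ∀ i, MeasurableSet (E i)) {V : Set Y}
    (hsub : ∀ i, E i ⊆ V) {N : ℕ}
    (h : ∀ y, ∀ F : Finset ι, (∀ i ∈ F, y ∈ E i) → F.card ≤ N) :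
    ∑' i, ν (E i) ≤ N * ν V := by
  classical
  calc ∑' i, ν (E i) = ∑' i, ∫⁻ y in V, (E i).indicator 1 y ∂ν := by
        refine tsum_congr fun i => ?_
        rw [lintegral_indicator_one (hE i), Measure.restrict_apply (hE i),
          inter_eq_left.2 (hsub i)]
    _ = ∫⁻ y in V, ∑' i, (E i).indicator 1 y ∂ν :=
        (lintegral_tsum fun i => (measurable_one.indicator (hE i)).aemeasurable).symm
    _ ≤ ∫⁻ _ in V, N ∂ν := by
        refine lintegral_mono fun y => ?_
        simp only [indicator_apply, Pi.one_apply]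
        exact tsum_ite_le_of_card (h y)
    _ = N * ν V := setLIntegral_const _ _

theorem measurableSet_nearSet (hX : IsCATNegOne X) (Γ₀ : Subgroup (X ≃ᵢ X)) (o : X) (K : ℝ) :
    MeasurableSet (nearSet Γ₀ o K) := (isClosed_nearSet hX Γ₀ o K).measurableSet

theorem continuous_smul_regularSet (α : Γ₀) : Continuous fun ξ : RegularSet Γ₀ => α • ξ :=
  Continuous.subtype_mk ((continuous_smul_boundary α.1).comp continuous_subtype_val) _

theorem isOpen_image_quotMk {W : Set (RegularSet Γ₀)} (hW : IsOpen W) :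
    IsOpen (quotMk Γ₀ '' W) := by
  have h : quotMk Γ₀ ⁻¹' (quotMk Γ₀ '' W) = ⋃ α : Γ₀, (fun ξ => α • ξ) ⁻¹' W := by
    ext ξ
    rw [mem_iUnion]
    constructor
    · rintro ⟨η, hη, hηξ⟩
      obtain ⟨α, hα⟩ := (Quotient.exact hηξ : (MulAction.orbitRel Γ₀ (RegularSet Γ₀)) η ξ)
      exact ⟨α, by simpa [hα] using hη⟩
    · rintro ⟨α, hα⟩
      exact ⟨α • ξ, hα, quotMk_smul Γ₀ α ξ⟩
  refine isOpen_coinduced.2 (?_ : IsOpen (quotMk Γ₀ ⁻¹' (quotMk Γ₀ '' W)))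
  rw [h]
  exact isOpen_iUnion fun α => hW.preimage (continuous_smul_regularSet α)

variable [ProperSpace X]

theorem card_le_of_mem_nearSet (hX : IsCATNegOne X) (hD : IsDiscreteGroup Γ₀) {K : ℝ}
    {ξ : Boundary X} {F : Finset Γ₀} (hF : ∀ α ∈ F, α.1⁻¹ • ξ ∈ nearSet Γ₀ o K) :
    F.card ≤ (hD.finite_ball o (2 * K)).toFinset.card := by
  classical
  rcases F.eq_empty_or_nonempty with rfl | ⟨α₁, h₁⟩
  · simp
  refine Finset.card_le_card_of_injOn (fun α => α₁⁻¹ * α) (fun α hα => ?_)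
    (fun a _ b _ h => mul_left_cancel h)
  rw [Finset.mem_coe, Finite.mem_toFinset, mem_ofPred_eq]
  change len o (α₁.1⁻¹ * α.1) ≤ _
  rw [← dist_apply_apply]
  exact dist_le_of_mem_nearSet hX (hF α₁ h₁) (hF α hα)

/-- The Γ₀-translates of this set cover the complement of ΛΓ₀. If it were null, μ_o would be carried
by ΛΓ₀, and by quasi-invariance also by γΛΓ₀; these are disjoint. -/
theorem measure_nearSet_ne_zero (hX : IsCATNegOne X) (hD : IsDiscreteGroup Γ) (hle : Γ₀ ≤ Γ)
    (hmal : IsAlmostMalnormal Γ₀ Γ) (hC : IsCore Γ₀ C o R) (hδ : 0 ≤ δ)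
    (hμ : IsConformalDensity Γ δ μ) (hμ0 : μ o ≠ 0) {γ : X ≃ᵢ X} (hγ : γ ∈ Γ) (hγ₀ : γ ∉ Γ₀) :
    μ o (nearSet Γ₀ o (κ + R)) ≠ 0 := by
  intro h0
  have : Nonempty X := ⟨o⟩
  have : Countable Γ₀ := (hD.mono hle).countable
  have hac : ∀ x {E : Set (Boundary X)}, MeasurableSet E → μ o E = 0 → μ x E = 0 := by
    intro x E hE h
    have := hμ.measure_le hδ hE (x := x) (y := o) fun ξ _ => neg_dist_le_busemann hX ξ x o
    rw [h, mul_zero] at this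
    exact le_antisymm this bot_le
  have hreg : μ o (limitSet Γ₀)ᶜ = 0 := by
    refine measure_mono_null (t := ⋃ α : Γ₀, {ξ | α.1⁻¹ • ξ ∈ nearSet Γ₀ o (κ + R)}) ?_ ?_
    · intro ξ hξ
      exact mem_iUnion.2 (exists_smul_mem_nearSet hX hC hξ)
    · refine measure_iUnion_null fun α => ?_
      rw [← hμ.measure_smul (Γ.inv_mem (hle α.2)) o (measurableSet_nearSet hX Γ₀ o _)]
      exact hac _ (measurableSet_nearSet hX Γ₀ o _) h0
  have hmeas : MeasurableSet (limitSet Γ₀)ᶜ := (isClosed_limitSet hX hC).measurableSet.compl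
  have hreg' : μ o {ξ | γ⁻¹ • ξ ∈ (limitSet Γ₀)ᶜ} = 0 := by
    rw [← hμ.measure_smul (Γ.inv_mem hγ) o hmeas]
    exact hac _ hmeas hreg
  refine hμ0 (Measure.measure_univ_eq_zero.1 (measure_mono_null (t := (limitSet Γ₀)ᶜ ∪
    {ξ | γ⁻¹ • ξ ∈ (limitSet Γ₀)ᶜ}) (fun ξ _ => ?_) (measure_union_null hreg hreg')))
  by_contra hc
  rw [mem_union, not_or, mem_compl_iff, not_not, mem_ofPred_eq, mem_compl_iff, not_not] at hc
  refine smul_limitSet_disjoint hX hD hle hmal hC hγ hγ₀ hc.2 ?_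
  rw [smul_inv_smul]
  exact hc.1

/-- The translate of `nearSet` by α has mass at least exp(-δ d(o, αo)) times that of `nearSet`.
These translates overlap boundedly and the total mass is finite. -/
theorem tsum_poincareTerm_subgroup_ne_top (hX : IsCATNegOne X) (hD : IsDiscreteGroup Γ)
    (hle : Γ₀ ≤ Γ) (hδ : 0 ≤ δ) (hμ : IsConformalDensity Γ δ μ) {K : ℝ}
    (hpos : μ o (nearSet Γ₀ o K) ≠ 0) : ∑' α : Γ₀, poincareTerm o δ α.1 ≠ ⊤ := by
  have : Nonempty X := ⟨o⟩
  have : Countable Γ₀ := (hD.mono hle).countable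
  have := hμ.finite o
  have hmeas := measurableSet_nearSet hX Γ₀ o K
  have h1 := tsum_measure_le_of_card (μ o)
    (E := fun α : Γ₀ => {ξ | α.1⁻¹ • ξ ∈ nearSet Γ₀ o K})
    (fun α => measurable_smul_boundary _ hmeas) (fun _ => subset_univ _)
    (fun ξ F hF => card_le_of_mem_nearSet hX (hD.mono hle) (o := o) hF)
  have h2 : (∑' α : Γ₀, poincareTerm o δ α.1) * μ o (nearSet Γ₀ o K) ≤
      ∑' α : Γ₀, μ o {ξ | α.1⁻¹ • ξ ∈ nearSet Γ₀ o K} := by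
    rw [← ENNReal.tsum_mul_right]
    exact ENNReal.tsum_le_tsum fun α => hμ.le_measure_translate hX hδ (hle α.2) hmeas
  intro htop
  rw [htop, ENNReal.top_mul hpos] at h2
  have h3 := h2.trans h1
  exact absurd (top_le_iff.1 h3) (ENNReal.mul_ne_top (ENNReal.natCast_ne_top _)
    (measure_ne_top _ _))

end Densities

section QuotientEstimates

variable {X : Type*} [MetricSpace X] [ProperSpace X] {Γ₀ Γ : Subgroup (X ≃ᵢ X)} {C : Set X}
  {o : X} {R δ : ℝ} {μ : X → Measure (Boundary X)}

/-! ### The measure on the quotient -/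

theorem measurableEmbedding_val (hX : IsCATNegOne X) (hC : IsCore Γ₀ C o R) :
    MeasurableEmbedding (Subtype.val : RegularSet Γ₀ → Boundary X) :=
  MeasurableEmbedding.subtype_coe (isClosed_limitSet hX hC).measurableSet.compl

theorem orbitSumMeasure_apply (hX : IsCATNegOne X) (hC : IsCore Γ₀ C o R)
    {S : Set (RegularSet Γ₀)} (hS : MeasurableSet S) :
    orbitSumMeasure Γ₀ μ o S = ∑' α : Γ₀, μ (α.1 o) (Subtype.val '' S) := by
  have he := measurableEmbedding_val hX hC
  rw [orbitSumMeasure, he.comap_apply, Measure.sum_apply _ (he.measurableSet_image.2 hS)]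

theorem measurePreserving_smul (hX : IsCATNegOne X) (hle : Γ₀ ≤ Γ) (hC : IsCore Γ₀ C o R)
    (hμ : IsConformalDensity Γ δ μ) (α : Γ₀) :
    MeasurePreserving (fun ξ : RegularSet Γ₀ => α • ξ) (orbitSumMeasure Γ₀ μ o)
      (orbitSumMeasure Γ₀ μ o) := by
  have hmeas : Measurable fun ξ : RegularSet Γ₀ => α • ξ :=
    (continuous_smul_regularSet α).measurable
  refine ⟨hmeas, Measure.ext fun S hS => ?_⟩
  rw [Measure.map_apply hmeas hS, orbitSumMeasure_apply hX hC (hmeas hS),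
    orbitSumMeasure_apply hX hC hS,
    ← (Equiv.mulLeft α).tsum_eq fun β : Γ₀ => μ (β.1 o) (Subtype.val '' S)]
  refine tsum_congr fun β => ?_
  have hS' := (measurableEmbedding_val hX hC).measurableSet_image.2 hS
  change _ = μ (α.1 (β.1 o)) _
  rw [hμ.measure_smul (hle α.2) _ hS']
  congr 1
  ext ξ
  constructor
  · rintro ⟨ξ, hξ, rfl⟩
    exact ⟨α • ξ, hξ, rfl⟩
  · rintro ⟨η, hη, hηξ⟩
    have hξ : (α⁻¹ • η : RegularSet Γ₀).1 = ξ := by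
      change α.1⁻¹ • η.1 = ξ
      rw [hηξ, inv_smul_smul]
    refine ⟨α⁻¹ • η, ?_, hξ⟩
    change α • α⁻¹ • η ∈ S
    rwa [smul_inv_smul]

/-- Unfolding: a packing function is dominated by its sum against the translates of the indicator of
U, and invariance moves the translations onto the function, whose orbit sums are at most 1. Openness
of U makes its image measurable; N need not be. -/
theorem quotMeasure_le (hX : IsCATNegOne X) (hD : IsDiscreteGroup Γ) (hle : Γ₀ ≤ Γ)
    (hC : IsCore Γ₀ C o R) (hμ : IsConformalDensity Γ δ μ) {N : Set (BoundaryQuot Γ₀)}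
    {U : Set (Boundary X)} (hU : IsOpen U)
    (hN : ∀ a ∈ N, ∃ ξ : RegularSet Γ₀, ξ.1 ∈ U ∧ quotMk Γ₀ ξ = a) :
    quotMeasure Γ₀ μ o N ≤ ∑' α : Γ₀, μ (α.1 o) U := by
  have : Nonempty X := ⟨o⟩
  have : Countable Γ₀ := (hD.mono hle).countable
  set W : Set (RegularSet Γ₀) := Subtype.val ⁻¹' U with hW
  have hWo : IsOpen W := hU.preimage continuous_subtype_val
  have hsub : N ⊆ quotMk Γ₀ '' W := fun a ha => by
    obtain ⟨ξ, hξ, rfl⟩ := hN a ha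
    exact ⟨ξ, hξ, rfl⟩
  refine (measure_mono hsub).trans ?_
  rw [quotMeasure, quotientMeasure,
    Measure.ofMeasurable_apply _ (isOpen_image_quotMk hWo).measurableSet]
  refine iSup_le fun f => ?_
  set ν := orbitSumMeasure Γ₀ μ o with hν
  have hmeas : ∀ α : Γ₀, Measurable fun ξ : RegularSet Γ₀ => α • ξ := fun α =>
    (continuous_smul_regularSet α).measurable
  have hind : Measurable (W.indicator (1 : RegularSet Γ₀ → ℝ≥0∞)) :=
    measurable_one.indicator hWo.measurableSet
  calc ∫⁻ ξ, f.1 ξ ∂ν ≤ ∫⁻ ξ, ∑' α : Γ₀, f.1 ξ * W.indicator 1 (α • ξ) ∂ν := by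
        refine lintegral_mono fun ξ => ?_
        by_cases hξ : ξ ∈ quotMk Γ₀ ⁻¹' (quotMk Γ₀ '' W)
        · obtain ⟨η, hη, hηξ⟩ := hξ
          obtain ⟨α, hα⟩ := (Quotient.exact hηξ : (MulAction.orbitRel Γ₀ (RegularSet Γ₀)) η ξ)
          have hα' : α • ξ ∈ W := by simpa [hα] using hη
          refine le_trans ?_ (ENNReal.le_tsum α)
          rw [indicator_of_mem hα', Pi.one_apply, mul_one]
        · have := Packing.le f ξ
          rw [indicator_of_notMem hξ] at this
          exact this.trans bot_le
    _ = ∑' α : Γ₀, ∫⁻ ξ, f.1 ξ * W.indicator 1 (α • ξ) ∂ν :=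
        lintegral_tsum fun α => (f.2.1.mul (hind.comp (hmeas α))).aemeasurable
    _ = ∑' α : Γ₀, ∫⁻ ξ, f.1 (α⁻¹ • ξ) * W.indicator 1 ξ ∂ν := by
        refine tsum_congr fun α => ?_
        have := (measurePreserving_smul hX hle hC hμ α).lintegral_comp
          (f := fun ξ => f.1 (α⁻¹ • ξ) * W.indicator 1 ξ) ((f.2.1.comp (hmeas α⁻¹)).mul hind)
        simpa only [inv_smul_smul] using this
    _ = ∑' α : Γ₀, ∫⁻ ξ, f.1 (α • ξ) * W.indicator 1 ξ ∂ν :=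
        (Equiv.inv Γ₀).tsum_eq fun α : Γ₀ => ∫⁻ ξ, f.1 (α • ξ) * W.indicator 1 ξ ∂ν
    _ = ∫⁻ ξ, (∑' α : Γ₀, f.1 (α • ξ)) * W.indicator 1 ξ ∂ν := by
        simp only [← ENNReal.tsum_mul_right]
        exact (lintegral_tsum fun α => ((f.2.1.comp (hmeas α)).mul hind).aemeasurable).symm
    _ ≤ ∫⁻ ξ, W.indicator 1 ξ ∂ν := by
        refine lintegral_mono fun ξ => ?_
        have h1 : ∑' α : Γ₀, f.1 (α • ξ) ≤ 1 :=
          (f.2.2 ξ).trans (indicator_le_self' (fun _ _ => bot_le) ξ)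
        calc (∑' α : Γ₀, f.1 (α • ξ)) * W.indicator 1 ξ ≤ 1 * W.indicator 1 ξ := by gcongr
          _ = _ := one_mul _
    _ = ν W := lintegral_indicator_one hWo.measurableSet
    _ ≤ _ := by
        rw [hν, orbitSumMeasure_apply hX hC hWo.measurableSet]
        exact ENNReal.tsum_le_tsum fun α => measure_mono (image_preimage_subset _ _)

/-- An orbit meets `nearSet` in boundedly many group parameters, so the indicator of V divided by
that bound is a packing function. Since N may fail to be measurable, a measurable hull is used. -/
theorem le_quotMeasure (hX : IsCATNegOne X) (hD : IsDiscreteGroup Γ₀) (hC : IsCore Γ₀ C o R)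
    {N : Set (BoundaryQuot Γ₀)} {V : Set (Boundary X)} (hV : MeasurableSet V) {K : ℝ}
    (hVK : V ⊆ nearSet Γ₀ o K) (hN : ∀ ξ : RegularSet Γ₀, ξ.1 ∈ V → quotMk Γ₀ ξ ∈ N) :
    ((hD.finite_ball o (2 * K)).toFinset.card : ℝ≥0∞)⁻¹ * μ o V ≤ quotMeasure Γ₀ μ o N := by
  classical
  set M : ℕ := (hD.finite_ball o (2 * K)).toFinset.card with hM
  set W : Set (RegularSet Γ₀) := Subtype.val ⁻¹' V with hW
  have hWm : MeasurableSet W := measurable_subtype_coe hV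
  rw [← measure_toMeasurable N]
  set B := toMeasurable (quotMeasure Γ₀ μ o) N with hB
  have hBm : MeasurableSet B := measurableSet_toMeasurable _ _
  have hNB : N ⊆ B := subset_toMeasurable _ _
  rw [quotMeasure, quotientMeasure, Measure.ofMeasurable_apply _ hBm]
  have hcount : ∀ ξ : RegularSet Γ₀, ∑' α : Γ₀, W.indicator (1 : RegularSet Γ₀ → ℝ≥0∞) (α • ξ) ≤
      M := by
    intro ξ
    rw [← (Equiv.inv Γ₀).tsum_eq]
    simp only [indicator_apply, Pi.one_apply]
    refine tsum_ite_le_of_card fun F hF => card_le_of_mem_nearSet hX hD (ξ := ξ.1) (o := o)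
      (K := K) fun α hα => ?_
    exact hVK (hF α hα)
  refine le_trans ?_ (le_iSup (fun f : Packing Γ₀ (quotMk Γ₀) B =>
    ∫⁻ ξ, f.1 ξ ∂(orbitSumMeasure Γ₀ μ o))
    ⟨fun ξ => (M : ℝ≥0∞)⁻¹ * W.indicator 1 ξ,
      (measurable_one.indicator hWm).const_mul _, fun ξ => ?_⟩)
  · change _ ≤ ∫⁻ ξ, (M : ℝ≥0∞)⁻¹ * W.indicator 1 ξ ∂(orbitSumMeasure Γ₀ μ o)
    rw [lintegral_const_mul _ (measurable_one.indicator hWm), lintegral_indicator_one hWm,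
      orbitSumMeasure_apply hX hC hWm]
    gcongr
    refine le_trans ?_ (ENNReal.le_tsum 1)
    refine measure_mono fun ξ hξ => ?_
    exact ⟨⟨ξ, nearSet_disjoint hX hC (hVK hξ)⟩, hξ, rfl⟩
  · rw [ENNReal.tsum_mul_left]
    by_cases hξ : ξ ∈ quotMk Γ₀ ⁻¹' B
    · rw [indicator_of_mem hξ, Pi.one_apply]
      calc _ ≤ (M : ℝ≥0∞)⁻¹ * M := by gcongr; exact hcount ξ
        _ ≤ 1 := ENNReal.inv_mul_le_one _
    · have : ∀ α : Γ₀, α • ξ ∉ W := by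
        intro α hα
        apply hξ
        have := hNB (hN (α • ξ) hα)
        rwa [quotMk_smul] at this
      simp [this]

end QuotientEstimates

section Estimates

variable {X : Type*} [MetricSpace X] {Γ₀ Γ : Subgroup (X ≃ᵢ X)} {o : X} {R δ : ℝ}
  {μ : X → Measure (Boundary X)}

/-! ### Double cosets -/

theorem quotDist_le (Γ₀ : Subgroup (X ≃ᵢ X)) (ξ η : RegularSet Γ₀) :
    quotDist Γ₀ (quotMk Γ₀ ξ) (quotMk Γ₀ η) ≤ convDist (groupHull Γ₀) ξ.1 η.1 :=
  csInf_le ⟨0, by rintro _ ⟨ξ, η, -, -, rfl⟩; exact convDist_nonneg _ _ _⟩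
    ⟨ξ, η, rfl, rfl, rfl⟩

theorem cosetLimitSet_mul (γ : X ≃ᵢ X) {α β : X ≃ᵢ X} (hα : α ∈ Γ₀) (hβ : β ∈ Γ₀) :
    cosetLimitSet Γ₀ (α * γ * β) = cosetLimitSet Γ₀ γ := by
  have key : ∀ (γ : X ≃ᵢ X) {α β : X ≃ᵢ X}, α ∈ Γ₀ → β ∈ Γ₀ →
      cosetLimitSet Γ₀ (α * γ * β) ⊆ cosetLimitSet Γ₀ γ := by
    rintro γ α β hα hβ _ ⟨ξ, ⟨ζ, hζ, hξ⟩, rfl⟩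
    refine ⟨(⟨α, hα⟩ : Γ₀)⁻¹ • ξ, ⟨β • ζ, smul_mem_limitSet hβ hζ, ?_⟩, quotMk_smul Γ₀ _ ξ⟩
    change α⁻¹ • ξ.1 = _
    rw [hξ, mul_smul, mul_smul, inv_smul_smul]
  refine (key γ hα hβ).antisymm ?_
  have h := key (α * γ * β) (Γ₀.inv_mem hα) (Γ₀.inv_mem hβ)
  rwa [show α⁻¹ * (α * γ * β) * β⁻¹ = γ by group] at h

theorem criticalExponent_ne_top_of_le (hle : Γ₀ ≤ Γ) (h : criticalExponent Γ o ≠ ⊤) :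
    criticalExponent Γ₀ o ≠ ⊤ := by
  obtain ⟨_, ⟨a, rfl, ha⟩, -⟩ := exists_lt_of_csInf_lt (by
    by_contra hc
    rw [not_nonempty_iff_eq_empty] at hc
    rw [criticalExponent, hc, sInf_empty] at h
    exact h rfl) (lt_top_iff_ne_top.2 h)
  have ha₀ := ha.comp_injective (Subgroup.inclusion_injective hle)
  exact ((sInf_le ⟨a, rfl, ha₀⟩ : criticalExponent Γ₀ o ≤ a).trans_lt ENNReal.coe_lt_top).ne

/-- Seen from γαo, the points o and γo lie in the same direction when α is long. A boundary point
projecting to γC near γαo does not head towards γo, hence not towards o. -/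
theorem bgp_le_of_translate_mem_nearSet (hX : IsCATNegOne X)
    (hC : IsCore Γ₀ (groupHull Γ₀) o R) {γ : X ≃ᵢ X} {A K : ℝ}
    (hγ : IsReduced (groupHull Γ₀) o A γ) {α : Γ₀} (hα : A + 4 * κ + K < len o α.1)
    {ξ : Boundary X} (hξ : (γ * α.1)⁻¹ • ξ ∈ nearSet Γ₀ o K) :
    bgp ξ (γ (α.1 o)) o ≤ K + 2 * κ := by
  have h1 := hξ α⁻¹
  rw [← bgp_smul hX (γ * α.1), smul_inv_smul] at h1
  change bgp ξ (γ (α.1 o)) (γ (α.1 (α.1⁻¹ o))) ≤ K at h1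
  rw [apply_inv_self] at h1
  have h2 := gp_translate_le hX hC hγ (hC.map_mem α.1 α.2 o hC.base_mem)
  have h3 := gp_add (γ o) (γ (α.1 o)) o
  rw [γ.dist_eq, gp_comm, gp_comm (γ (α.1 o))] at h3
  have h4 : len o α.1 = dist o (α.1 o) := rfl
  have h5 := bgp_min_left hX ξ (γ (α.1 o)) o (γ o)
  by_contra! hlt
  have := lt_min hlt (show K + 2 * κ < gp (γ (α.1 o)) o (γ o) by linarith)
  linarith

/-! ### The upper bound -/

/-- The easy half of the shadow lemma: the Busemann function is bounded below on the shadow, and the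
measures based at o and at go have the same total mass. -/
theorem measure_shadow_le (hX : IsCATNegOne X) (hμ : IsConformalDensity Γ δ μ) (hδ : 0 ≤ δ)
    {g : X ≃ᵢ X} (hg : g ∈ Γ) (s : ℝ) :
    μ o {ξ | s < bgp ξ o (g o)} ≤
      ENNReal.ofReal (Real.exp (-δ * (2 * s - len o g))) * μ o univ := by
  refine (hμ.measure_le hδ (y := g o) (b := 2 * s - len o g)
    (isOpen_lt continuous_const (continuous_bgp hX o _)).measurableSet fun ξ hξ => ?_).trans ?_
  · have h : s < bgp ξ o (g o) := hξ
    unfold bgp at h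
    unfold len
    linarith
  · rw [← hμ.measure_univ hg o]
    gcongr
    exact subset_univ _

theorem tsum_measure_le_of_subset_nearSet (hX : IsCATNegOne X) (hμ : IsConformalDensity Γ δ μ)
    (hδ : 0 ≤ δ) {K : ℝ} {U : Set (Boundary X)} (hU : MeasurableSet U)
    (hUK : U ⊆ nearSet Γ₀ o K) :
    ∑' β : Γ₀, μ (β.1 o) U ≤
      ENNReal.ofReal (Real.exp (2 * δ * K)) * (∑' β : Γ₀, poincareTerm o δ β.1) * μ o U := by
  rw [← ENNReal.tsum_mul_left, ← ENNReal.tsum_mul_right]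
  refine ENNReal.tsum_le_tsum fun β => ?_
  refine (hμ.measure_le hδ (y := o) (b := len o β.1 - 2 * K) hU fun ξ hξ => ?_).trans_eq ?_
  · have h1 := hUK hξ β
    have h2 := busemann_neg hX ξ o (β.1 o)
    unfold bgp at h1
    unfold len
    linarith
  · congr 1
    rw [poincareTerm, ← ENNReal.ofReal_mul (Real.exp_pos _).le, ← Real.exp_add]
    congr 2
    ring

variable [ProperSpace X]

theorem exists_shadow_of_mem_cosetNhd (hX : IsCATNegOne X)
    (hC : IsCore Γ₀ (groupHull Γ₀) o R) {γ : X ≃ᵢ X} {A B : ℝ}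
    (hγ : IsReduced (groupHull Γ₀) o A γ)
    (hB : ∀ w ∈ groupHull Γ₀, ∀ y ∈ groupHull Γ₀, gp o w (γ y) ≤ B) {ε : ℝ} (hε : 0 < ε)
    (hT : len o γ ≤ -Real.log (2 * ε)) {a : BoundaryQuot Γ₀} (ha : a ∈ cosetNhd Γ₀ γ ε) :
    ∃ ξ : RegularSet Γ₀, quotMk Γ₀ ξ = a ∧ ∃ α : Γ₀,
      |len o α.1 - (-Real.log (2 * ε) - len o γ)| ≤ R ∧
      -Real.log (2 * ε) - (2 * (A + 2 * κ) + B + 15 * κ + R) ≤ bgp ξ.1 o (γ (α.1 o)) := by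
  obtain ⟨_, ⟨η₀, ⟨ζ, hζ, hη₀⟩, rfl⟩, hd⟩ := ha
  obtain ⟨ξ₀, hξ₀⟩ := Quotient.exists_rep a
  -- The infimum defining d₀ need not be attained; representatives closer than 2ε suffice, hence T =
  -- -log(2ε).
  obtain ⟨_, ⟨ξ, η, hξ, hη, rfl⟩, hlt⟩ := exists_lt_of_csInf_lt
    (s := {d | ∃ ξ η : RegularSet Γ₀, quotMk Γ₀ ξ = a ∧ quotMk Γ₀ η = quotMk Γ₀ η₀ ∧
      d = convDist (groupHull Γ₀) ξ.1 η.1}) ⟨_, ξ₀, η₀, hξ₀, rfl, rfl⟩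
          (hd.trans_lt (show ε < 2 * ε by linarith))
  obtain ⟨α, hα⟩ := (Quotient.exact hη : (MulAction.orbitRel Γ₀ (RegularSet Γ₀)) η η₀)
  have hαη : α.1 • (γ • ζ) = η.1 := by
    rw [← hη₀]; exact congrArg Subtype.val hα
  obtain ⟨t, ht⟩ := ((tendsto_convDist (groupHull Γ₀) ξ.1 η.1).eventually
    (gt_mem_nhds hlt)).exists
  rw [← Real.lt_log_iff_exp_lt (by linarith)] at ht
  obtain ⟨r1, r2⟩ := perpRay_spec hX hC ξ.2
  obtain ⟨s1, s2⟩ := perpRay_spec hX hC η.2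
  have hinv := fun x => hC.map_mem_iff (Γ₀.inv_mem α.2) x
  have hη' : α.1⁻¹ • η.1 = γ • ζ := by rw [← hαη, inv_smul_smul]
  obtain ⟨β, h1, h2⟩ := exists_mem_shadow hX hC hγ hB (ξ := α.1⁻¹ • ξ.1) hζ
    (ρ := (perpRay (groupHull Γ₀) ξ.1).map α.1⁻¹) (σ := (perpRay (groupHull Γ₀) η.1).map α.1⁻¹)
    (by rw [← smul_endpoint, r1]) (by rw [← smul_endpoint, s1, hη'])
    (isClosestPoint_map hX hinv r2) (hη' ▸ isClosestPoint_map hX hinv s2) hT (t := t)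
    (by
      change dist (α.1⁻¹ _) (α.1⁻¹ _) ≤ _
      rw [α.1⁻¹.dist_eq]
      linarith)
  exact ⟨α⁻¹ • ξ, (quotMk_smul Γ₀ _ ξ).trans hξ, β, h1, h2⟩

theorem exists_quotMeasure_cosetNhd_le (hX : IsCATNegOne X) (hD : IsDiscreteGroup Γ)
    (hle : Γ₀ ≤ Γ) (hC : IsCore Γ₀ (groupHull Γ₀) o R) {A B : ℝ}
    (hfin : criticalExponent Γ₀ o ≠ ⊤) (hδ : 0 ≤ δ) (hμ : IsConformalDensity Γ δ μ)
    (hS : ∑' α : Γ₀, poincareTerm o δ α.1 ≠ ⊤) :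
    ∃ k E : ℝ, 0 ≤ k ∧ ∀ γ ∈ Γ, IsReduced (groupHull Γ₀) o A γ →
      (∀ w ∈ groupHull Γ₀, ∀ y ∈ groupHull Γ₀, gp o w (γ y) ≤ B) → ∀ ε : ℝ, 0 < ε →
      len o γ + E ≤ -Real.log ε → quotMeasure Γ₀ μ o (cosetNhd Γ₀ γ ε) ≤
        ENNReal.ofReal (k * Real.exp (-(criticalExponent Γ₀ o).toReal * len o γ +
          (δ - (criticalExponent Γ₀ o).toReal) * Real.log ε)) := by
  have hD₀ := hD.mono hle
  obtain ⟨c₁, hc₁, hcard⟩ := card_annulus_le hX hD₀ hC hfin R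
  set δ₀ := (criticalExponent Γ₀ o).toReal with hδ₀
  set S := ∑' α : Γ₀, poincareTerm o δ α.1
  have := hμ.finite o
  set L := 2 * (A + 2 * κ) + B + 15 * κ + R with hL
  refine ⟨Real.exp (2 * δ * (B + 2 * κ)) * S.toReal * (c₁ * (μ o univ).toReal) *
    Real.exp (δ * (Real.log 2 + 2 * L + 2 + R) - δ₀ * Real.log 2),
    -- This threshold ensures T ≥ d(o, γo), so that the annulus makes sense, and T - L - 1 ≥ B + 2κ,
    -- so that all the shadows lie in `nearSet`.
    max 0 (Real.log 2 + L + 1 + B + 2 * κ) + Real.log 2, by positivity, ?_⟩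
  intro γ hγ hred hB ε hε hlen
  have hlog : Real.log (2 * ε) = Real.log 2 + Real.log ε :=
    Real.log_mul two_ne_zero hε.ne'
  have hlog2 : 0 < Real.log 2 := Real.log_pos one_lt_two
  set T := -Real.log (2 * ε) with hT
  have m1 := le_max_left 0 (Real.log 2 + L + 1 + B + 2 * κ)
  have m2 := le_max_right 0 (Real.log 2 + L + 1 + B + 2 * κ)
  have hlen0 := len_nonneg o γ
  have hTlen : len o γ ≤ T := by linarith
  set F := (hD₀.finite_annulus o (T - len o γ) R).toFinset with hF
  set U : Set (Boundary X) := ⋃ α ∈ F, {ξ | T - L - 1 < bgp ξ o ((γ * α.1) o)} with hU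
  have hUo : IsOpen U := isOpen_biUnion fun α _ =>
    isOpen_lt continuous_const (continuous_bgp hX o _)
  have hUnear : U ⊆ nearSet Γ₀ o (B + 2 * κ) := by
    intro ξ hξ β
    obtain ⟨α, -, hα⟩ := mem_iUnion₂.1 hξ
    refine le_bgp_of_between hX hB (hC.map_mem α.1 α.2 o hC.base_mem)
      (lt_of_le_of_lt ?_ hα) (hC.map_mem β.1 β.2 o hC.base_mem)
    linarith
  have h1 := quotMeasure_le hX hD hle hC hμ (N := cosetNhd Γ₀ γ ε) hUo (by
    intro a ha
    obtain ⟨ξ, hξ, α, hα1, hα2⟩ := exists_shadow_of_mem_cosetNhd hX hC hred hB hε hTlen ha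
    refine ⟨ξ, mem_iUnion₂.2 ⟨α, ?_, ?_⟩, hξ⟩
    · rw [hF, Finite.mem_toFinset]; exact hα1
    · change T - L - 1 < bgp ξ.1 o (γ (α.1 o))
      linarith)
  have h2 := tsum_measure_le_of_subset_nearSet hX hμ hδ hUo.measurableSet hUnear
  have h3 : μ o U ≤ F.card * (ENNReal.ofReal (Real.exp (-δ * (T - 2 * L - 2 - R))) *
      μ o univ) := by
    refine (measure_biUnion_finset_le F _).trans ?_
    rw [← nsmul_eq_mul]
    refine Finset.sum_le_card_nsmul F _ _ fun α hα => ?_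
    refine (measure_shadow_le hX hμ hδ (Γ.mul_mem hγ (hle α.2)) _).trans ?_
    gcongr ENNReal.ofReal (Real.exp ?_) * _
    rw [hF, Finite.mem_toFinset] at hα
    have hα' := (abs_le.1 (show |len o α.1 - (T - len o γ)| ≤ R from hα)).2
    have := len_mul_le o γ α.1
    nlinarith
  have h4 : (F.card : ℝ≥0∞) ≤ ENNReal.ofReal (c₁ * Real.exp (δ₀ * (T - len o γ))) := by
    rw [← ENNReal.ofReal_natCast]
    exact ENNReal.ofReal_le_ofReal (hcard _ (by linarith))
  refine h1.trans (h2.trans ?_)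
  calc _ ≤ ENNReal.ofReal (Real.exp (2 * δ * (B + 2 * κ))) * S *
        (ENNReal.ofReal (c₁ * Real.exp (δ₀ * (T - len o γ))) *
          (ENNReal.ofReal (Real.exp (-δ * (T - 2 * L - 2 - R))) * μ o univ)) := by
        gcongr
        exact h3.trans (by gcongr)
    _ = ENNReal.ofReal (Real.exp (2 * δ * (B + 2 * κ)) * S.toReal *
        (c₁ * Real.exp (δ₀ * (T - len o γ)) *
          (Real.exp (-δ * (T - 2 * L - 2 - R)) * (μ o univ).toReal))) := by
        rw [ENNReal.ofReal_mul (p := Real.exp (2 * δ * (B + 2 * κ)) * S.toReal) (by positivity),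
          ENNReal.ofReal_mul (p := Real.exp (2 * δ * (B + 2 * κ))) (by positivity),
          ENNReal.ofReal_mul (p := c₁ * Real.exp (δ₀ * (T - len o γ))) (by positivity),
          ENNReal.ofReal_mul (p := Real.exp (-δ * (T - 2 * L - 2 - R))) (by positivity),
          ENNReal.ofReal_toReal hS, ENNReal.ofReal_toReal (measure_ne_top _ _)]
    _ = _ := by
        congr 1
        have e : Real.exp (δ₀ * (T - len o γ)) * Real.exp (-δ * (T - 2 * L - 2 - R)) =
            Real.exp (δ * (Real.log 2 + 2 * L + 2 + R) - δ₀ * Real.log 2) *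
              Real.exp (-δ₀ * len o γ + (δ - δ₀) * Real.log ε) := by
          rw [← Real.exp_add, ← Real.exp_add, hT, hlog]
          congr 1
          ring
        linear_combination (Real.exp (2 * δ * (B + 2 * κ)) * S.toReal *
          (c₁ * (μ o univ).toReal)) * e

/-! ### The lower bound -/

theorem mem_cosetNhd_of_translate_mem_nearSet (hX : IsCATNegOne X)
    (hC : IsCore Γ₀ (groupHull Γ₀) o R) {γ : X ≃ᵢ X} {A B K H : ℝ}
    (hγ : IsReduced (groupHull Γ₀) o A γ)
    (hB : ∀ w ∈ groupHull Γ₀, ∀ y ∈ groupHull Γ₀, gp o w (γ y) ≤ B) {ξ₁ ξ₂ : Boundary X}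
    (h₁ : ξ₁ ∈ limitSet Γ₀) (h₂ : ξ₂ ∈ limitSet Γ₀)
    (hreg : ∀ ζ ∈ limitSet Γ₀, γ • ζ ∉ limitSet Γ₀)
    (hpair : ∀ w, bgp ξ₁ o w ≤ H ∨ bgp ξ₂ o w ≤ H) (hHK : K + 2 * κ ≤ H)
    {α : Γ₀} (hα : A + 4 * κ + K < len o α.1) {ε : ℝ} (hε : 0 < ε) (hε1 : ε ≤ 1)
    (hlen : -Real.log ε + (B + 5 * κ + H + 1 + 2 * (A + 2 * κ)) ≤ len o γ + len o α.1)
    {ξ : Boundary X} (hξ : (γ * α.1)⁻¹ • ξ ∈ nearSet Γ₀ o K) :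
    ξ ∈ nearSet Γ₀ o (B + 2 * κ) ∧
      ∀ h : ξ ∉ limitSet Γ₀, quotMk Γ₀ ⟨ξ, h⟩ ∈ cosetNhd Γ₀ γ ε := by
  have hk := κ_pos
  have hαo := hC.map_mem α.1 α.2 o hC.base_mem
  have h1 := bgp_le_of_translate_mem_nearSet hX hC hγ hα hξ
  have h2 := bgp_add hX ξ o (γ (α.1 o))
  have h3 := len_add_dist_le hX hC hγ hαo
  have h4 : len o α.1 = dist o (α.1 o) := rfl
  have h5 : Real.log ε ≤ 0 := Real.log_nonpos hε.le hε1
  have hnear : ∀ w ∈ groupHull Γ₀, bgp ξ o w ≤ B + 2 * κ := fun w hw =>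
    le_bgp_of_between hX hB hαo (by linarith) hw
  refine ⟨fun β => hnear _ (hC.map_mem β.1 β.2 o hC.base_mem), fun h => ?_⟩
  -- One of the two limit points is not in the direction of o pulled back by γα. Its image then
  -- lies, like ξ, in the shadow of γαo, and two points in one shadow are close for d_C.
  obtain ⟨ζ, hζ, hζH⟩ : ∃ ζ ∈ limitSet Γ₀, bgp ζ o ((γ * α.1)⁻¹ o) ≤ H :=
    (hpair ((γ * α.1)⁻¹ o)).elim (fun h => ⟨ξ₁, h₁, h⟩) fun h => ⟨ξ₂, h₂, h⟩
  rw [← bgp_smul hX (γ * α.1), apply_inv_self, mul_smul] at hζH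
  change bgp (γ • α.1 • ζ) (γ (α.1 o)) o ≤ H at hζH
  have hζ' := smul_mem_limitSet α.2 hζ
  have h6 := bgp_add hX (γ • α.1 • ζ) o (γ (α.1 o))
  refine ⟨quotMk Γ₀ ⟨γ • α.1 • ζ, hreg _ hζ'⟩, ⟨_, ⟨_, hζ', rfl⟩, rfl⟩,
    (quotDist_le Γ₀ _ _).trans ((convDist_le_of_bgp hX hC h (hreg _ hζ') hnear
      (fun w hw => bgp_translate_le hX hC hB hζ' hw) (y := γ (α.1 o)) (K := H)
      (by linarith) (by linarith)).trans ?_)⟩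
  rw [← Real.exp_add, ← Real.le_log_iff_exp_le hε]
  linarith

/-- Distinct translates of the near set by elements of `γ Γ₀` have bounded overlap. -/
theorem card_mul_measure_nearSet_le (hX : IsCATNegOne X) (hD : IsDiscreteGroup Γ)
    (hle : Γ₀ ≤ Γ) (hδ : 0 ≤ δ) (hμ : IsConformalDensity Γ δ μ) {γ : X ≃ᵢ X} (hγ : γ ∈ Γ)
    {F : Finset Γ₀} (K : ℝ) {T : ℝ} (hF : ∀ α ∈ F, len o (γ * α.1) ≤ T) :
    F.card * (ENNReal.ofReal (Real.exp (-δ * T)) * μ o (nearSet Γ₀ o K)) ≤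
      ((hD.mono hle).finite_ball o (2 * K)).toFinset.card *
        μ o (⋃ α : F, {ξ | (γ * α.1.1)⁻¹ • ξ ∈ nearSet Γ₀ o K}) := by
  have hm := measurableSet_nearSet hX Γ₀ o K
  refine le_trans ?_ (tsum_measure_le_of_card (μ o)
    (E := fun α : F => {ξ | (γ * α.1.1)⁻¹ • ξ ∈ nearSet Γ₀ o K})
    (fun α => measurable_smul_boundary _ hm)
    (fun α => subset_iUnion (fun α : F => {ξ | (γ * α.1.1)⁻¹ • ξ ∈ nearSet Γ₀ o K}) α)
    (fun ξ G hG => ?_))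
  · rw [tsum_fintype, ← Fintype.card_coe F, ← Finset.card_univ, ← nsmul_eq_mul]
    refine Finset.card_nsmul_le_sum _ _ _ fun α _ => ?_
    refine le_trans ?_ (hμ.le_measure_translate hX hδ (Γ.mul_mem hγ (hle α.1.2)) hm)
    gcongr ENNReal.ofReal (Real.exp ?_) * _
    exact mul_le_mul_of_nonpos_left (hF α.1 α.2) (neg_nonpos.2 hδ)
  · rw [← Finset.card_map (Function.Embedding.subtype _)]
    refine card_le_of_mem_nearSet hX (hD.mono hle) (ξ := γ⁻¹ • ξ) fun α hα => ?_
    obtain ⟨β, hβ, rfl⟩ := Finset.mem_map.1 hα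
    have := hG β hβ
    rwa [mem_ofPred_eq, mul_inv_rev, mul_smul] at this

theorem exists_le_quotMeasure_cosetNhd (hX : IsCATNegOne X) (hD : IsDiscreteGroup Γ)
    (hle : Γ₀ ≤ Γ) (hmal : IsAlmostMalnormal Γ₀ Γ) (hC : IsCore Γ₀ (groupHull Γ₀) o R)
    (hΛ : 2 ≤ (limitSet Γ₀).encard) {A B : ℝ} (hA : 0 ≤ A) (hB0 : 0 ≤ B) (hδ : 0 ≤ δ)
    (hμ : IsConformalDensity Γ δ μ) (hpos : μ o (nearSet Γ₀ o (κ + R)) ≠ 0) :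
    ∃ k E : ℝ, 0 < k ∧ ∀ γ ∈ Γ, γ ∉ Γ₀ → IsReduced (groupHull Γ₀) o A γ →
      (∀ w ∈ groupHull Γ₀, ∀ y ∈ groupHull Γ₀, gp o w (γ y) ≤ B) → ∀ ε : ℝ, 0 < ε →
      len o γ + E ≤ -Real.log ε →
        ENNReal.ofReal (k * Real.exp (-(criticalExponent Γ₀ o).toReal * len o γ +
          (δ - (criticalExponent Γ₀ o).toReal) * Real.log ε)) ≤
          quotMeasure Γ₀ μ o (cosetNhd Γ₀ γ ε) := by
  classical
  have hD₀ := hD.mono hle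
  have hk := κ_pos
  have hR := hC.nonneg
  have := hμ.finite o
  obtain ⟨ξ₁, ξ₂, h₁, h₂, hne⟩ := one_lt_encard_iff.1
    (lt_of_lt_of_le (by norm_num) hΛ : 1 < (limitSet Γ₀).encard)
  obtain ⟨H₀, hH₀⟩ := exists_pair_bgp_le hX o hne
  set K := κ + R with hK
  set H := max (K + 2 * κ) H₀ with hH
  have hHK : K + 2 * κ ≤ H := le_max_left _ _
  have hpair : ∀ w, bgp ξ₁ o w ≤ H ∨ bgp ξ₂ o w ≤ H := fun w =>
    (hH₀ w).imp (fun h => h.trans (le_max_right _ _)) fun h => h.trans (le_max_right _ _)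
  set δ₀ := (criticalExponent Γ₀ o).toReal with hδ₀
  set p := μ o (nearSet Γ₀ o K) with hp
  have hptop : p ≠ ⊤ := measure_ne_top _ _
  have hp0 : 0 < p.toReal := ENNReal.toReal_pos hpos hptop
  set M := (hD₀.finite_ball o (2 * K)).toFinset.card with hM
  set M' := (hD₀.finite_ball o (2 * (B + 2 * κ))).toFinset.card with hM'
  -- The final R absorbs the width of the annulus, so every α in it puts γαo far enough out for its
  -- whole translate of `nearSet` to lie in the ε-neighbourhood.
  set J := B + 5 * κ + H + 1 + 2 * (A + 2 * κ) + R with hJ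
  refine ⟨Real.exp (δ₀ * (J - 3 * R) - δ * (J + R)) * p.toReal / ((M' + 1) * (M + 1)), 0,
    by positivity, ?_⟩
  intro γ hγ hγ₀ hred hB ε hε hlen
  rw [add_zero] at hlen
  have hlen0 := len_nonneg o γ
  have hε1 : ε ≤ 1 := by
    by_contra! h
    linarith [Real.log_pos h]
  set τ := -Real.log ε + J - len o γ with hτ
  set F := (hD₀.finite_annulus o τ R).toFinset with hF
  have hFmem : ∀ α ∈ F, |len o α.1 - τ| ≤ R := fun α hα => by
    rw [hF, Finite.mem_toFinset] at hα; exact hα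
  set V : F → Set (Boundary X) := fun α => {ξ | (γ * α.1.1)⁻¹ • ξ ∈ nearSet Γ₀ o K} with hV
  have hVm : ∀ α, MeasurableSet (V α) := fun α =>
    measurable_smul_boundary _ (measurableSet_nearSet hX Γ₀ o K)
  have hVspec : ∀ α, ∀ ξ ∈ V α, ξ ∈ nearSet Γ₀ o (B + 2 * κ) ∧
      ∀ h : ξ ∉ limitSet Γ₀, quotMk Γ₀ ⟨ξ, h⟩ ∈ cosetNhd Γ₀ γ ε := by
    intro α ξ hξ
    have h := (abs_le.1 (hFmem α.1 α.2)).1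
    exact mem_cosetNhd_of_translate_mem_nearSet hX hC hred hB h₁ h₂
      (fun ζ hζ => smul_limitSet_disjoint hX hD hle hmal hC hγ hγ₀ hζ) hpair hHK
      (by linarith) hε hε1 (by linarith) hξ
  have q1 := le_quotMeasure hX hD₀ hC (μ := μ) (N := cosetNhd Γ₀ γ ε) (V := ⋃ α, V α)
    (MeasurableSet.iUnion hVm)
    (iUnion_subset fun α ξ hξ => (hVspec α ξ hξ).1) (fun ξ hξ => by
      obtain ⟨α, hα⟩ := mem_iUnion.1 hξ
      exact (hVspec α ξ.1 hα).2 ξ.2)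
  have q2 := card_mul_measure_nearSet_le hX hD hle hδ hμ hγ (F := F) K (T := -Real.log ε + J + R)
    fun α hα => by linarith [len_mul_le o γ α.1, (abs_le.1 (hFmem α hα)).2]
  have q3 : ENNReal.ofReal (Real.exp (δ₀ * (τ - 3 * R)) *
      (Real.exp (-δ * (-Real.log ε + J + R)) * p.toReal)) ≤
      F.card * (ENNReal.ofReal (Real.exp (-δ * (-Real.log ε + J + R))) * p) := by
    rw [ENNReal.ofReal_mul (Real.exp_pos _).le, ENNReal.ofReal_mul (Real.exp_pos _).le,
      ENNReal.ofReal_toReal hptop, ← ENNReal.ofReal_natCast]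
    gcongr
    exact exp_le_card_annulus hX hD₀ hC ⟨ξ₁, h₁⟩ (by linarith)
  have q4 : μ o (⋃ α, V α) ≤ (M' + 1 : ℕ) * quotMeasure Γ₀ μ o (cosetNhd Γ₀ γ ε) := by
    rw [← ENNReal.inv_mul_le_iff (Nat.cast_ne_zero.2 M'.succ_ne_zero) (ENNReal.natCast_ne_top _)]
    refine le_trans ?_ q1
    gcongr
    exact Nat.le_succ _
  have q5 := (q3.trans q2).trans (mul_le_mul' (Nat.cast_le.2 (Nat.le_add_right M 1)) q4)
  rw [← mul_assoc ((M + 1 : ℕ) : ℝ≥0∞), ← Nat.cast_mul] at q5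
  have hN : (0 : ℝ) < ((M + 1) * (M' + 1) : ℕ) :=
    Nat.cast_pos.2 (Nat.mul_pos M.succ_pos M'.succ_pos)
  refine le_trans (le_of_eq ?_) (ENNReal.div_le_of_le_mul' q5)
  rw [← ENNReal.ofReal_natCast, ← ENNReal.ofReal_div_of_pos hN]
  congr 1
  have e : Real.exp (δ₀ * (J - 3 * R) - δ * (J + R)) *
      Real.exp (-δ₀ * len o γ + (δ - δ₀) * Real.log ε) =
      Real.exp (δ₀ * (τ - 3 * R)) * Real.exp (-δ * (-Real.log ε + J + R)) := by
    rw [← Real.exp_add, ← Real.exp_add, hτ]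
    congr 1
    ring
  rw [← mul_assoc, ← e, div_mul_eq_mul_div, Nat.cast_mul, Nat.cast_succ, Nat.cast_succ,
    mul_comm ((M : ℝ) + 1), mul_right_comm]

end Estimates

end Spiral

end

/-! ### Conclusion: from reduced representatives to double cosets. -/

theorem mainTheorem9 {X : Type*} [MetricSpace X] [ProperSpace X] (hX : Spiral.IsCATNegOne X)
    (Γ Γ₀ : Subgroup (X ≃ᵢ X)) (hΓ : Spiral.IsDiscreteGroup Γ)
    (hΓne : Spiral.IsNonElementary Γ)
    (hle : Γ₀ ≤ Γ) (hmal : Spiral.IsAlmostMalnormal Γ₀ Γ)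
    (hcc : Spiral.IsConvexCocompact Γ₀) (hindex : Γ₀.relIndex Γ = 0)
    (x₀ : X) (hx₀ : x₀ ∈ Spiral.groupHull Γ₀)
    (δ δ₀ : ℝ) (hfin : Spiral.criticalExponent Γ x₀ ≠ ⊤)
    (hδ : δ = (Spiral.criticalExponent Γ x₀).toReal)
    (hδ₀ : δ₀ = (Spiral.criticalExponent Γ₀ x₀).toReal)
    (μ : X → Measure (Spiral.Boundary X)) (hμ : Spiral.IsConformalDensity Γ δ μ)
    (hμ0 : μ x₀ ≠ 0) :
    ∃ c c' : ℝ, 0 < c ∧ 0 < c' ∧ ∀ γ ∈ Γ, γ ∉ Γ₀ → ∀ ε : ℝ, 0 < ε →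
      ε ≤ c' * Real.exp (-Spiral.cosetDepth Γ₀ γ) →
      ENNReal.ofReal (1 / c * Real.exp (-δ₀ * Spiral.cosetDepth Γ₀ γ) * ε ^ (δ - δ₀)) ≤
          Spiral.quotMeasure Γ₀ μ x₀ (Spiral.cosetNhd Γ₀ γ ε) ∧
        Spiral.quotMeasure Γ₀ μ x₀ (Spiral.cosetNhd Γ₀ γ ε) ≤
          ENNReal.ofReal (c * Real.exp (-δ₀ * Spiral.cosetDepth Γ₀ γ) * ε ^ (δ - δ₀)) := by
  open Spiral in
  by_cases hex : ∃ γ ∈ Γ, γ ∉ Γ₀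
  swap
  · push Not at hex
    exact ⟨1, 1, one_pos, one_pos, fun γ hγ hγ₀ => absurd (hex γ hγ) hγ₀⟩
  obtain ⟨g, hg, hg₀⟩ := hex
  obtain ⟨R, hC⟩ := isCore_groupHull hcc hx₀
  have hR := hC.nonneg
  have hδ0 : 0 ≤ δ := hδ ▸ ENNReal.toReal_nonneg
  have hδ₀0 : 0 ≤ δ₀ := hδ₀ ▸ ENNReal.toReal_nonneg
  have hpos := measure_nearSet_ne_zero hX hΓ hle hmal hC hδ0 hμ hμ0 hg hg₀
  set A := 2 * R + 1 with hA
  obtain ⟨B, hB0, hB⟩ := exists_uniform_gp_bound hX hΓ hle hmal hC A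
  obtain ⟨k, E, hk, hup⟩ := exists_quotMeasure_cosetNhd_le hX hΓ hle hC (A := A) (B := B)
    (criticalExponent_ne_top_of_le hle hfin) hδ0 hμ
    (tsum_poincareTerm_subgroup_ne_top hX hΓ hle hδ0 hμ hpos)
  obtain ⟨k', E', hk', hlow⟩ := exists_le_quotMeasure_cosetNhd hX hΓ hle hmal hC hcc.1
    (A := A) (by linarith) hB0 hδ0 hμ hpos
  rw [← hδ₀] at hup hlow
  -- The depth D and the length of the reduced representative satisfy D ≤ length ≤ D + A. This costs
  -- a factor exp(δ₀A) in the lower bound only, and a shift A in the range of ε.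
  refine ⟨k + Real.exp (δ₀ * A) / k', Real.exp (-(max E E' + A)), by positivity,
    Real.exp_pos _, fun γ hγ hγ₀ ε hε hεle => ?_⟩
  obtain ⟨α, hα, β, hβ, hred, hD1, hD2⟩ := exists_isReduced hC γ
  have hγ' : α * γ * β ∈ Γ := Γ.mul_mem (Γ.mul_mem (hle hα) hγ) (hle hβ)
  have hγ₀' : α * γ * β ∉ Γ₀ := fun h =>
    hγ₀ ((Subgroup.mul_mem_cancel_left _ hα).1 ((Subgroup.mul_mem_cancel_right _ hβ).1 h))
  have hN : cosetNhd Γ₀ (α * γ * β) ε = cosetNhd Γ₀ γ ε := by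
    rw [cosetNhd, cosetLimitSet_mul γ hα hβ, cosetNhd]
  change cosetDepth Γ₀ γ ≤ _ at hD1
  change _ ≤ cosetDepth Γ₀ γ + A at hD2
  rw [← Real.exp_add, ← Real.log_le_iff_le_exp hε] at hεle
  have m1 := le_max_left E E'
  have m2 := le_max_right E E'
  have hB' := hB _ hγ' hγ₀' hred
  have h1 := hup _ hγ' hred hB' ε hε (by linarith)
  have h2 := hlow _ hγ' hγ₀' hred hB' ε hε (by linarith)
  rw [hN, Real.exp_add] at h1 h2
  rw [Real.rpow_def_of_pos hε, mul_comm (Real.log ε)]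
  set D := cosetDepth Γ₀ γ
  set l := len x₀ (α * γ * β)
  have e1 : Real.exp (-δ₀ * l) ≤ Real.exp (-δ₀ * D) := Real.exp_le_exp.2 (by nlinarith)
  have e2 : Real.exp (-δ₀ * D) ≤ Real.exp (δ₀ * A) * Real.exp (-δ₀ * l) := by
    rw [← Real.exp_add]
    exact Real.exp_le_exp.2 (by nlinarith)
  refine ⟨(ENNReal.ofReal_le_ofReal ?_).trans h2, h1.trans (ENNReal.ofReal_le_ofReal ?_)⟩
  · rw [← mul_assoc]
    refine mul_le_mul_of_nonneg_right ?_ (Real.exp_pos _).le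
    rw [one_div, inv_mul_le_iff₀ (by positivity)]
    have e3 : Real.exp (δ₀ * A) / k' * (k' * Real.exp (-δ₀ * l)) =
        Real.exp (δ₀ * A) * Real.exp (-δ₀ * l) := by field_simp
    have e4 : 0 ≤ k * (k' * Real.exp (-δ₀ * l)) := by positivity
    linarith
  · rw [← mul_assoc]
    refine mul_le_mul_of_nonneg_right ?_ (Real.exp_pos _).le
    refine mul_le_mul ?_ e1 (Real.exp_pos _).le (by positivity)
    exact le_add_of_nonneg_right (by positivity)
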